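/- Let $J=\begin{pmatrix}0&1\\-1&0\end{pmatrix}$, $\sigma_1=\begin{pmatrix}0&1\\1&0\end{pmatrix}$, $\sigma_2=iJ=\begin{pmatrix}0&i\\-i&0\end{pmatrix}$, $\sigma_3=\begin{pmatrix}1&0\\0&-1\end{pmatrix}$, and let $\mathbb I$ be the $2\times2$ identity matrix. Let $Q=\begin{pmatrix}q_1&q\\ \overline q&q_2\end{pmatrix}:\mathbb R\to M_2(\mathbb C)$ be Hermitian ($q_1,q_2$ real valued, $q$ complex valued), $\pi$-periodic, and integrable on $[0,\pi)$. For $\lambda\in\mathbb C$ let $\mathbb Y(\cdot,\lambda)$ be the matrix solution on $\mathbb R$, with entries absolutely continuous on compact intervals, of $$J\,\mathbb Y'+Q\,\mathbb Y=\lambda\,\mathbb Y\quad\text{a.e.},\qquad \mathbb Y(0,\lambda)=\mathbb I,$$ and let $\Delta(\lambda)=\operatorname{tr}\mathbb Y(\pi,\lambda)$. Write $Q=Q_1+Q_2$ with $$Q_1=\operatorname{Re}(q)\,\sigma_1+\tfrac12(q_1-q_2)\,\sigma_3,\qquad Q_2=\tfrac12(q_1+q_2)\,\mathbb I+\operatorname{Im}(q)\,\sigma_2,$$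 and put $$R(z)=\exp\Big(J\int_0^z\Big(Q_2(t)-\frac1\pi\int_0^\pi Q_2\,d\tau\Big)dt\Big),\qquad \tilde Q(z)=R(z)^{-1}Q_1(z)R(z)+\frac1\pi\int_0^\pi Q_2\,dt .$$ Say that an analytic function has only double zeros if each of its zeros in $\mathbb C$ has order exactly $2$. Then: (a) If $Q(z+\frac\pi2)=Q(z)$ for a.e. $z\in\mathbb R$, then $\lambda\mapsto\Delta(\lambda)+2e^{-i\int_0^\pi\operatorname{Im}q\,dt}$ has only double zeros. (b) If $\lambda\mapsto\Delta(\lambda)+2e^{-i\int_0^\pi\operatorname{Im}q\,dt}$ has only double zeros, then $\tilde Q(z+\frac\pi2)=\tilde Q(z)$ for a.e. $z\in\mathbb R$. -/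

import Mathlib

namespace DiracSystem

/-! ### Existence of solutions of linear equations with locally integrable coefficients -/

open MeasureTheory intervalIntegral Set in
theorem integral_mul_pow_primitive (a : ℝ → ℝ) (ha : ∀ x y, IntervalIntegrable a volume x y)
    (n : ℕ) (z : ℝ) :
    ∫ t in (0 : ℝ)..z, a t * (∫ s in (0 : ℝ)..t, a s) ^ n
      = (∫ s in (0 : ℝ)..z, a s) ^ (n + 1) / (n + 1) := by
  set α : ℝ → ℝ := fun t => ∫ s in (0 : ℝ)..t, a s with hα
  have hac : AbsolutelyContinuousOnInterval α 0 z :=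
    (ha 0 z).absolutelyContinuousOnInterval_intervalIntegral (by simp)
  have hpow : ∀ m : ℕ, AbsolutelyContinuousOnInterval (fun t => α t ^ (m + 1)) 0 z := by
    intro m
    induction m with
    | zero => simpa using hac
    | succ k ih =>
      have := ih.fun_mul hac
      simpa [pow_succ] using this
  have h1 := (hpow n).integral_deriv_eq_sub
  have h0 : α 0 = 0 := by simp [hα]
  have h2 : ∫ t in (0 : ℝ)..z, deriv (fun t => α t ^ (n + 1)) t
      = ∫ t in (0 : ℝ)..z, (n + 1 : ℝ) * (a t * α t ^ n) := by
    apply intervalIntegral.integral_congr_ae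
    filter_upwards [(ha 0 z).ae_hasDerivAt_integral] with t ht htz
    have hd : HasDerivAt α (a t) t := ht (uIoc_subset_uIcc htz) 0 (by simp)
    have := (hd.fun_pow (n + 1)).deriv
    rw [this]
    push_cast
    ring_nf
    try simp
  rw [h2, intervalIntegral.integral_const_mul, h0] at h1
  have hn : (n + 1 : ℝ) ≠ 0 := by positivity
  simp only [ne_eq, Nat.add_eq_zero_iff, one_ne_zero, and_false, not_false_eq_true, zero_pow,
    sub_zero] at h1
  rw [eq_div_iff hn, ← h1]
  ring

open MeasureTheory intervalIntegral Set Filter in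
theorem exists_volterra {E : Type*} [NormedRing E] [NormedAlgebra ℝ E] [CompleteSpace E]
    (A : ℝ → E) (hA : ∀ x y, IntervalIntegrable A volume x y) :
    ∃ Y : ℝ → E, Continuous Y ∧ ∀ z, Y z = 1 + ∫ t in (0 : ℝ)..z, A t * Y t := by
  set a : ℝ → ℝ := fun t => ‖A t‖ with ha_def
  have ha : ∀ x y, IntervalIntegrable a volume x y := fun x y => (hA x y).norm
  set α : ℝ → ℝ := fun t => ∫ s in (0 : ℝ)..t, a s with hα
  have hαc : Continuous α := intervalIntegral.continuous_primitive ha 0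
  let u : ℕ → ℝ → E := fun n =>
    Nat.rec (fun _ => 1) (fun _ v z => ∫ t in (0 : ℝ)..z, A t * v t) n
  have hu0 : ∀ z, u 0 z = 1 := fun z => rfl
  have hus : ∀ n z, u (n + 1) z = ∫ t in (0 : ℝ)..z, A t * u n t := fun n z => rfl
  have hmul : ∀ v : ℝ → E, Continuous v → ∀ x y, IntervalIntegrable (fun t => A t * v t) volume x y :=
    fun v hv x y => (hA x y).mul_continuousOn hv.continuousOn
  have huc : ∀ n, Continuous (u n) := by
    intro n
    induction n with
    | zero => exact continuous_const
    | succ k ih => exact intervalIntegral.continuous_primitive (hmul _ ih) 0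
  set C : ℝ := ‖(1 : E)‖ with hC
  have hbound : ∀ n z, ‖u n z‖ ≤ C * (|α z| ^ n / n.factorial) := by
    intro n
    induction n with
    | zero => intro z; simp [hu0, hC]
    | succ k ih =>
      intro z
      have hbi : IntervalIntegrable (fun t => a t * (C * (|α t| ^ k / k.factorial))) volume 0 z :=
        (ha 0 z).mul_continuousOn (by fun_prop)
      have h1 : ‖u (k + 1) z‖ ≤ |∫ t in (0 : ℝ)..z, a t * (C * (|α t| ^ k / k.factorial))| := by
        rw [hus]
        refine intervalIntegral.norm_integral_le_abs_of_norm_le ?_ hbi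
        refine Eventually.of_forall fun t => ?_
        calc ‖A t * u k t‖ ≤ ‖A t‖ * ‖u k t‖ := norm_mul_le _ _
          _ ≤ _ := mul_le_mul_of_nonneg_left (ih t) (norm_nonneg _)
      refine h1.trans ?_
      obtain ⟨s, hs, hst⟩ : ∃ s : ℝ, |s| = 1 ∧ ∀ t ∈ uIcc 0 z, |α t| = s * α t := by
        rcases le_total 0 z with hz | hz
        · refine ⟨1, by simp, fun t ht => ?_⟩
          rw [uIcc_of_le hz] at ht
          rw [one_mul, abs_of_nonneg]
          exact intervalIntegral.integral_nonneg ht.1 fun _ _ => norm_nonneg _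
        · refine ⟨-1, by simp, fun t ht => ?_⟩
          rw [uIcc_of_ge hz] at ht
          rw [neg_one_mul, abs_of_nonpos]
          change (∫ s in (0 : ℝ)..t, a s) ≤ 0
          rw [intervalIntegral.integral_symm]
          exact neg_nonpos.mpr (intervalIntegral.integral_nonneg ht.2 fun _ _ => norm_nonneg _)
      have h2 : ∫ t in (0 : ℝ)..z, a t * (C * (|α t| ^ k / k.factorial))
          = (C / k.factorial * s ^ k) * ∫ t in (0 : ℝ)..z, a t * α t ^ k := by
        rw [← intervalIntegral.integral_const_mul]
        refine intervalIntegral.integral_congr fun t ht => ?_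
        rw [hst t ht]
        ring
      rw [h2, integral_mul_pow_primitive a ha k z]
      rw [abs_mul, abs_mul, abs_pow, hs, one_pow, mul_one, abs_div, abs_div, abs_pow]
      rw [abs_of_nonneg (norm_nonneg (1 : E)), abs_of_nonneg (by positivity : (0 : ℝ) ≤ k.factorial),
        abs_of_nonneg (by positivity : (0 : ℝ) ≤ (k : ℝ) + 1)]
      apply le_of_eq
      rw [Nat.factorial_succ]
      push_cast
      have : (k.factorial : ℝ) ≠ 0 := by positivity
      have : (k : ℝ) + 1 ≠ 0 := by positivity
      field_simp
      rfl
  have hloc : ∀ r : ℝ, ∃ M : ℝ, 0 ≤ M ∧ ∀ n, ∀ z ∈ Icc (-r) r, ‖u n z‖ ≤ C * (M ^ n / n.factorial) := by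
    intro r
    obtain ⟨M, hM⟩ := (isCompact_Icc (a := -r) (b := r)).exists_bound_of_continuousOn hαc.continuousOn
    refine ⟨max M 0, le_max_right _ _, fun n z hz => (hbound n z).trans ?_⟩
    have : |α z| ≤ max M 0 := (hM z hz).trans (le_max_left _ _)
    gcongr
  have hsumm : ∀ M : ℝ, Summable fun n : ℕ => C * (M ^ n / n.factorial) :=
    fun M => (Real.summable_pow_div_factorial M).mul_left C
  have hYsum : ∀ z, HasSum (fun n => u n z) (∑' n, u n z) := by
    intro z
    obtain ⟨M, -, hM⟩ := hloc |z|
    exact (Summable.of_norm_bounded (hsumm M)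
      fun n => hM n z ⟨neg_abs_le z, le_abs_self z⟩).hasSum
  refine ⟨fun z => ∑' n, u n z, ?_, fun z => ?_⟩
  · rw [continuous_iff_continuousAt]
    intro z
    obtain ⟨M, -, hM⟩ := hloc (|z| + 1)
    have hc : ContinuousOn (fun z => ∑' n, u n z) (Icc (-(|z| + 1)) (|z| + 1)) :=
      continuousOn_tsum (fun n => (huc n).continuousOn) (hsumm M) hM
    refine hc.continuousAt (Icc_mem_nhds ?_ ?_)
    · linarith [neg_abs_le z]
    · linarith [le_abs_self z]
  · obtain ⟨M, hM0, hM⟩ := hloc |z|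
    have hsub : ∀ t ∈ uIoc 0 z, t ∈ Icc (-|z|) |z| := by
      intro t ht
      have h := uIoc_subset_uIcc ht
      rcases le_total 0 z with hz | hz
      · rw [uIcc_of_le hz] at h
        rw [abs_of_nonneg hz]
        exact ⟨by linarith [h.1], h.2⟩
      · rw [uIcc_of_ge hz] at h
        rw [abs_of_nonpos hz]
        exact ⟨by linarith [h.1], by linarith [h.2]⟩
    have hint : HasSum (fun n => ∫ t in (0 : ℝ)..z, A t * u n t)
        (∫ t in (0 : ℝ)..z, A t * ∑' n, u n t) := by
      refine intervalIntegral.hasSum_integral_of_dominated_convergence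
        (fun n t => a t * (C * (M ^ n / n.factorial))) (fun n => ?_) (fun n => ?_) ?_ ?_ ?_
      · exact (hmul _ (huc n) 0 z).def'.aestronglyMeasurable
      · exact Eventually.of_forall fun t ht => (norm_mul_le _ _).trans
          (mul_le_mul_of_nonneg_left (hM n t (hsub t ht)) (norm_nonneg _))
      · exact Eventually.of_forall fun t _ => (hsumm M).mul_left _
      · simp_rw [tsum_mul_left]
        exact (ha 0 z).mul_const _
      · exact Eventually.of_forall fun t _ => (hYsum t).mul_left _
    have h1 : HasSum (fun n => u (n + 1) z) (∫ t in (0 : ℝ)..z, A t * ∑' n, u n t) := hint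
    have h2 := (hYsum z).summable.tsum_eq_zero_add
    rw [h1.tsum_eq, hu0] at h2
    exact h2

theorem absolutelyContinuous_primitive {E : Type*} [NormedAddCommGroup E] [NormedSpace ℝ E]
    (f : ℝ → E) (hf : ∀ x y, IntervalIntegrable f MeasureTheory.volume x y) (x y : ℝ) :
    AbsolutelyContinuousOnInterval (fun z => ∫ t in (0 : ℝ)..z, f t) x y := by
  have hn : ∀ x y, IntervalIntegrable (fun t => ‖f t‖) MeasureTheory.volume x y :=
    fun x y => (hf x y).norm
  have hG : AbsolutelyContinuousOnInterval (fun z => ∫ t in x..z, ‖f t‖) x y :=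
    (hn x y).absolutelyContinuousOnInterval_intervalIntegral (by simp)
  refine squeeze_zero (fun e => Finset.sum_nonneg fun i _ => dist_nonneg) (fun e => ?_) hG
  refine Finset.sum_le_sum fun i _ => ?_
  rw [dist_eq_norm, dist_eq_norm, intervalIntegral.integral_interval_sub_left (hf _ _) (hf _ _),
    intervalIntegral.integral_interval_sub_left (hn _ _) (hn _ _), Real.norm_eq_abs]
  exact intervalIntegral.norm_integral_le_abs_integral_norm

/-! ### The system `J Y' + Q Y = λ Y` -/

/-- The symplectic matrix `J`. -/
def J : Matrix (Fin 2) (Fin 2) ℂ := !![0, 1; -1, 0]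

/-- The Pauli matrix `σ₁`. -/
def sigma1 : Matrix (Fin 2) (Fin 2) ℂ := !![0, 1; 1, 0]

/-- The Pauli matrix `σ₂`, with the sign convention `σ₂ = i J`. -/
def sigma2 : Matrix (Fin 2) (Fin 2) ℂ := !![0, Complex.I; -Complex.I, 0]

/-- The Pauli matrix `σ₃`. -/
def sigma3 : Matrix (Fin 2) (Fin 2) ℂ := !![1, 0; 0, -1]

/-- `Y` is the matrix solution on `ℝ` of `J Y' + Q Y = lam Y` with `Y 0 = 𝕀`, in the sense of
Carathéodory: its entries are absolutely continuous on every compact interval and the equation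
holds almost everywhere. -/
structure IsFundamentalMatrix (Q : ℝ → Matrix (Fin 2) (Fin 2) ℂ) (lam : ℂ)
    (Y : ℝ → Matrix (Fin 2) (Fin 2) ℂ) : Prop where
  absolutelyContinuous : ∀ (i j : Fin 2) (a b : ℝ),
    AbsolutelyContinuousOnInterval (fun z => Y z i j) a b
  equation : ∀ᵐ z : ℝ, ∃ Y' : Matrix (Fin 2) (Fin 2) ℂ,
    (∀ i j, HasDerivAt (fun t => Y t i j) (Y' i j) z) ∧ J * Y' + Q z * Y z = lam • Y z
  initial : Y 0 = 1

section
open MeasureTheory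

theorem exists_isFundamentalMatrix (Q : ℝ → Matrix (Fin 2) (Fin 2) ℂ)
    (hper : Function.Periodic Q Real.pi)
    (hint : ∀ i j, IntegrableOn (fun z => Q z i j) (Set.Ico 0 Real.pi)) (lam : ℂ) :
    ∃ Y, IsFundamentalMatrix Q lam Y := by
  have hQij : ∀ i j x y, IntervalIntegrable (fun z => Q z i j) volume x y := by
    intro i j x y
    have hp : Function.Periodic (fun z => Q z i j) Real.pi := fun z => by simp only [hper z]
    refine hp.intervalIntegrable₀ Real.pi_ne_zero ?_ x y
    rw [intervalIntegrable_iff_integrableOn_Ico_of_le Real.pi_pos.le]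
    exact hint i j
  set A : ℝ → Matrix (Fin 2) (Fin 2) ℂ := fun z => J * (Q z - lam • 1) with hAdef
  have hAij : ∀ i j x y, IntervalIntegrable (fun z => A z i j) volume x y := by
    intro i j x y
    have h : (fun z => A z i j) = fun z => J i 0 * (Q z 0 j - (lam • (1 : Matrix (Fin 2) (Fin 2) ℂ)) 0 j)
        + J i 1 * (Q z 1 j - (lam • (1 : Matrix (Fin 2) (Fin 2) ℂ)) 1 j) := by
      funext z
      simp [hAdef, Matrix.mul_apply, Fin.sum_univ_two]
    rw [h]
    exact (((hQij 0 j x y).sub intervalIntegrable_const).const_mul _).add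
      (((hQij 1 j x y).sub intervalIntegrable_const).const_mul _)
  -- Matrices are viewed as operators on `ℂ²`, in order to have a complete normed algebra.
  let m : Matrix (Fin 2) (Fin 2) ℂ → ((Fin 2 → ℂ) →L[ℂ] (Fin 2 → ℂ)) := fun M =>
    LinearMap.toContinuousLinearMap (Matrix.toLin' M)
  have hmA : ∀ x y, IntervalIntegrable (fun z => m (A z)) volume x y := by
    intro x y
    have h : (fun z => m (A z)) = fun z => ∑ i, ∑ j, (A z i j) • m (Matrix.single i j 1) := by
      funext z
      conv_lhs => rw [Matrix.matrix_eq_sum_single (A z)]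
      simp only [m, map_sum, ← map_smul, Matrix.smul_single, smul_eq_mul, mul_one]
    rw [h]
    have h2 : ∀ i j : Fin 2, IntervalIntegrable
        (fun z => (A z i j) • m (Matrix.single i j (1 : ℂ))) volume x y :=
      fun i j => ⟨(hAij i j x y).1.smul_const _, (hAij i j x y).2.smul_const _⟩
    simp only [Fin.sum_univ_two]
    exact ((h2 0 0).add (h2 0 1)).add ((h2 1 0).add (h2 1 1))
  obtain ⟨T, hTc, hT⟩ := exists_volterra (fun z => m (A z)) hmA
  have hAT : ∀ x y, IntervalIntegrable (fun t => m (A t) * T t) volume x y :=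
    fun x y => (hmA x y).mul_continuousOn hTc.continuousOn
  let L : Fin 2 → Fin 2 → ((Fin 2 → ℂ) →L[ℂ] (Fin 2 → ℂ)) →L[ℂ] ℂ := fun i j =>
    (ContinuousLinearMap.proj i).comp (ContinuousLinearMap.apply ℂ (Fin 2 → ℂ) (Pi.single j 1))
  let Y : ℝ → Matrix (Fin 2) (Fin 2) ℂ := fun z => LinearMap.toMatrix' (T z : (Fin 2 → ℂ) →ₗ[ℂ] _)
  have hLY : ∀ i j z, L i j (T z) = Y z i j := by
    intro i j z
    simp [L, Y, LinearMap.toMatrix'_apply]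
  have hLAT : ∀ i j z, L i j (m (A z) * T z) = (A z * Y z) i j := by
    intro i j z
    have : A z * Y z = LinearMap.toMatrix' ((m (A z) * T z : _ →L[ℂ] _) : (Fin 2 → ℂ) →ₗ[ℂ] _) := by
      change _ = LinearMap.toMatrix' ((Matrix.toLin' (A z)) ∘ₗ (T z : (Fin 2 → ℂ) →ₗ[ℂ] _))
      rw [LinearMap.toMatrix'_comp, LinearMap.toMatrix'_toLin']
    rw [this]
    simp [L, LinearMap.toMatrix'_apply]
  have hfint : ∀ i j x y, IntervalIntegrable (fun t => (A t * Y t) i j) volume x y := by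
    intro i j x y
    simp_rw [← hLAT]
    exact ⟨(L i j).integrable_comp (hAT x y).1, (L i j).integrable_comp (hAT x y).2⟩
  have hentry : ∀ i j, (fun z => Y z i j)
      = fun z => (1 : Matrix (Fin 2) (Fin 2) ℂ) i j + ∫ t in (0 : ℝ)..z, (A t * Y t) i j := by
    intro i j
    funext z
    have h := (L i j).intervalIntegral_comp_comm (hAT 0 z)
    simp only [hLAT] at h
    rw [h, ← hLY, hT z, map_add]
    congr 1
    simp [L, Matrix.one_apply, Pi.single_apply]
  refine ⟨Y, ⟨fun i j a b => ?_, ?_, ?_⟩⟩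
  · rw [hentry i j]
    refine AbsolutelyContinuousOnInterval.fun_add ?_ (absolutelyContinuous_primitive _ (hfint i j) a b)
    exact (LipschitzWith.const' (K := 0) _).lipschitzOnWith.absolutelyContinuousOnInterval
  · have hd : ∀ i j, ∀ᵐ z : ℝ, HasDerivAt (fun t => Y t i j) ((A z * Y z) i j) z := by
      intro i j
      have hloc : LocallyIntegrable (fun t => (A t * Y t) i j) volume := by
        rw [locallyIntegrable_iff]
        intro K hK
        obtain ⟨r, hr⟩ := hK.isBounded.subset_closedBall 0
        have : K ⊆ Set.Icc (-r) r := by simpa [Real.closedBall_eq_Icc] using hr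
        rcases le_or_gt (-r) r with h | h
        · refine IntegrableOn.mono_set ?_ this
          rw [integrableOn_Icc_iff_integrableOn_Ioc,
            ← intervalIntegrable_iff_integrableOn_Ioc_of_le h]
          exact hfint i j _ _
        · rw [Set.Icc_eq_empty (not_le.mpr h), Set.subset_empty_iff] at this
          simp [this]
      filter_upwards [LocallyIntegrable.ae_hasDerivAt_integral hloc] with z hz
      rw [hentry i j]
      exact (hz 0).const_add _
    have hall : ∀ᵐ z : ℝ, ∀ i j, HasDerivAt (fun t => Y t i j) ((A z * Y z) i j) z :=
      ae_all_iff.mpr fun i => ae_all_iff.mpr fun j => hd i j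
    filter_upwards [hall] with z hz
    refine ⟨A z * Y z, hz, ?_⟩
    have hJ : J * J = -1 := by
      ext i j; fin_cases i <;> fin_cases j <;> simp [J, Matrix.mul_apply]
    rw [hAdef]
    simp only
    rw [← mul_assoc, ← mul_assoc, hJ]
    simp [sub_mul]
  · ext i j
    have := congrFun (hentry i j) 0
    simpa using this

end

/-- The fundamental matrix `𝕐(z)` of `J Y' + Q Y = lam Y`, normalised by `𝕐(0) = 𝕀`. For periodic
locally integrable `Q` it exists by `exists_isFundamentalMatrix`, and it is the only one, since the
initial value problem is linear with locally integrable coefficients. -/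
noncomputable def fundamentalMatrix (Q : ℝ → Matrix (Fin 2) (Fin 2) ℂ) (lam : ℂ) :
    ℝ → Matrix (Fin 2) (Fin 2) ℂ :=
  Classical.epsilon (IsFundamentalMatrix Q lam)

theorem isFundamentalMatrix_fundamentalMatrix (Q : ℝ → Matrix (Fin 2) (Fin 2) ℂ)
    (hper : Function.Periodic Q Real.pi)
    (hint : ∀ i j, MeasureTheory.IntegrableOn (fun z => Q z i j) (Set.Ico 0 Real.pi)) (lam : ℂ) :
    IsFundamentalMatrix Q lam (fundamentalMatrix Q lam) :=
  Classical.epsilon_spec (exists_isFundamentalMatrix Q hper hint lam)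

/-- The discriminant `Δ(lam) = y₁₁(π) + y₂₂(π)`, the trace of `𝕐(π)`. -/
noncomputable def discriminant (Q : ℝ → Matrix (Fin 2) (Fin 2) ℂ) (lam : ℂ) : ℂ :=
  (fundamentalMatrix Q lam Real.pi).trace

/-- Every zero of `f` is a zero of order exactly two (in particular `f` is analytic there). -/
def OnlyDoubleZeros (f : ℂ → ℂ) : Prop :=
  ∀ lam : ℂ, f lam = 0 → analyticOrderAt f lam = 2

/-! ### The `J`-decomposition of the potential and the gauge transformation

Throughout `Q = !![q₁, q; q*, q₂]`, so that `q₁ = Q 0 0`, `q = Q 0 1` and `q₂ = Q 1 1`. -/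

/-- The part `Q₁ = Re(q) σ₁ + ½ (q₁ - q₂) σ₃` of `Q`, which anticommutes with `J`. -/
noncomputable def Q1 (Q : ℝ → Matrix (Fin 2) (Fin 2) ℂ) (z : ℝ) : Matrix (Fin 2) (Fin 2) ℂ :=
  ((Q z 0 1).re : ℂ) • sigma1 + ((Q z 0 0 - Q z 1 1) / 2) • sigma3

/-- The part `Q₂ = ½ (q₁ + q₂) σ₀ + Im(q) σ₂` of `Q`, which commutes with `J`. -/
noncomputable def Q2 (Q : ℝ → Matrix (Fin 2) (Fin 2) ℂ) (z : ℝ) : Matrix (Fin 2) (Fin 2) ℂ :=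
  ((Q z 0 0 + Q z 1 1) / 2) • (1 : Matrix (Fin 2) (Fin 2) ℂ) + ((Q z 0 1).im : ℂ) • sigma2

/-- The entrywise integral of a matrix function over `[a, b]`. -/
noncomputable def matrixIntegral (M : ℝ → Matrix (Fin 2) (Fin 2) ℂ) (a b : ℝ) :
    Matrix (Fin 2) (Fin 2) ℂ :=
  Matrix.of fun i j => ∫ t in a..b, M t i j

/-- The mean value `π⁻¹ ∫₀^π Q₂`. -/
noncomputable def meanQ2 (Q : ℝ → Matrix (Fin 2) (Fin 2) ℂ) : Matrix (Fin 2) (Fin 2) ℂ :=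
  (1 / (Real.pi : ℂ)) • matrixIntegral (Q2 Q) 0 Real.pi

/-- The gauge matrix `R(z) = exp (J ∫₀^z (Q₂ - π⁻¹ ∫₀^π Q₂))`. -/
noncomputable def gaugeMatrix (Q : ℝ → Matrix (Fin 2) (Fin 2) ℂ) (z : ℝ) : Matrix (Fin 2) (Fin 2) ℂ :=
  NormedSpace.exp (J * matrixIntegral (fun t => Q2 Q t - meanQ2 Q) 0 z)

/-- The transformed potential `Q̃ = Q̃₁ + Q̃₂` with `Q̃₁ = R⁻¹ Q₁ R` and `Q̃₂ = π⁻¹ ∫₀^π Q₂`. -/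
noncomputable def transformedPotential (Q : ℝ → Matrix (Fin 2) (Fin 2) ℂ) (z : ℝ) :
    Matrix (Fin 2) (Fin 2) ℂ :=
  (gaugeMatrix Q z)⁻¹ * Q1 Q z * gaugeMatrix Q z + meanQ2 Q

/-- The unimodular constant `exp (-i ∫₀^π Im q)`. -/
noncomputable def phase (Q : ℝ → Matrix (Fin 2) (Fin 2) ℂ) : ℂ :=
  Complex.exp (-Complex.I * ((∫ t in (0 : ℝ)..Real.pi, (Q t 0 1).im : ℝ) : ℂ))

end DiracSystem

/-! The system is first gauged to a traceless real symmetric one. `Q2` commutes with `J`: its trace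
part generates a rotation by `angle Q`, and its `Im q` part only a scalar exponential. Removing both
(`gauge_mul_isFundamentalMatrix`) leaves a potential `V = v σ₁ + w σ₃` (`gaugedPotential`) and a
spectral parameter shifted by the mean of `halfTrace Q`. The angle vanishes at `π`, so the function
in the theorem is, up to a nonzero factor and a translation, `G = tr Y(π) + 2` for `V`
(`discriminant_add_eq`), while `transformedPotential` is `V` plus a constant matrix. Both claims
thus become claims about `V` and the half-period `π / 2`.

Let `A` and `B` be the transfer matrices over the first and second half of `[0, π]`, so that `Y(π) =
B A` and both have determinant 1. If `V` has period `π / 2`, then `A = B` and `G = (tr A)²`. At a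
zero of `tr A` the multipliers are `±i`, so the spectral parameter is real by Lagrange's identity
(`im_eq_zero_of_multiplier`). At a real point where the trace lies in `[-2, 2]` and is critical,
positivity of the Gram matrix of the solutions forces a scalar matrix (`sol_scalar_of_critical`). A
scalar matrix of trace 0 cannot have determinant 1, so the zeros of `tr A` are simple and those of
`G` double.

Conversely, at a double zero of `G` the same lemma gives `B A = -1`, that is `A = -B⁻¹`. Hence `A₀₁
- B₀₁`, `A₁₀ - B₁₀` and `(A₀₀ - B₀₀) - (A₁₁ - B₁₁)` vanish at all zeros of `G`. For each such
function `N`, the quotient `N² / G` is entire because every zero of `G` has order exactly two. By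
`sol_asymptotics`, `A` and `B` are both asymptotic to the free rotation, so `N` is `o(exp(π |Im λ| /
2))`, whereas `G` has full growth `exp(π |Im λ|)` on large squares that stay away from the zeros of
`cos(πλ/2)`. The maximum principle gives `N = 0`. Then either `A = B` or `G = 0`
(`eq_or_trace_mul_eq`), and the second is impossible far out on the squares.

It remains to recover the potential from its transfer matrix, a uniqueness theorem of Borg type
(`sol_eq_of_monodromy_eq`). At an interior point the quotient of the two fundamental matrices, minus
1 and multiplied by an entry of the common transfer matrix, is negligible against the growth of that
entry, so the same maximum principle annihilates it. Equal solutions have equal coefficients almost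
everywhere (`ae_eq_of_sol_eq`). -/

namespace DiracSystem

/-! ### Calculus of absolutely continuous functions with values in a normed space. -/

section Calculus
open MeasureTheory Set Filter

variable {E : Type*} [NormedAddCommGroup E] [NormedSpace ℝ E]

/-- `F` is absolutely continuous on compact intervals, with locally integrable derivative `f`
almost everywhere. -/
structure HasAEDeriv (F f : ℝ → E) : Prop where
  intervalIntegrable : ∀ x y, IntervalIntegrable f volume x y
  absolutelyContinuous : ∀ x y, AbsolutelyContinuousOnInterval F x y
  hasDerivAt : ∀ᵐ x, HasDerivAt F (f x) x

theorem continuous_of_absolutelyContinuous {X : Type*} [NormedAddCommGroup X] {F : ℝ → X}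
    (h : ∀ x y, AbsolutelyContinuousOnInterval F x y) : Continuous F := by
  rw [continuous_iff_continuousAt]
  intro x
  have h1 := (h (x - 1) (x + 1)).continuousOn
  rw [uIcc_of_le (by linarith)] at h1
  exact h1.continuousAt (Icc_mem_nhds (by linarith) (by linarith))

theorem LipschitzWith.comp_absolutelyContinuous {X Y : Type*} [PseudoMetricSpace X]
    [PseudoMetricSpace Y] {g : X → Y} {K : NNReal} (hg : LipschitzWith K g) {F : ℝ → X} {a b : ℝ}
    (hF : AbsolutelyContinuousOnInterval F a b) :
    AbsolutelyContinuousOnInterval (fun x => g (F x)) a b := by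
  unfold AbsolutelyContinuousOnInterval at hF ⊢
  refine squeeze_zero (fun t => Finset.sum_nonneg fun _ _ => dist_nonneg) (fun t => ?_)
    (by simpa using hF.const_mul (K : ℝ))
  rw [Finset.mul_sum]
  exact Finset.sum_le_sum fun i _ => hg.dist_le_mul _ _

/-- Both factors are bounded on the interval, so each increment of the product splits into two
controlled ones. The order of the factors is kept because the application is to matrices. -/
theorem absolutelyContinuous_mul {A : Type*} [NormedRing A] {F G : ℝ → A} {a b : ℝ}
    (hF : AbsolutelyContinuousOnInterval F a b) (hG : AbsolutelyContinuousOnInterval G a b) :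
    AbsolutelyContinuousOnInterval (fun x => F x * G x) a b := by
  obtain ⟨C, hC⟩ := hF.exists_bound
  obtain ⟨D, hD⟩ := hG.exists_bound
  unfold AbsolutelyContinuousOnInterval at hF hG ⊢
  refine squeeze_zero' (Eventually.of_forall fun _ => Finset.sum_nonneg fun i _ => dist_nonneg) ?_
    (by simpa using (hG.const_mul C).add (hF.const_mul D))
  rw [eventually_inf_principal]
  filter_upwards with p hp
  rw [Finset.mul_sum, Finset.mul_sum, ← Finset.sum_add_distrib]
  refine Finset.sum_le_sum fun i hi => ?_
  have h1 := hC _ (hp.1 i hi).1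
  have h2 := hD _ (hp.1 i hi).2
  rw [dist_eq_norm, dist_eq_norm, dist_eq_norm]
  have e : F (p.2 i).1 * G (p.2 i).1 - F (p.2 i).2 * G (p.2 i).2
      = F (p.2 i).1 * (G (p.2 i).1 - G (p.2 i).2) + (F (p.2 i).1 - F (p.2 i).2) * G (p.2 i).2 := by
    noncomm_ring
  rw [e]
  calc _ ≤ ‖F (p.2 i).1 * (G (p.2 i).1 - G (p.2 i).2)‖
        + ‖(F (p.2 i).1 - F (p.2 i).2) * G (p.2 i).2‖ := norm_add_le _ _
    _ ≤ ‖F (p.2 i).1‖ * ‖G (p.2 i).1 - G (p.2 i).2‖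
        + ‖F (p.2 i).1 - F (p.2 i).2‖ * ‖G (p.2 i).2‖ :=
      add_le_add (norm_mul_le _ _) (norm_mul_le _ _)
    _ ≤ C * ‖G (p.2 i).1 - G (p.2 i).2‖ + D * ‖F (p.2 i).1 - F (p.2 i).2‖ := by
      rw [mul_comm D]
      gcongr

theorem locallyIntegrable_of_intervalIntegrable {X : Type*} [NormedAddCommGroup X] {f : ℝ → X}
    (hf : ∀ x y, IntervalIntegrable f volume x y) : LocallyIntegrable f volume := by
  intro x
  refine ⟨Ioo (x - 1) (x + 1), Ioo_mem_nhds (by linarith) (by linarith), ?_⟩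
  exact ((intervalIntegrable_iff_integrableOn_Ioc_of_le (by linarith)).1
    (hf (x - 1) (x + 1))).mono_set Ioo_subset_Ioc_self

namespace HasAEDeriv

variable {F G f g : ℝ → E}

theorem continuous (h : HasAEDeriv F f) : Continuous F :=
  continuous_of_absolutelyContinuous h.absolutelyContinuous

theorem congr (h : HasAEDeriv F f) (hfg : f =ᵐ[volume] g) : HasAEDeriv F g where
  intervalIntegrable x y := (h.intervalIntegrable x y).congr_ae (ae_restrict_of_ae hfg)
  absolutelyContinuous := h.absolutelyContinuous
  hasDerivAt := by
    filter_upwards [h.hasDerivAt, hfg] with x hx hx'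
    rwa [← hx']

theorem congr' (h : HasAEDeriv F f) (hfg : ∀ x, f x = g x) : HasAEDeriv F g :=
  h.congr (Eventually.of_forall hfg)

theorem const (c : E) : HasAEDeriv (fun _ => c) (fun _ => (0 : E)) where
  intervalIntegrable _ _ := intervalIntegrable_const
  absolutelyContinuous _ _ :=
    (LipschitzWith.const' (K := 0) c).lipschitzOnWith.absolutelyContinuousOnInterval
  hasDerivAt := Eventually.of_forall fun x => hasDerivAt_const x c

theorem add (hF : HasAEDeriv F f) (hG : HasAEDeriv G g) :
    HasAEDeriv (fun x => F x + G x) (fun x => f x + g x) where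
  intervalIntegrable x y := (hF.intervalIntegrable x y).add (hG.intervalIntegrable x y)
  absolutelyContinuous x y := (hF.absolutelyContinuous x y).fun_add (hG.absolutelyContinuous x y)
  hasDerivAt := by
    filter_upwards [hF.hasDerivAt, hG.hasDerivAt] with x h1 h2 using h1.add h2

theorem neg (hF : HasAEDeriv F f) : HasAEDeriv (fun x => -F x) (fun x => -f x) where
  intervalIntegrable x y := (hF.intervalIntegrable x y).neg
  absolutelyContinuous x y := (hF.absolutelyContinuous x y).fun_neg
  hasDerivAt := by filter_upwards [hF.hasDerivAt] with x h1 using h1.neg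

theorem sub (hF : HasAEDeriv F f) (hG : HasAEDeriv G g) :
    HasAEDeriv (fun x => F x - G x) (fun x => f x - g x) := by
  simpa only [sub_eq_add_neg] using hF.add hG.neg

theorem clm {E' : Type*} [NormedAddCommGroup E'] [NormedSpace ℝ E'] (L : E →L[ℝ] E')
    (hF : HasAEDeriv F f) : HasAEDeriv (fun x => L (F x)) (fun x => L (f x)) where
  intervalIntegrable x y := ⟨L.integrable_comp (hF.intervalIntegrable x y).1,
    L.integrable_comp (hF.intervalIntegrable x y).2⟩
  absolutelyContinuous x y :=
    LipschitzWith.comp_absolutelyContinuous L.lipschitz (hF.absolutelyContinuous x y)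
  hasDerivAt := by
    filter_upwards [hF.hasDerivAt] with x h1 using L.hasFDerivAt.comp_hasDerivAt x h1

theorem comp_const_add (hF : HasAEDeriv F f) (s : ℝ) :
    HasAEDeriv (fun x => F (s + x)) (fun x => f (s + x)) where
  intervalIntegrable x y := by
    simpa using (hF.intervalIntegrable (s + x) (s + y)).comp_add_left s
  absolutelyContinuous x y := by
    have h := hF.absolutelyContinuous (s + x) (s + y)
    rw [absolutelyContinuousOnInterval_iff] at h ⊢
    intro ε hε
    obtain ⟨δ, hδ, H⟩ := h ε hε
    refine ⟨δ, hδ, fun p hp hlt => ?_⟩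
    refine H (p.1, fun i => (s + (p.2 i).1, s + (p.2 i).2)) ⟨fun i hi => ?_, ?_⟩ (by simpa using hlt)
    · have := hp.1 i hi
      simp only [mem_uIcc] at this ⊢
      constructor
      · rcases this.1 with h | h
        · left; constructor <;> linarith [h.1, h.2]
        · right; constructor <;> linarith [h.1, h.2]
      · rcases this.2 with h | h
        · left; constructor <;> linarith [h.1, h.2]
        · right; constructor <;> linarith [h.1, h.2]
    · intro i hi j hj hij
      have := hp.2 hi hj hij
      simp only [Function.onFun, Set.disjoint_left] at this ⊢
      intro t ht ht'
      refine this (a := t - s) ?_ ?_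
      · simp only [mem_uIoc] at ht ⊢
        rcases ht with h | h
        · left; constructor <;> linarith [h.1, h.2]
        · right; constructor <;> linarith [h.1, h.2]
      · simp only [mem_uIoc] at ht' ⊢
        rcases ht' with h | h
        · left; constructor <;> linarith [h.1, h.2]
        · right; constructor <;> linarith [h.1, h.2]
  hasDerivAt := by
    have h := (measurePreserving_add_left volume s).quasiMeasurePreserving.ae hF.hasDerivAt
    filter_upwards [h] with x hx
    exact hx.comp_const_add s x

theorem of_hasDerivAt (h : ∀ x, HasDerivAt F (f x) x) (hf : Continuous f) : HasAEDeriv F f where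
  intervalIntegrable x y := hf.intervalIntegrable x y
  absolutelyContinuous x y := by
    refine ContDiffOn.absolutelyContinuousOnInterval (ContDiff.contDiffOn ?_)
    rw [contDiff_one_iff_deriv]
    refine ⟨fun x => (h x).differentiableAt, ?_⟩
    rwa [show deriv F = f from funext fun x => (h x).deriv]
  hasDerivAt := Eventually.of_forall h

/-- Absolute continuity rules out Cantor-type functions. All uniqueness statements for the
differential equations below rest on this. -/
theorem eq_of_zero (h : HasAEDeriv F (fun _ => 0)) (x y : ℝ) : F x = F y := by
  obtain ⟨C, hC⟩ := (h.absolutelyContinuous x y).const_of_ae_hasDerivAt_zero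
    (by filter_upwards [h.hasDerivAt] with t ht _ using ht)
  rw [hC x (by simp), hC y (by simp)]

theorem mul {A : Type*} [NormedRing A] [NormedAlgebra ℝ A] {F G f g : ℝ → A}
    (hF : HasAEDeriv F f) (hG : HasAEDeriv G g) :
    HasAEDeriv (fun x => F x * G x) (fun x => f x * G x + F x * g x) where
  intervalIntegrable x y :=
    ((hF.intervalIntegrable x y).mul_continuousOn hG.continuous.continuousOn).add
      ((hG.intervalIntegrable x y).continuousOn_mul hF.continuous.continuousOn)
  absolutelyContinuous x y :=
    absolutelyContinuous_mul (hF.absolutelyContinuous x y) (hG.absolutelyContinuous x y)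
  hasDerivAt := by
    filter_upwards [hF.hasDerivAt, hG.hasDerivAt] with x h1 h2 using h1.mul h2

variable [CompleteSpace E]

theorem integral (hf : ∀ x y, IntervalIntegrable f volume x y) :
    HasAEDeriv (fun x => ∫ t in (0 : ℝ)..x, f t) f where
  intervalIntegrable := hf
  absolutelyContinuous := absolutelyContinuous_primitive f hf
  hasDerivAt := by
    filter_upwards [LocallyIntegrable.ae_hasDerivAt_integral
      (locallyIntegrable_of_intervalIntegrable hf)] with x hx
    exact hx 0

theorem eq_integral (h : HasAEDeriv F f) (x : ℝ) : F x = F 0 + ∫ t in (0 : ℝ)..x, f t := by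
  have h1 := h.sub (HasAEDeriv.integral h.intervalIntegrable)
  simp only [sub_self] at h1
  have := h1.eq_of_zero x 0
  simp only [intervalIntegral.integral_same, sub_zero] at this
  rw [← this]
  abel

theorem real_sin {F f : ℝ → ℝ} (hF : HasAEDeriv F f) :
    HasAEDeriv (fun x => Real.sin (F x)) (fun x => Real.cos (F x) * f x) where
  intervalIntegrable x y := (hF.intervalIntegrable x y).continuousOn_mul
    (Real.continuous_cos.comp hF.continuous).continuousOn
  absolutelyContinuous x y := by
    refine LipschitzWith.comp_absolutelyContinuous (K := 1) ?_ (hF.absolutelyContinuous x y)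
    refine lipschitzWith_of_nnnorm_deriv_le Real.differentiable_sin fun x => ?_
    rw [← NNReal.coe_le_coe]
    simpa using Real.abs_cos_le_one x
  hasDerivAt := by
    filter_upwards [hF.hasDerivAt] with x h1 using h1.sin

theorem real_cos {F f : ℝ → ℝ} (hF : HasAEDeriv F f) :
    HasAEDeriv (fun x => Real.cos (F x)) (fun x => -Real.sin (F x) * f x) where
  intervalIntegrable x y := (hF.intervalIntegrable x y).continuousOn_mul
    (Real.continuous_sin.comp hF.continuous).neg.continuousOn
  absolutelyContinuous x y := by
    refine LipschitzWith.comp_absolutelyContinuous (K := 1) ?_ (hF.absolutelyContinuous x y)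
    refine lipschitzWith_of_nnnorm_deriv_le Real.differentiable_cos fun x => ?_
    rw [← NNReal.coe_le_coe]
    simpa using Real.abs_sin_le_one x
  hasDerivAt := by
    filter_upwards [hF.hasDerivAt] with x h1 using h1.cos

end HasAEDeriv

/-- Gronwall's inequality with an integrable kernel. -/
theorem le_mul_exp_of_le_add_integral {a u : ℝ → ℝ} (ha : ∀ x y, IntervalIntegrable a volume x y)
    (ha0 : ∀ t, 0 ≤ a t) (hu : Continuous u) {c X : ℝ} (hX : 0 ≤ X)
    (h : ∀ x ∈ Icc 0 X, u x ≤ c + ∫ t in (0 : ℝ)..x, a t * u t) :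
    u X ≤ c * Real.exp (∫ t in (0 : ℝ)..X, a t) := by
  obtain ⟨S, hS⟩ := (isCompact_Icc (a := (0 : ℝ)) (b := X)).exists_bound_of_continuousOn
    hu.continuousOn
  set α : ℝ → ℝ := fun t => ∫ s in (0 : ℝ)..t, a s with hα
  have hαc : Continuous α := intervalIntegral.continuous_primitive ha 0
  -- Iterating the integral inequality produces the Taylor polynomials of `exp (α x)`; the crude
  -- bound `S` on `u` survives only in a remainder that tends to zero. The kernel must be
  -- nonnegative, but no sign of `c` is needed.
  have key : ∀ n : ℕ, ∀ x ∈ Icc 0 X, u x ≤ c * (∑ k ∈ Finset.range n, α x ^ k / k.factorial)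
      + S * (α x ^ n / n.factorial) := by
    intro n
    induction n with
    | zero =>
      intro x hx
      simpa using (le_abs_self _).trans (hS x hx)
    | succ n ih =>
      intro x hx
      refine (h x hx).trans ?_
      have h1 : ∫ t in (0 : ℝ)..x, a t * u t ≤ ∫ t in (0 : ℝ)..x, a t *
          (c * (∑ k ∈ Finset.range n, α t ^ k / k.factorial) + S * (α t ^ n / n.factorial)) := by
        refine intervalIntegral.integral_mono_on hx.1 ?_ ?_ fun t ht => ?_
        · exact (ha 0 x).mul_continuousOn hu.continuousOn
        · exact (ha 0 x).mul_continuousOn (by fun_prop)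
        · exact mul_le_mul_of_nonneg_left (ih t ⟨ht.1, ht.2.trans hx.2⟩) (ha0 t)
      have hm : ∀ k : ℕ, ∫ t in (0 : ℝ)..x, a t * (α t ^ k / k.factorial)
          = α x ^ (k + 1) / (k + 1).factorial := by
        intro k
        have e : ∀ t, a t * (α t ^ k / k.factorial) = (1 / (k.factorial : ℝ)) * (a t * α t ^ k) :=
          fun t => by ring
        simp_rw [e]
        rw [intervalIntegral.integral_const_mul, integral_mul_pow_primitive a ha k x,
          Nat.factorial_succ]
        push_cast
        field_simp
        rfl
      have hi : ∀ k : ℕ, IntervalIntegrable (fun t => a t * (α t ^ k / k.factorial)) volume 0 x :=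
        fun k => (ha 0 x).mul_continuousOn (by fun_prop)
      have h2 : ∫ t in (0 : ℝ)..x, a t *
          (c * (∑ k ∈ Finset.range n, α t ^ k / k.factorial) + S * (α t ^ n / n.factorial))
          = c * (∑ k ∈ Finset.range n, α x ^ (k + 1) / (k + 1).factorial)
            + S * (α x ^ (n + 1) / (n + 1).factorial) := by
        have e : ∀ t, a t * (c * (∑ k ∈ Finset.range n, α t ^ k / k.factorial)
            + S * (α t ^ n / n.factorial))
            = c * (∑ k ∈ Finset.range n, a t * (α t ^ k / k.factorial))
              + S * (a t * (α t ^ n / n.factorial)) := by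
          intro t
          rw [← Finset.mul_sum]
          ring
        simp_rw [e]
        rw [intervalIntegral.integral_add, intervalIntegral.integral_const_mul,
          intervalIntegral.integral_const_mul, intervalIntegral.integral_finsetSum, hm]
        · simp_rw [hm]
        · exact fun k _ => hi k
        · refine IntervalIntegrable.const_mul ?_ _
          have := IntervalIntegrable.sum (Finset.range n) (fun k _ => hi k)
          simpa [Finset.sum_fn] using this
        · exact (hi n).const_mul _
      rw [h2] at h1
      rw [Finset.sum_range_succ']
      simp only [pow_zero, Nat.factorial_zero, Nat.cast_one, div_one]
      linarith
  have hlim : Tendsto (fun n : ℕ => c * (∑ k ∈ Finset.range n, α X ^ k / k.factorial)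
      + S * (α X ^ n / n.factorial)) atTop (nhds (c * Real.exp (α X) + S * 0)) := by
    refine Tendsto.add (Tendsto.const_mul c ?_) (Tendsto.const_mul S ?_)
    · have h := (NormedSpace.expSeries_div_hasSum_exp (α X)).tendsto_sum_nat
      rwa [← Real.exp_eq_exp_ℝ] at h
    · exact FloorSemiring.tendsto_pow_div_factorial_atTop _
  rw [mul_zero, add_zero] at hlim
  exact ge_of_tendsto' hlim fun n => key n X ⟨hX, le_rfl⟩

end Calculus
end DiracSystem

/-! ### The traceless real system, its fundamental matrix and the free system. -/

namespace DiracSystem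
open MeasureTheory Set Filter

open scoped Matrix.Norms.Operator

/-- The topology of the operator norm on matrices. It is the usual one, but displayed as coming from
the norm. -/
@[reducible] noncomputable def normTopology : TopologicalSpace (Matrix (Fin 2) (Fin 2) ℂ) :=
  (inferInstance : PseudoMetricSpace (Matrix (Fin 2) (Fin 2) ℂ)).toUniformSpace.toTopologicalSpace

attribute [local instance] normTopology

section Norm

theorem norm_matrix_le {M : Matrix (Fin 2) (Fin 2) ℂ} {r : ℝ}
    (h0 : ‖M 0 0‖ + ‖M 0 1‖ ≤ r) (h1 : ‖M 1 0‖ + ‖M 1 1‖ ≤ r) : ‖M‖ ≤ r := by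
  have hr : 0 ≤ r := by
    have := norm_nonneg (M 0 0)
    have := norm_nonneg (M 0 1)
    linarith
  rw [Matrix.linfty_opNorm_def, ← NNReal.coe_mk r hr, NNReal.coe_le_coe, Finset.sup_le_iff]
  intro i _
  rw [← NNReal.coe_le_coe]
  fin_cases i <;> simpa [Fin.sum_univ_two]

theorem norm_entry_le (M : Matrix (Fin 2) (Fin 2) ℂ) (i j : Fin 2) : ‖M i j‖ ≤ ‖M‖ := by
  have h : (∑ j, ‖M i j‖₊ : NNReal) ≤ ‖M‖₊ := by
    rw [Matrix.linfty_opNNNorm_def]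
    exact Finset.le_sup (f := fun i => ∑ j, ‖M i j‖₊) (Finset.mem_univ i)
  have h2 : ‖M i j‖₊ ≤ ∑ j, ‖M i j‖₊ :=
    Finset.single_le_sum (f := fun j => ‖M i j‖₊) (fun _ _ => zero_le) (Finset.mem_univ j)
  exact_mod_cast h2.trans h

/-- The entry of a matrix as a continuous linear map. -/
noncomputable def entryCLM (i j : Fin 2) : Matrix (Fin 2) (Fin 2) ℂ →L[ℝ] ℂ :=
  LinearMap.toContinuousLinearMap
    { toFun := fun M => M i j
      map_add' := fun _ _ => rfl
      map_smul' := fun _ _ => rfl }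

/-- The adjugate of a `2 × 2` matrix as a continuous linear map. -/
noncomputable def adjugateCLM : Matrix (Fin 2) (Fin 2) ℂ →L[ℝ] Matrix (Fin 2) (Fin 2) ℂ :=
  LinearMap.toContinuousLinearMap
    { toFun := fun M => M.adjugate
      map_add' := fun A B => by
        ext i j; fin_cases i <;> fin_cases j <;> simp [Matrix.adjugate_fin_two, add_comm]
      map_smul' := fun c A => by
        ext i j; fin_cases i <;> fin_cases j <;> simp [Matrix.adjugate_fin_two] }

@[simp] theorem adjugateCLM_apply (M : Matrix (Fin 2) (Fin 2) ℂ) :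
    adjugateCLM M = M.adjugate := rfl

theorem norm_J_le : ‖J‖ ≤ 1 := norm_matrix_le (by simp [J]) (by simp [J])

theorem J_mul_J : J * J = -1 := by
  ext i j; fin_cases i <;> fin_cases j <;> simp [J, Matrix.mul_apply]

end Norm

/-- A real, symmetric, traceless potential `v σ₁ + w σ₃` with locally integrable entries. -/
structure Potential where
  v : ℝ → ℝ
  w : ℝ → ℝ
  hv : ∀ x y, IntervalIntegrable v volume x y
  hw : ∀ x y, IntervalIntegrable w volume x y

namespace Potential

/-- `J (v σ₁ + w σ₃) = v σ₃ - w σ₁`. -/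
noncomputable def mat (q : Potential) (t : ℝ) : Matrix (Fin 2) (Fin 2) ℂ :=
  !![(q.v t : ℂ), -q.w t; -q.w t, -q.v t]

/-- The coefficient `J (v σ₁ + w σ₃ - lam)` of the system. -/
noncomputable def coeff (q : Potential) (lam : ℂ) (t : ℝ) : Matrix (Fin 2) (Fin 2) ℂ :=
  q.mat t - lam • J

theorem coeff_eq (q : Potential) (lam : ℂ) (t : ℝ) :
    q.coeff lam t = !![(q.v t : ℂ), -q.w t - lam; -q.w t + lam, -q.v t] := by
  ext i j; fin_cases i <;> fin_cases j <;> simp [coeff, mat, J]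

/-- The pointwise size of the potential. -/
noncomputable def size (q : Potential) (t : ℝ) : ℝ := |q.v t| + |q.w t|

theorem size_nonneg (q : Potential) (t : ℝ) : 0 ≤ q.size t := by unfold size; positivity

theorem intervalIntegrable_size (q : Potential) (x y : ℝ) :
    IntervalIntegrable q.size volume x y :=
  (q.hv x y).abs.add (q.hw x y).abs

theorem norm_mat_le (q : Potential) (t : ℝ) : ‖q.mat t‖ ≤ q.size t := by
  refine norm_matrix_le ?_ ?_ <;> simp [mat, size, add_comm]

theorem mat_eq (q : Potential) (t : ℝ) : q.mat t = q.v t • sigma3 - q.w t • sigma1 := by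
  ext i j; fin_cases i <;> fin_cases j <;> simp [sigma3, sigma1, mat]

theorem intervalIntegrable_mat (q : Potential) (x y : ℝ) :
    IntervalIntegrable q.mat volume x y := by
  rw [show q.mat = fun t => q.v t • sigma3 - q.w t • sigma1 from funext q.mat_eq]
  exact ((q.hv x y).smul_continuousOn continuousOn_const).sub
    ((q.hw x y).smul_continuousOn continuousOn_const)

theorem intervalIntegrable_coeff (q : Potential) (lam : ℂ) (x y : ℝ) :
    IntervalIntegrable (q.coeff lam) volume x y :=
  (q.intervalIntegrable_mat x y).sub intervalIntegrable_const

/-- This is tracelessness. It makes the adjugate of a solution satisfy the adjoint equation, so that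
adjugate and inverse coincide and the determinant stays 1. -/
theorem adjugate_coeff (q : Potential) (lam : ℂ) (t : ℝ) :
    (q.coeff lam t).adjugate = -q.coeff lam t := by
  rw [coeff_eq, Matrix.adjugate_fin_two_of]
  ext i j; fin_cases i <;> fin_cases j <;> simp

theorem exists_sol (q : Potential) (lam : ℂ) : ∃ Y : ℝ → Matrix (Fin 2) (Fin 2) ℂ,
    Y 0 = 1 ∧ HasAEDeriv Y (fun t => q.coeff lam t * Y t) := by
  obtain ⟨Y, hY, h⟩ := exists_volterra (q.coeff lam) (q.intervalIntegrable_coeff lam)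
  refine ⟨Y, by simpa using h 0, ?_⟩
  have hi : ∀ x y, IntervalIntegrable (fun t => q.coeff lam t * Y t) volume x y := fun x y =>
    (q.intervalIntegrable_coeff lam x y).mul_continuousOn hY.continuousOn
  have h2 := (HasAEDeriv.const (1 : Matrix (Fin 2) (Fin 2) ℂ)).add (HasAEDeriv.integral hi)
  rw [show (fun x : ℝ => (1 : Matrix (Fin 2) (Fin 2) ℂ) + ∫ t in (0 : ℝ)..x, q.coeff lam t * Y t) = Y
    from funext fun x => (h x).symm] at h2
  exact h2.congr' fun x => zero_add _

/-- The normalised fundamental matrix of `Y' = J (v σ₁ + w σ₃ - lam) Y`. -/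
noncomputable def sol (q : Potential) (lam : ℂ) : ℝ → Matrix (Fin 2) (Fin 2) ℂ :=
  (q.exists_sol lam).choose

@[simp] theorem sol_zero (q : Potential) (lam : ℂ) : q.sol lam 0 = 1 :=
  (q.exists_sol lam).choose_spec.1

theorem sol_hasAEDeriv (q : Potential) (lam : ℂ) :
    HasAEDeriv (q.sol lam) (fun t => q.coeff lam t * q.sol lam t) :=
  (q.exists_sol lam).choose_spec.2

theorem continuous_sol (q : Potential) (lam : ℂ) : Continuous (q.sol lam) :=
  (q.sol_hasAEDeriv lam).continuous

/-- The adjugate (and inverse) of the fundamental matrix. -/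
noncomputable def inv (q : Potential) (lam : ℂ) (t : ℝ) : Matrix (Fin 2) (Fin 2) ℂ :=
  (q.sol lam t).adjugate

@[simp] theorem inv_zero (q : Potential) (lam : ℂ) : q.inv lam 0 = 1 := by
  simp [inv]

theorem inv_hasAEDeriv (q : Potential) (lam : ℂ) :
    HasAEDeriv (q.inv lam) (fun t => -(q.inv lam t * q.coeff lam t)) := by
  refine ((q.sol_hasAEDeriv lam).clm adjugateCLM).congr' fun t => ?_
  rw [adjugateCLM_apply, Matrix.adjugate_mul_distrib, adjugate_coeff, mul_neg, inv]

theorem continuous_inv (q : Potential) (lam : ℂ) : Continuous (q.inv lam) :=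
  (q.inv_hasAEDeriv lam).continuous

theorem inv_mul_sol (q : Potential) (lam : ℂ) (x : ℝ) : q.inv lam x * q.sol lam x = 1 := by
  have h := ((q.inv_hasAEDeriv lam).mul (q.sol_hasAEDeriv lam)).congr'
    (g := fun _ => 0) fun t => by noncomm_ring
  simpa using h.eq_of_zero x 0

theorem sol_mul_inv (q : Potential) (lam : ℂ) (x : ℝ) : q.sol lam x * q.inv lam x = 1 :=
  mul_eq_one_comm.1 (q.inv_mul_sol lam x)

theorem det_sol (q : Potential) (lam : ℂ) (x : ℝ) : (q.sol lam x).det = 1 := by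
  have h := q.inv_mul_sol lam x
  rw [inv, Matrix.adjugate_mul] at h
  simpa using congrFun (congrFun h 0) 0

/-- Variation of constants. -/
theorem hasAEDeriv_inv_mul (q : Potential) (lam : ℂ) {B Z : ℝ → Matrix (Fin 2) (Fin 2) ℂ}
    (hZ : HasAEDeriv Z (fun t => B t * Z t)) :
    HasAEDeriv (fun t => q.inv lam t * Z t)
      (fun t => q.inv lam t * (B t - q.coeff lam t) * Z t) :=
  ((q.inv_hasAEDeriv lam).mul hZ).congr' fun t => by noncomm_ring

/-- Duhamel's formula, the source of every comparison estimate below. The factor `sol x` stands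
under the integral so that it can be joined with `inv t` into a single propagator. -/
theorem eq_sol_add_integral (q : Potential) (lam : ℂ) {B Z : ℝ → Matrix (Fin 2) (Fin 2) ℂ}
    (hZ : HasAEDeriv Z (fun t => B t * Z t)) (x : ℝ) :
    Z x = q.sol lam x * Z 0
      + ∫ t in (0 : ℝ)..x, q.sol lam x * (q.inv lam t * (B t - q.coeff lam t) * Z t) := by
  have h := q.hasAEDeriv_inv_mul lam hZ
  have h1 := h.eq_integral x
  have e : (∫ t in (0 : ℝ)..x, q.sol lam x * (q.inv lam t * (B t - q.coeff lam t) * Z t))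
      = q.sol lam x * ∫ t in (0 : ℝ)..x, q.inv lam t * (B t - q.coeff lam t) * Z t :=
    (ContinuousLinearMap.mul ℝ _ (q.sol lam x)).intervalIntegral_comp_comm
      (h.intervalIntegrable 0 x)
  have h2 : q.sol lam x * (q.inv lam x * Z x) = q.sol lam x * (q.inv lam 0 * Z 0
      + ∫ t in (0 : ℝ)..x, q.inv lam t * (B t - q.coeff lam t) * Z t) := congrArg _ h1
  rw [← mul_assoc, sol_mul_inv, one_mul, inv_zero, one_mul, mul_add] at h2
  rw [e, h2]

theorem eq_sol_mul (q : Potential) (lam : ℂ) {Z : ℝ → Matrix (Fin 2) (Fin 2) ℂ}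
    (hZ : HasAEDeriv Z (fun t => q.coeff lam t * Z t)) (x : ℝ) : Z x = q.sol lam x * Z 0 := by
  have h := q.eq_sol_add_integral lam hZ x
  simpa using h

/-- The translated potential. -/
def shift (q : Potential) (s : ℝ) : Potential where
  v t := q.v (s + t)
  w t := q.w (s + t)
  hv x y := by simpa using (q.hv (s + x) (s + y)).comp_add_left s
  hw x y := by simpa using (q.hw (s + x) (s + y)).comp_add_left s

/-- Both sides solve the translated equation in `t` and agree at `t = 0`. It splits the monodromy
over `π` into two half-period factors. -/
theorem sol_add (q : Potential) (lam : ℂ) (s t : ℝ) :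
    q.sol lam (s + t) = (q.shift s).sol lam t * q.sol lam s := by
  have h := (q.sol_hasAEDeriv lam).comp_const_add s
  simpa using (q.shift s).eq_sol_mul lam (Z := fun t => q.sol lam (s + t)) h t

/-- The propagator from `s` to `x` is again a fundamental matrix, so bounds on intervals starting at
0 apply to it. -/
theorem sol_mul_inv_eq (q : Potential) (lam : ℂ) (s x : ℝ) :
    q.sol lam x * q.inv lam s = (q.shift s).sol lam (x - s) := by
  have h := q.sol_add lam s (x - s)
  rw [add_sub_cancel] at h
  rw [h, mul_assoc, sol_mul_inv, mul_one]

theorem sol_congr {q p : Potential} (hv : q.v =ᵐ[volume] p.v) (hw : q.w =ᵐ[volume] p.w) (lam : ℂ)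
    (x : ℝ) : q.sol lam x = p.sol lam x := by
  have h : HasAEDeriv (q.sol lam) (fun t => p.coeff lam t * q.sol lam t) := by
    refine (q.sol_hasAEDeriv lam).congr ?_
    filter_upwards [hv, hw] with t h1 h2
    rw [coeff_eq, coeff_eq, h1, h2]
  simpa using p.eq_sol_mul lam h x

end Potential

/-- The fundamental matrix `exp (-lam x J)` of the free system. -/
noncomputable def rot (lam : ℂ) (x : ℝ) : Matrix (Fin 2) (Fin 2) ℂ :=
  Complex.cos (lam * x) • (1 : Matrix (Fin 2) (Fin 2) ℂ) - Complex.sin (lam * x) • J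

theorem rot_eq (lam : ℂ) (x : ℝ) : rot lam x =
    !![Complex.cos (lam * x), -Complex.sin (lam * x);
      Complex.sin (lam * x), Complex.cos (lam * x)] := by
  ext i j; fin_cases i <;> fin_cases j <;> simp [rot, J]

/-- The zero potential. -/
def zeroPotential : Potential where
  v _ := 0
  w _ := 0
  hv _ _ := intervalIntegrable_const
  hw _ _ := intervalIntegrable_const

theorem coeff_zeroPotential (lam : ℂ) (t : ℝ) : zeroPotential.coeff lam t = -(lam • J) := by
  ext i j; fin_cases i <;> fin_cases j <;> simp [zeroPotential, Potential.coeff, Potential.mat]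

theorem sol_zeroPotential (lam : ℂ) (x : ℝ) : zeroPotential.sol lam x = rot lam x := by
  have hm : ∀ t : ℝ, HasDerivAt (fun s : ℝ => lam * (s : ℂ)) lam t := fun t => by
    simpa using (Complex.ofRealCLM.hasDerivAt (x := t)).const_mul lam
  have h : HasAEDeriv (rot lam) (fun t => zeroPotential.coeff lam t * rot lam t) := by
    refine HasAEDeriv.of_hasDerivAt (fun t => ?_) ?_
    · have hc := (Complex.hasDerivAt_cos (lam * t)).comp t (hm t)
      have hs := (Complex.hasDerivAt_sin (lam * t)).comp t (hm t)
      have h1 := (hc.smul_const (1 : Matrix (Fin 2) (Fin 2) ℂ)).sub (hs.smul_const J)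
      refine h1.congr_deriv ?_
      rw [coeff_zeroPotential, rot]
      ext i j
      fin_cases i <;> fin_cases j <;> simp [J, Matrix.mul_apply] <;> ring
    · simp only [coeff_zeroPotential, rot]
      fun_prop
  simpa [rot] using (zeroPotential.eq_sol_mul lam h x).symm

theorem norm_cos_le_exp (z : ℂ) : ‖Complex.cos z‖ ≤ Real.exp |z.im| := by
  rw [Complex.cos, norm_div, Complex.norm_two, div_le_iff₀ two_pos]
  refine (norm_add_le _ _).trans ?_
  rw [Complex.norm_exp, Complex.norm_exp]
  have h1 : (z * Complex.I).re ≤ |z.im| := by simpa using neg_le_abs z.im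
  have h2 : (-z * Complex.I).re ≤ |z.im| := by simpa using le_abs_self z.im
  linarith [Real.exp_le_exp.2 h1, Real.exp_le_exp.2 h2]

theorem norm_sin_le_exp (z : ℂ) : ‖Complex.sin z‖ ≤ Real.exp |z.im| := by
  rw [Complex.sin, norm_div, Complex.norm_two, div_le_iff₀ two_pos, norm_mul, Complex.norm_I,
    mul_one]
  refine (norm_sub_le _ _).trans ?_
  rw [Complex.norm_exp, Complex.norm_exp]
  have h1 : (z * Complex.I).re ≤ |z.im| := by simpa using neg_le_abs z.im
  have h2 : (-z * Complex.I).re ≤ |z.im| := by simpa using le_abs_self z.im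
  linarith [Real.exp_le_exp.2 h1, Real.exp_le_exp.2 h2]

theorem norm_rot_le (lam : ℂ) {x : ℝ} (hx : 0 ≤ x) :
    ‖rot lam x‖ ≤ 2 * Real.exp (|lam.im| * x) := by
  have h1 := norm_cos_le_exp (lam * x)
  have h2 := norm_sin_le_exp (lam * x)
  have e : |(lam * x).im| = |lam.im| * x := by simp [abs_mul, abs_of_nonneg hx]
  rw [e] at h1 h2
  rw [rot_eq]
  refine norm_matrix_le ?_ ?_ <;> simp <;> linarith

end DiracSystem

/-! ### Growth bounds and asymptotics for large spectral parameter. -/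

namespace DiracSystem
open MeasureTheory Set Filter
open scoped Matrix.Norms.Operator
attribute [local instance] normTopology

namespace Potential

/-- The integral of the size of the potential over `[0, x]`. -/
noncomputable def mass (q : Potential) (x : ℝ) : ℝ := ∫ t in (0 : ℝ)..x, q.size t

theorem coeff_sub_coeff_zeroPotential (q : Potential) (lam : ℂ) (t : ℝ) :
    q.coeff lam t - zeroPotential.coeff lam t = q.mat t := by
  rw [coeff_zeroPotential, coeff]
  abel

theorem zeroPotential_sol_mul_inv (lam : ℂ) (x t : ℝ) :
    zeroPotential.sol lam x * zeroPotential.inv lam t = rot lam (x - t) := by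
  rw [sol_mul_inv_eq, ← sol_zeroPotential]
  rfl

/-- Gronwall's inequality is applied to the solution weighted by `exp (-|Im lam| t)`, with the free
system as reference. The spectral parameter then enters only through the free propagator, and the
constant depends on the potential alone. -/
theorem norm_sol_le (q : Potential) (lam : ℂ) {x : ℝ} (hx : 0 ≤ x) :
    ‖q.sol lam x‖ ≤ 2 * Real.exp (2 * q.mass x) * Real.exp (|lam.im| * x) := by
  set k := |lam.im| with hk
  set u : ℝ → ℝ := fun t => Real.exp (-(k * t)) * ‖q.sol lam t‖ with hu
  have huc : Continuous u := by
    have := (q.continuous_sol lam).norm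
    fun_prop
  have hi : ∀ x y, IntervalIntegrable (fun t => 2 * q.size t) volume x y :=
    fun x y => (q.intervalIntegrable_size x y).const_mul 2
  have hui : ∀ x y, IntervalIntegrable (fun t => 2 * q.size t * u t) volume x y :=
    fun x y => (hi x y).mul_continuousOn huc.continuousOn
  have key : ∀ y ∈ Icc 0 x, u y ≤ 2 + ∫ t in (0 : ℝ)..y, 2 * q.size t * u t := by
    intro y hy
    have h1 := zeroPotential.eq_sol_add_integral lam (q.sol_hasAEDeriv lam) y
    have h2 : ‖∫ t in (0 : ℝ)..y, zeroPotential.sol lam y * (zeroPotential.inv lam t *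
        (q.coeff lam t - zeroPotential.coeff lam t) * q.sol lam t)‖
        ≤ ∫ t in (0 : ℝ)..y, Real.exp (k * y) * (2 * q.size t * u t) := by
      refine intervalIntegral.norm_integral_le_of_norm_le hy.1 (Eventually.of_forall fun t ht => ?_)
        ((hui 0 y).const_mul _)
      rw [coeff_sub_coeff_zeroPotential, mul_assoc, ← mul_assoc (zeroPotential.sol lam y),
        zeroPotential_sol_mul_inv]
      have h3 := norm_rot_le lam (sub_nonneg.2 ht.2)
      calc _ ≤ ‖rot lam (y - t)‖ * (‖q.mat t‖ * ‖q.sol lam t‖) :=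
            (norm_mul_le _ _).trans (mul_le_mul_of_nonneg_left (norm_mul_le _ _) (norm_nonneg _))
        _ ≤ (2 * Real.exp (k * (y - t))) * (q.size t * ‖q.sol lam t‖) := by
            gcongr
            exact q.norm_mat_le t
        _ = _ := by
            rw [hu, mul_sub, sub_eq_add_neg, Real.exp_add]
            ring
    rw [intervalIntegral.integral_const_mul] at h2
    have h4 : ‖q.sol lam y‖ ≤ 2 * Real.exp (k * y)
        + Real.exp (k * y) * ∫ t in (0 : ℝ)..y, 2 * q.size t * u t := by
      rw [h1, sol_zero, mul_one, sol_zeroPotential]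
      refine (norm_add_le _ _).trans (add_le_add (norm_rot_le lam hy.1) ?_)
      simpa only [sol_zeroPotential] using h2
    calc u y ≤ Real.exp (-(k * y)) * (2 * Real.exp (k * y)
        + Real.exp (k * y) * ∫ t in (0 : ℝ)..y, 2 * q.size t * u t) :=
          mul_le_mul_of_nonneg_left h4 (Real.exp_pos _).le
      _ = (Real.exp (-(k * y)) * Real.exp (k * y))
          * (2 + ∫ t in (0 : ℝ)..y, 2 * q.size t * u t) := by ring
      _ = _ := by rw [← Real.exp_add, neg_add_cancel, Real.exp_zero, one_mul]
  have h := le_mul_exp_of_le_add_integral hi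
    (fun t => mul_nonneg zero_le_two (q.size_nonneg t)) huc hx key
  rw [intervalIntegral.integral_const_mul] at h
  change u x ≤ 2 * Real.exp (2 * q.mass x) at h
  calc ‖q.sol lam x‖ = u x * Real.exp (k * x) := by
        rw [hu]
        simp only
        rw [mul_right_comm, ← Real.exp_add, neg_add_cancel, Real.exp_zero, one_mul]
    _ ≤ _ := mul_le_mul_of_nonneg_right h (Real.exp_pos _).le

theorem mass_mono (q : Potential) {s x : ℝ} (hx : s ≤ x) : q.mass s ≤ q.mass x := by
  unfold mass
  rw [← sub_nonneg, intervalIntegral.integral_interval_sub_left (q.intervalIntegrable_size _ _)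
    (q.intervalIntegrable_size _ _)]
  exact intervalIntegral.integral_nonneg hx fun t _ => q.size_nonneg t

theorem mass_nonneg (q : Potential) {x : ℝ} (hx : 0 ≤ x) : 0 ≤ q.mass x :=
  intervalIntegral.integral_nonneg hx fun t _ => q.size_nonneg t

theorem mass_shift_le (q : Potential) {s x : ℝ} (hs : 0 ≤ s) :
    (q.shift s).mass (x - s) ≤ q.mass x := by
  have h : (q.shift s).mass (x - s) = ∫ t in s..x, q.size t := by
    have := intervalIntegral.integral_comp_add_left (a := 0) (b := x - s) q.size s
    rw [add_zero, add_sub_cancel] at this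
    exact this
  have h2 := q.mass_nonneg hs
  rw [h, ← intervalIntegral.integral_interval_sub_left (q.intervalIntegrable_size 0 x)
    (q.intervalIntegrable_size 0 s)]
  change q.mass x - q.mass s ≤ q.mass x
  linarith

/-- Bounding the two factors separately would give the exponent `|Im lam| (x + s)`. Read as a
fundamental matrix of the shifted potential, the product costs only the length `x - s`. -/
theorem norm_sol_mul_inv_le (q : Potential) (lam : ℂ) {s x : ℝ} (hs : 0 ≤ s) (hx : s ≤ x) :
    ‖q.sol lam x * q.inv lam s‖
      ≤ 2 * Real.exp (2 * q.mass x) * Real.exp (|lam.im| * (x - s)) := by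
  rw [sol_mul_inv_eq]
  refine ((q.shift s).norm_sol_le lam (sub_nonneg.2 hx)).trans ?_
  have := q.mass_shift_le (x := x) hs
  gcongr

/-- The fundamental matrix depends continuously on the potential, uniformly in the spectral
parameter relative to the growth of the free solution. -/
theorem norm_sol_sub_sol_le (q p : Potential) (lam : ℂ) {x : ℝ} (hx : 0 ≤ x) :
    ‖q.sol lam x - p.sol lam x‖ ≤ 4 * Real.exp (2 * q.mass x + 2 * p.mass x)
      * (∫ t in (0 : ℝ)..x, (|q.v t - p.v t| + |q.w t - p.w t|)) * Real.exp (|lam.im| * x) := by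
  have h1 := p.eq_sol_add_integral lam (q.sol_hasAEDeriv lam) x
  rw [sol_zero, mul_one, ← sub_eq_iff_eq_add'] at h1
  rw [h1]
  have hi : IntervalIntegrable (fun t => |q.v t - p.v t| + |q.w t - p.w t|) volume 0 x :=
    ((q.hv 0 x).sub (p.hv 0 x)).abs.add ((q.hw 0 x).sub (p.hw 0 x)).abs
  have h2 : ‖∫ t in (0 : ℝ)..x, p.sol lam x * (p.inv lam t *
      (q.coeff lam t - p.coeff lam t) * q.sol lam t)‖
      ≤ ∫ t in (0 : ℝ)..x, (4 * Real.exp (2 * q.mass x + 2 * p.mass x) * Real.exp (|lam.im| * x))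
        * (|q.v t - p.v t| + |q.w t - p.w t|) := by
    refine intervalIntegral.norm_integral_le_of_norm_le hx (Eventually.of_forall fun t ht => ?_)
      (hi.const_mul _)
    have e : q.coeff lam t - p.coeff lam t = q.mat t - p.mat t := by
      simp only [coeff]; abel
    have hm : ‖q.mat t - p.mat t‖ ≤ |q.v t - p.v t| + |q.w t - p.w t| := by
      have e1 : |q.w t - p.w t| = |-q.w t + p.w t| := by rw [← abs_neg]; congr 1; ring
      have e2 : |q.v t - p.v t| = |-q.v t + p.v t| := by rw [← abs_neg]; congr 1; ring
      refine norm_matrix_le ?_ ?_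
      · simp only [mat, Matrix.sub_apply, Matrix.of_apply, Matrix.cons_val', Matrix.cons_val_zero,
          Matrix.cons_val_one, Matrix.cons_val_fin_one]
        norm_cast
        simp only [Real.norm_eq_abs]
        rw [e1, sub_neg_eq_add]
      · simp only [mat, Matrix.sub_apply, Matrix.of_apply, Matrix.cons_val', Matrix.cons_val_zero,
          Matrix.cons_val_one, Matrix.cons_val_fin_one]
        norm_cast
        simp only [Real.norm_eq_abs]
        rw [e1, e2, sub_neg_eq_add, sub_neg_eq_add, add_comm]
    have h3 := p.norm_sol_mul_inv_le lam ht.1.le ht.2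
    have h4 : ‖q.sol lam t‖ ≤ 2 * Real.exp (2 * q.mass x) * Real.exp (|lam.im| * t) := by
      refine (q.norm_sol_le lam ht.1.le).trans ?_
      have := q.mass_mono ht.2
      gcongr
    rw [e, mul_assoc, ← mul_assoc (p.sol lam x)]
    calc _ ≤ ‖p.sol lam x * p.inv lam t‖ * (‖q.mat t - p.mat t‖ * ‖q.sol lam t‖) :=
          (norm_mul_le _ _).trans (mul_le_mul_of_nonneg_left (norm_mul_le _ _) (norm_nonneg _))
      _ ≤ (2 * Real.exp (2 * p.mass x) * Real.exp (|lam.im| * (x - t)))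
          * ((|q.v t - p.v t| + |q.w t - p.w t|)
            * (2 * Real.exp (2 * q.mass x) * Real.exp (|lam.im| * t))) := by
          gcongr
      _ = _ := by
          rw [Real.exp_add, mul_sub, Real.exp_sub]
          field_simp
          ring
  rw [intervalIntegral.integral_const_mul] at h2
  refine h2.trans (le_of_eq ?_)
  ring

end Potential

/-- Approximation of a locally integrable function by a continuously differentiable one. -/
theorem exists_contDiff_integral_abs_sub_le {f : ℝ → ℝ}
    (hf : ∀ x y, IntervalIntegrable f volume x y) {x : ℝ} (hx : 0 ≤ x) {δ : ℝ} (hδ : 0 < δ) :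
    ∃ g : ℝ → ℝ, ContDiff ℝ 1 g ∧ ∫ t in (0 : ℝ)..x, |f t - g t| ≤ δ := by
  have hi : Integrable f (volume.restrict (Ioc 0 x)) :=
    (intervalIntegrable_iff_integrableOn_Ioc_of_le hx).1 (hf 0 x)
  obtain ⟨g, -, hg, h⟩ := MemLp.exist_eLpNorm_sub_le (p := 1) ENNReal.one_ne_top le_rfl
    (memLp_one_iff_integrable.2 hi) hδ
  refine ⟨g, hg.of_le (by exact_mod_cast le_top), ?_⟩
  have hgi : Integrable g (volume.restrict (Ioc 0 x)) :=
    (intervalIntegrable_iff_integrableOn_Ioc_of_le hx).1 (hg.continuous.intervalIntegrable 0 x)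
  rw [intervalIntegral.integral_of_le hx]
  have h2 := integral_norm_eq_lintegral_enorm (hi.sub hgi).aestronglyMeasurable
  rw [eLpNorm_one_eq_lintegral_enorm] at h
  have h3 := ENNReal.toReal_mono ENNReal.ofReal_ne_top h
  rw [← h2, ENNReal.toReal_ofReal hδ.le] at h3
  simpa using h3

namespace Potential

/-- For a continuously differentiable potential, the fundamental matrix differs from the free one by
a relative error of order `1 / lam`. -/
theorem asymptotics_of_contDiff (q : Potential) (hv : ContDiff ℝ 1 q.v) (hw : ContDiff ℝ 1 q.w)
    {x : ℝ} (hx : 0 ≤ x) : ∃ C : ℝ, ∀ lam : ℂ, lam ≠ 0 →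
      ‖q.sol lam x - rot lam x‖ ≤ C / ‖lam‖ * Real.exp (|lam.im| * x) := by
  set m' : ℝ → Matrix (Fin 2) (Fin 2) ℂ := fun t => deriv q.v t • sigma3 - deriv q.w t • sigma1
    with hm'
  have hm'c : Continuous m' := by
    have h1 := hv.continuous_deriv le_rfl
    have h2 := hw.continuous_deriv le_rfl
    fun_prop
  have hmc : Continuous q.mat := by
    rw [show q.mat = fun t => q.v t • sigma3 - q.w t • sigma1 from funext q.mat_eq]
    have h1 := hv.continuous
    have h2 := hw.continuous
    fun_prop
  have hm : HasAEDeriv q.mat m' := by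
    rw [show q.mat = fun t => q.v t • sigma3 - q.w t • sigma1 from funext q.mat_eq]
    refine HasAEDeriv.of_hasDerivAt (fun t => ?_) hm'c
    exact (((hv.differentiable one_ne_zero) t).hasDerivAt.smul_const sigma3).sub
      (((hw.differentiable one_ne_zero) t).hasDerivAt.smul_const sigma1)
  set S : ℝ → Matrix (Fin 2) (Fin 2) ℂ := fun t => J * (m' t + q.mat t * q.mat t) with hS
  have hSc : Continuous S := by fun_prop
  obtain ⟨B, hB⟩ := (isCompact_Icc (a := (0 : ℝ)) (b := x)).exists_bound_of_continuousOn
    hSc.continuousOn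
  have hB0 : 0 ≤ B := (norm_nonneg _).trans (hB 0 ⟨le_rfl, hx⟩)
  set D : ℝ := 2 * Real.exp (2 * q.mass x) with hD
  have hD0 : 0 ≤ D := by positivity
  refine ⟨q.size x * D + 2 * q.size 0 + x * (2 * (B * D)), fun lam hlam => ?_⟩
  -- Since `J * mat * J = mat` and `J * J = -1`, multiplying the solution by `1 + c J mat` replaces
  -- the perturbation `mat` by `(1 - 2 c lam) mat` plus terms of order `c`. This `c` cancels the
  -- first part and leaves the perturbation `c S`.
  set c : ℂ := 1 / (2 * lam) with hc
  have hcn : ‖c‖ ≤ 1 / ‖lam‖ := by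
    rw [hc, norm_div, norm_mul, norm_one, Complex.norm_two]
    have : 0 < ‖lam‖ := norm_pos_iff.2 hlam
    gcongr
    linarith
  have hclam : c * lam = 1 / 2 := by rw [hc]; field_simp
  have hJm : ∀ t, q.mat t * J = -(J * q.mat t) := fun t => by
    ext i j
    fin_cases i <;> fin_cases j <;> simp [mat, J, Matrix.mul_apply]
  -- the transformed solution `(1 + c J mat) sol`
  have hT : HasAEDeriv (fun t => 1 + c • (J * q.mat t)) (fun t => c • (J * m' t)) := by
    have h1 := ((HasAEDeriv.const (c • J)).mul hm)
    refine ((HasAEDeriv.const (1 : Matrix (Fin 2) (Fin 2) ℂ)).add ?_).congr'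
      (f := fun t => 0 + c • (J * m' t)) (fun t => zero_add _)
    simpa only [smul_mul_assoc, zero_mul, zero_add] using h1
  have hZ := hT.mul (q.sol_hasAEDeriv lam)
  have hW := (zeroPotential.inv_hasAEDeriv lam).mul hZ
  have hW' := hW.congr' (g := fun t => zeroPotential.inv lam t * (c • S t) * q.sol lam t)
    (fun t => by
      have key : lam • (J * (1 + c • (J * q.mat t))) + c • (J * m' t)
          + (1 + c • (J * q.mat t)) * (q.mat t - lam • J) = c • S t := by
        have e1 : J * (J * q.mat t) = -q.mat t := by rw [← mul_assoc, J_mul_J, neg_one_mul]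
        have e2 : J * q.mat t * J = q.mat t := by
          rw [mul_assoc, hJm, mul_neg, ← mul_assoc, J_mul_J, neg_one_mul, neg_neg]
        simp only [hS, mul_add, add_mul, mul_sub, one_mul, mul_one, mul_smul_comm, smul_mul_assoc,
          smul_add, e1, e2, ← mul_assoc J (q.mat t) (q.mat t), smul_smul]
        rw [mul_comm lam c, hclam]
        module
      rw [← key, coeff_zeroPotential]
      simp only [coeff]
      simp only [mul_add, add_mul, mul_sub, sub_mul, mul_neg, mul_one, one_mul, mul_smul_comm,
        smul_mul_assoc, mul_assoc, neg_neg]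
      module)
  have hI := hW'.eq_integral x
  rw [zeroPotential.inv_zero, q.sol_zero, one_mul, mul_one] at hI
  have hI2 : (1 + c • (J * q.mat x)) * q.sol lam x = rot lam x * (1 + c • (J * q.mat 0))
      + ∫ t in (0 : ℝ)..x, rot lam (x - t) * (c • S t) * q.sol lam t := by
    have h1 := congrArg (fun M => zeroPotential.sol lam x * M) hI
    have e : (∫ t in (0 : ℝ)..x, rot lam (x - t) * (c • S t) * q.sol lam t)
        = zeroPotential.sol lam x *
          ∫ t in (0 : ℝ)..x, zeroPotential.inv lam t * (c • S t) * q.sol lam t := by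
      have e1 : (∫ t in (0 : ℝ)..x, zeroPotential.sol lam x *
          (zeroPotential.inv lam t * (c • S t) * q.sol lam t)) = zeroPotential.sol lam x *
          ∫ t in (0 : ℝ)..x, zeroPotential.inv lam t * (c • S t) * q.sol lam t :=
        (ContinuousLinearMap.mul ℝ _ (zeroPotential.sol lam x)).intervalIntegral_comp_comm
          (hW'.intervalIntegrable 0 x)
      rw [← e1]
      refine intervalIntegral.integral_congr fun t _ => ?_
      simp only [← mul_assoc]
      rw [zeroPotential_sol_mul_inv]
    simp only [← mul_assoc, zeroPotential.sol_mul_inv, one_mul] at h1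
    rw [h1, mul_add, e, sol_zeroPotential]
  have hI3 : q.sol lam x - rot lam x = -(c • (J * q.mat x) * q.sol lam x)
      + rot lam x * (c • (J * q.mat 0))
      + ∫ t in (0 : ℝ)..x, rot lam (x - t) * (c • S t) * q.sol lam t := by
    rw [add_mul, one_mul, mul_add, mul_one] at hI2
    rw [show q.sol lam x - rot lam x = (q.sol lam x + c • (J * q.mat x) * q.sol lam x)
      - c • (J * q.mat x) * q.sol lam x - rot lam x by abel, hI2]
    abel
  set k := |lam.im| with hk
  have hJn : ∀ t, ‖J * q.mat t‖ ≤ q.size t := fun t => by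
    refine (norm_mul_le _ _).trans ?_
    calc ‖J‖ * ‖q.mat t‖ ≤ 1 * q.size t := by
          gcongr
          · exact norm_J_le
          · exact q.norm_mat_le t
      _ = _ := one_mul _
  have b1 : ‖c • (J * q.mat x) * q.sol lam x‖ ≤ ‖c‖ * (q.size x * D * Real.exp (k * x)) := by
    rw [smul_mul_assoc, norm_smul]
    gcongr
    refine (norm_mul_le _ _).trans ?_
    rw [mul_assoc]
    gcongr
    · exact q.size_nonneg x
    · exact hJn x
    · exact q.norm_sol_le lam hx
  have b2 : ‖rot lam x * (c • (J * q.mat 0))‖ ≤ ‖c‖ * (2 * q.size 0 * Real.exp (k * x)) := by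
    rw [mul_smul_comm, norm_smul]
    gcongr
    refine (norm_mul_le _ _).trans ?_
    calc _ ≤ (2 * Real.exp (k * x)) * q.size 0 := by
          gcongr
          · exact norm_rot_le lam hx
          · exact hJn 0
      _ = _ := by ring
  have b3 : ‖∫ t in (0 : ℝ)..x, rot lam (x - t) * (c • S t) * q.sol lam t‖
      ≤ ‖c‖ * (x * (2 * (B * D)) * Real.exp (k * x)) := by
    have h5 : ∀ t ∈ uIoc (0 : ℝ) x, ‖rot lam (x - t) * (c • S t) * q.sol lam t‖
        ≤ ‖c‖ * (2 * (B * D) * Real.exp (k * x)) := by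
      intro t ht
      rw [uIoc_of_le hx] at ht
      have hst : ‖q.sol lam t‖ ≤ D * Real.exp (k * t) := by
        refine (q.norm_sol_le lam ht.1.le).trans ?_
        have := q.mass_mono ht.2
        rw [hD]
        gcongr
      rw [mul_smul_comm, smul_mul_assoc, norm_smul]
      gcongr
      calc _ ≤ ‖rot lam (x - t)‖ * ‖S t‖ * ‖q.sol lam t‖ :=
            (norm_mul_le _ _).trans (mul_le_mul_of_nonneg_right (norm_mul_le _ _) (norm_nonneg _))
        _ ≤ (2 * Real.exp (k * (x - t))) * B * (D * Real.exp (k * t)) := by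
            gcongr
            · exact norm_rot_le lam (sub_nonneg.2 ht.2)
            · exact hB t ⟨ht.1.le, ht.2⟩
        _ = _ := by
            rw [mul_sub, Real.exp_sub]
            field_simp
    refine (intervalIntegral.norm_integral_le_of_norm_le_const h5).trans (le_of_eq ?_)
    rw [sub_zero, abs_of_nonneg hx]
    ring
  rw [hI3]
  calc _ ≤ ‖c • (J * q.mat x) * q.sol lam x‖ + ‖rot lam x * (c • (J * q.mat 0))‖
        + ‖∫ t in (0 : ℝ)..x, rot lam (x - t) * (c • S t) * q.sol lam t‖ := by
        refine (norm_add_le _ _).trans (add_le_add_left ((norm_add_le _ _).trans ?_) _)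
        rw [norm_neg]
    _ ≤ ‖c‖ * ((q.size x * D + 2 * q.size 0 + x * (2 * (B * D))) * Real.exp (k * x)) := by
        linarith
    _ ≤ (1 / ‖lam‖) * ((q.size x * D + 2 * q.size 0 + x * (2 * (B * D))) * Real.exp (k * x)) := by
        have := q.size_nonneg x
        have := q.size_nonneg 0
        gcongr
    _ = _ := by ring

/-- As `lam → ∞` in any direction, the fundamental matrix is asymptotic to that of the free
system. -/
theorem sol_asymptotics (q : Potential) {x : ℝ} (hx : 0 ≤ x) {ε : ℝ} (hε : 0 < ε) :
    ∃ K : ℝ, ∀ lam : ℂ, K ≤ ‖lam‖ →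
      ‖q.sol lam x - rot lam x‖ ≤ ε * Real.exp (|lam.im| * x) := by
  -- `N` dominates the constant in `norm_sol_sub_sol_le` when the smooth approximant has mass at
  -- most `q.mass x + 1`, which `δ ≤ 1` guarantees. The other bound on `δ` makes the approximation
  -- error at most `ε / 2`.
  set N : ℝ := 4 * Real.exp (4 * q.mass x + 2) with hN
  have hN0 : 0 < N := by positivity
  set δ : ℝ := min 1 (ε / (2 * N)) with hδ
  have hδ0 : 0 < δ := by positivity
  obtain ⟨g, hg, hgδ⟩ := exists_contDiff_integral_abs_sub_le q.hv hx (half_pos hδ0)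
  obtain ⟨h, hh, hhδ⟩ := exists_contDiff_integral_abs_sub_le q.hw hx (half_pos hδ0)
  let p : Potential :=
    ⟨g, h, fun _ _ => hg.continuous.intervalIntegrable _ _,
      fun _ _ => hh.continuous.intervalIntegrable _ _⟩
  have hdv : IntervalIntegrable (fun t => |q.v t - p.v t|) volume 0 x :=
    ((q.hv 0 x).sub (p.hv 0 x)).abs
  have hdw : IntervalIntegrable (fun t => |q.w t - p.w t|) volume 0 x :=
    ((q.hw 0 x).sub (p.hw 0 x)).abs
  have hdist : ∫ t in (0 : ℝ)..x, (|q.v t - p.v t| + |q.w t - p.w t|) ≤ δ := by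
    rw [intervalIntegral.integral_add hdv hdw]
    calc _ ≤ δ / 2 + δ / 2 := add_le_add hgδ hhδ
      _ = δ := add_halves δ
  have hpm : p.mass x ≤ q.mass x + 1 := by
    have h1 : p.mass x ≤ ∫ t in (0 : ℝ)..x, (q.size t + (|q.v t - p.v t| + |q.w t - p.w t|)) := by
      refine intervalIntegral.integral_mono_on hx (p.intervalIntegrable_size 0 x)
        ((q.intervalIntegrable_size 0 x).add (hdv.add hdw)) fun t _ => ?_
      have e1 := abs_sub_abs_le_abs_sub (p.v t) (q.v t)
      have e2 := abs_sub_abs_le_abs_sub (p.w t) (q.w t)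
      rw [abs_sub_comm] at e1 e2
      unfold size
      linarith
    rw [intervalIntegral.integral_add (q.intervalIntegrable_size 0 x) (hdv.add hdw)] at h1
    have : δ ≤ 1 := min_le_left _ _
    change p.mass x ≤ q.mass x + _ at h1
    linarith
  obtain ⟨C, hC⟩ := p.asymptotics_of_contDiff hg hh hx
  refine ⟨max 1 (2 * |C| / ε), fun lam hlam => ?_⟩
  have hl1 : 1 ≤ ‖lam‖ := (le_max_left _ _).trans hlam
  have hl2 : 2 * |C| / ε ≤ ‖lam‖ := (le_max_right _ _).trans hlam
  have h1 := hC lam (norm_pos_iff.1 (by linarith))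
  have h2 := q.norm_sol_sub_sol_le p lam hx
  have h3 : 4 * Real.exp (2 * q.mass x + 2 * p.mass x)
      * (∫ t in (0 : ℝ)..x, (|q.v t - p.v t| + |q.w t - p.w t|)) ≤ ε / 2 := by
    have e1 : Real.exp (2 * q.mass x + 2 * p.mass x) ≤ Real.exp (4 * q.mass x + 2) :=
      Real.exp_le_exp.2 (by linarith)
    calc _ ≤ 4 * Real.exp (4 * q.mass x + 2) * δ := by
          refine mul_le_mul (by linarith) hdist ?_ hN0.le
          exact intervalIntegral.integral_nonneg hx fun t _ => by positivity
      _ ≤ N * (ε / (2 * N)) := by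
          rw [← hN]
          exact mul_le_mul_of_nonneg_left (min_le_right _ _) hN0.le
      _ = ε / 2 := by field_simp
  have h4 : C / ‖lam‖ ≤ ε / 2 := by
    rw [div_le_iff₀ (by linarith)]
    rw [div_le_iff₀ hε] at hl2
    linarith [le_abs_self C]
  calc ‖q.sol lam x - rot lam x‖
      = ‖(q.sol lam x - p.sol lam x) + (p.sol lam x - rot lam x)‖ := by congr 1; abel
    _ ≤ ‖q.sol lam x - p.sol lam x‖ + ‖p.sol lam x - rot lam x‖ := norm_add_le _ _
    _ ≤ ε / 2 * Real.exp (|lam.im| * x) + ε / 2 * Real.exp (|lam.im| * x) := by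
        refine add_le_add (h2.trans ?_) (h1.trans ?_)
        · exact mul_le_mul_of_nonneg_right h3 (Real.exp_pos _).le
        · exact mul_le_mul_of_nonneg_right h4 (Real.exp_pos _).le
    _ = _ := by ring

end Potential
end DiracSystem

/-! ### Dependence on the spectral parameter, and rigidity at real critical points. -/

namespace DiracSystem
open MeasureTheory Set Filter
open scoped Matrix.Norms.Operator ComplexConjugate
attribute [local instance] normTopology

namespace Potential

theorem sol_sub_sol (q : Potential) (lam mu : ℂ) (x : ℝ) :
    q.sol mu x - q.sol lam x = ∫ t in (0 : ℝ)..x,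
      -((mu - lam) • (q.sol lam x * q.inv lam t * J * q.sol mu t)) := by
  have h := q.eq_sol_add_integral lam (q.sol_hasAEDeriv mu) x
  rw [sol_zero, mul_one, ← sub_eq_iff_eq_add'] at h
  rw [h]
  refine intervalIntegral.integral_congr fun t _ => ?_
  have e : q.coeff mu t - q.coeff lam t = -((mu - lam) • J) := by
    simp only [coeff]; module
  simp only [e, mul_neg, neg_mul, mul_smul_comm, smul_mul_assoc, mul_assoc]

/-- The derivative of the fundamental matrix with respect to the spectral parameter. -/
theorem hasDerivAt_sol (q : Potential) (lam : ℂ) {x : ℝ} (hx : 0 ≤ x) :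
    HasDerivAt (fun mu => q.sol mu x)
      (-(q.sol lam x * ∫ t in (0 : ℝ)..x, q.inv lam t * J * q.sol lam t)) lam := by
  set N : ℝ := 2 * Real.exp (2 * q.mass x) * Real.exp ((|lam.im| + 1) * x) with hN
  have hN0 : 0 ≤ N := by positivity
  have hsol : ∀ mu : ℂ, ‖mu - lam‖ ≤ 1 → ∀ t ∈ Icc 0 x, ‖q.sol mu t‖ ≤ N := by
    intro mu hmu t ht
    refine (q.norm_sol_le mu ht.1).trans ?_
    have h1 := q.mass_mono ht.2
    have h2 : |mu.im| ≤ |lam.im| + 1 := by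
      have h3 := Complex.abs_im_le_norm (mu - lam)
      rw [Complex.sub_im] at h3
      linarith [abs_sub_abs_le_abs_sub mu.im lam.im]
    have h4 : |mu.im| * t ≤ (|lam.im| + 1) * x := by
      have := abs_nonneg lam.im
      exact mul_le_mul h2 ht.2 ht.1 (by linarith)
    rw [hN]
    gcongr
  have htr : ∀ s ∈ Icc 0 x, ∀ t ∈ Icc s x, ‖q.sol lam t * q.inv lam s‖ ≤ N := by
    intro s hs t ht
    refine (q.norm_sol_mul_inv_le lam hs.1 ht.1).trans ?_
    have h1 := q.mass_mono ht.2
    have h4 : |lam.im| * (t - s) ≤ (|lam.im| + 1) * x := by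
      have := abs_nonneg lam.im
      exact mul_le_mul (by linarith) (by linarith [hs.1, ht.2]) (by linarith [ht.1]) (by linarith)
    rw [hN]
    gcongr
  have hlip : ∀ mu : ℂ, ‖mu - lam‖ ≤ 1 → ∀ t ∈ Icc 0 x,
      ‖q.sol mu t - q.sol lam t‖ ≤ x * N * N * ‖mu - lam‖ := by
    intro mu hmu t ht
    rw [sol_sub_sol]
    have h5 : ∀ s ∈ uIoc (0 : ℝ) t,
        ‖-((mu - lam) • (q.sol lam t * q.inv lam s * J * q.sol mu s))‖ ≤ N * N * ‖mu - lam‖ := by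
      intro s hs
      rw [uIoc_of_le ht.1] at hs
      rw [norm_neg, norm_smul, mul_comm]
      gcongr
      calc _ ≤ ‖q.sol lam t * q.inv lam s‖ * ‖J‖ * ‖q.sol mu s‖ :=
            (norm_mul_le _ _).trans (mul_le_mul_of_nonneg_right (norm_mul_le _ _) (norm_nonneg _))
        _ ≤ N * 1 * N := by
            gcongr
            · exact htr s ⟨hs.1.le, hs.2.trans ht.2⟩ t ⟨hs.2, ht.2⟩
            · exact norm_J_le
            · exact hsol mu hmu s ⟨hs.1.le, hs.2.trans ht.2⟩
        _ = N * N := by ring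
    refine (intervalIntegral.norm_integral_le_of_norm_le_const h5).trans ?_
    rw [sub_zero, abs_of_nonneg ht.1]
    calc N * N * ‖mu - lam‖ * t ≤ N * N * ‖mu - lam‖ * x := by gcongr; exact ht.2
      _ = _ := by ring
  set D : Matrix (Fin 2) (Fin 2) ℂ :=
    -(q.sol lam x * ∫ t in (0 : ℝ)..x, q.inv lam t * J * q.sol lam t) with hD
  have hci : ∀ mu, Continuous fun t => q.inv lam t * J * q.sol mu t := fun mu => by
    have h1 := q.continuous_inv lam
    have h2 := q.continuous_sol mu
    fun_prop
  have hD2 : D = ∫ t in (0 : ℝ)..x, -(q.sol lam x * q.inv lam t * J * q.sol lam t) := by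
    have e : (∫ t in (0 : ℝ)..x, q.sol lam x * (q.inv lam t * J * q.sol lam t))
        = q.sol lam x * ∫ t in (0 : ℝ)..x, q.inv lam t * J * q.sol lam t :=
      (ContinuousLinearMap.mul ℝ _ (q.sol lam x)).intervalIntegral_comp_comm
        ((hci lam).intervalIntegrable 0 x)
    rw [hD, ← e, ← intervalIntegral.integral_neg]
    simp only [mul_assoc]
  -- Duhamel's formula already carries one factor `mu - lam`; the Lipschitz bound `hlip` under the
  -- integral supplies the second.
  have hrem : ∀ mu : ℂ, ‖mu - lam‖ ≤ 1 → ‖q.sol mu x - q.sol lam x - (mu - lam) • D‖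
      ≤ x * (x * N * N * N) * ‖mu - lam‖ ^ 2 := by
    intro mu hmu
    have hc1 : ∀ nu, Continuous fun t => -(q.sol lam x * q.inv lam t * J * q.sol nu t) := fun nu => by
      have h1 := q.continuous_inv lam
      have h2 := q.continuous_sol nu
      fun_prop
    have e1 : (mu - lam) • D = ∫ t in (0 : ℝ)..x,
        (mu - lam) • -(q.sol lam x * q.inv lam t * J * q.sol lam t) := by
      rw [intervalIntegral.integral_smul, ← hD2]
    have e2 : q.sol mu x - q.sol lam x = ∫ t in (0 : ℝ)..x,
        (mu - lam) • -(q.sol lam x * q.inv lam t * J * q.sol mu t) := by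
      rw [sol_sub_sol]
      simp only [smul_neg]
    have hi : ∀ nu, IntervalIntegrable
        (fun t => (mu - lam) • -(q.sol lam x * q.inv lam t * J * q.sol nu t)) volume 0 x :=
      fun nu => ((hc1 nu).const_smul (mu - lam)).intervalIntegrable 0 x
    rw [e1, e2, ← intervalIntegral.integral_sub (hi mu) (hi lam)]
    have h5 : ∀ t ∈ uIoc (0 : ℝ) x, ‖(mu - lam) • -(q.sol lam x * q.inv lam t * J * q.sol mu t)
        - (mu - lam) • -(q.sol lam x * q.inv lam t * J * q.sol lam t)‖
        ≤ x * N * N * N * ‖mu - lam‖ ^ 2 := by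
      intro t ht
      rw [uIoc_of_le hx] at ht
      have e3 : (mu - lam) • -(q.sol lam x * q.inv lam t * J * q.sol mu t)
          - (mu - lam) • -(q.sol lam x * q.inv lam t * J * q.sol lam t)
          = -((mu - lam) • (q.sol lam x * q.inv lam t * J * (q.sol mu t - q.sol lam t))) := by
        rw [mul_sub]; module
      rw [e3, norm_neg, norm_smul]
      calc _ ≤ ‖mu - lam‖ * (‖q.sol lam x * q.inv lam t‖ * ‖J‖ * ‖q.sol mu t - q.sol lam t‖) :=
            mul_le_mul_of_nonneg_left ((norm_mul_le _ _).trans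
              (mul_le_mul_of_nonneg_right (norm_mul_le _ _) (norm_nonneg _))) (norm_nonneg _)
        _ ≤ ‖mu - lam‖ * (N * 1 * (x * N * N * ‖mu - lam‖)) := by
            gcongr
            · exact htr t ⟨ht.1.le, ht.2⟩ x ⟨ht.2, le_rfl⟩
            · exact norm_J_le
            · exact hlip mu hmu t ⟨ht.1.le, ht.2⟩
        _ = _ := by ring
    refine (intervalIntegral.norm_integral_le_of_norm_le_const h5).trans (le_of_eq ?_)
    rw [sub_zero, abs_of_nonneg hx]
    ring
  have hO : (fun mu => q.sol mu x - q.sol lam x - (mu - lam) • D)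
      =O[nhds lam] fun mu => ‖mu - lam‖ ^ 2 := by
    refine Asymptotics.IsBigO.of_bound (x * (x * N * N * N)) ?_
    filter_upwards [Metric.closedBall_mem_nhds lam one_pos] with mu hmu
    rw [Metric.mem_closedBall, dist_eq_norm] at hmu
    simpa using hrem mu hmu
  have h0 : HasDerivAt (fun mu => q.sol mu x - q.sol lam x - (mu - lam) • D) 0 lam := by
    simpa using (hO.hasFDerivAt one_lt_two).hasDerivAt
  have h1 : HasDerivAt (fun mu : ℂ => (mu - lam) • D) D lam := by
    simpa using ((hasDerivAt_id lam).sub_const lam).smul_const D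
  have h2 := (h0.add h1).add_const (q.sol lam x)
  rw [zero_add] at h2
  refine h2.congr_of_eventuallyEq (Eventually.of_forall fun mu => ?_)
  simp

theorem hasDerivAt_sol_apply (q : Potential) (lam : ℂ) {x : ℝ} (hx : 0 ≤ x) (i j : Fin 2) :
    HasDerivAt (fun mu => q.sol mu x i j)
      (-(q.sol lam x * ∫ t in (0 : ℝ)..x, q.inv lam t * J * q.sol lam t) i j) lam := by
  let L : Matrix (Fin 2) (Fin 2) ℂ →L[ℂ] ℂ := LinearMap.toContinuousLinearMap
    { toFun := fun M => M i j
      map_add' := fun _ _ => rfl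
      map_smul' := fun _ _ => rfl }
  exact L.hasFDerivAt.comp_hasDerivAt lam (q.hasDerivAt_sol lam hx)

theorem differentiable_sol_apply (q : Potential) {x : ℝ} (hx : 0 ≤ x) (i j : Fin 2) :
    Differentiable ℂ (fun mu => q.sol mu x i j) :=
  fun lam => (q.hasDerivAt_sol_apply lam hx i j).differentiableAt

/-! ### Real spectral parameters -/

/-- Entrywise conjugation as a continuous real-linear map. -/
noncomputable def _root_.DiracSystem.conjCLM :
    Matrix (Fin 2) (Fin 2) ℂ →L[ℝ] Matrix (Fin 2) (Fin 2) ℂ :=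
  LinearMap.toContinuousLinearMap
    { toFun := fun M => M.map conj
      map_add' := fun A B => by ext; simp
      map_smul' := fun c A => by ext; simp }

/-- For real `lam` the coefficient matrix is real, so the conjugate solves the same initial value
problem. -/
theorem conj_sol (q : Potential) {lam : ℂ} (hlam : lam.im = 0) (x : ℝ) (i j : Fin 2) :
    conj (q.sol lam x i j) = q.sol lam x i j := by
  have hl : conj lam = lam := Complex.conj_eq_iff_im.2 hlam
  have h : HasAEDeriv (fun t => (q.sol lam t).map conj)
      (fun t => q.coeff lam t * (q.sol lam t).map conj) := by
    refine ((q.sol_hasAEDeriv lam).clm conjCLM).congr' fun t => ?_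
    change (q.coeff lam t * q.sol lam t).map conj = _
    rw [Matrix.map_mul]
    congr 1
    rw [coeff_eq]
    ext i j
    fin_cases i <;> fin_cases j <;> simp [hl]
  have h2 := q.eq_sol_mul lam h x
  rw [sol_zero, Matrix.map_one _ (map_zero _) (map_one _), mul_one] at h2
  exact congrFun (congrFun h2 i) j

/-- Conjugate transposition as a continuous real-linear map. -/
noncomputable def _root_.DiracSystem.conjTransposeCLM :
    Matrix (Fin 2) (Fin 2) ℂ →L[ℝ] Matrix (Fin 2) (Fin 2) ℂ :=
  LinearMap.toContinuousLinearMap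
    { toFun := fun M => M.conjTranspose
      map_add' := fun A B => by ext; simp
      map_smul' := fun c A => by ext; simp }

/-- Lagrange's identity. -/
theorem hasAEDeriv_lagrange (q : Potential) (lam : ℂ) :
    HasAEDeriv (fun t => (q.sol lam t).conjTranspose * J * q.sol lam t)
      (fun t => (lam - conj lam) • ((q.sol lam t).conjTranspose * q.sol lam t)) := by
  have h1 := (q.sol_hasAEDeriv lam).clm conjTransposeCLM
  have h2 := (h1.mul (HasAEDeriv.const J)).mul (q.sol_hasAEDeriv lam)
  refine h2.congr' fun t => ?_
  change ((q.coeff lam t * q.sol lam t).conjTranspose * J + (q.sol lam t).conjTranspose * 0)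
    * q.sol lam t + (q.sol lam t).conjTranspose * J * (q.coeff lam t * q.sol lam t) = _
  have key : (q.coeff lam t).conjTranspose * J + J * q.coeff lam t
      = (lam - conj lam) • (1 : Matrix (Fin 2) (Fin 2) ℂ) := by
    rw [coeff_eq]
    ext i j
    fin_cases i <;> fin_cases j <;>
      simp [J, Matrix.mul_apply, Fin.sum_univ_two, Matrix.conjTranspose_apply] <;> ring
  calc _ = (q.sol lam t).conjTranspose * ((q.coeff lam t).conjTranspose * J + J * q.coeff lam t)
        * q.sol lam t := by
        rw [Matrix.conjTranspose_mul]; noncomm_ring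
    _ = _ := by rw [key, mul_smul_comm, mul_one, smul_mul_assoc]

/-- A value of the spectral parameter with a unimodular Floquet multiplier is real. -/
theorem im_eq_zero_of_multiplier (q : Potential) {lam om : ℂ} {x : ℝ} (hx : 0 < x)
    (hom : ‖om‖ = 1) (hdet : (q.sol lam x - om • 1).det = 0) : lam.im = 0 := by
  obtain ⟨c, hc0, hc⟩ := Matrix.exists_mulVec_eq_zero_iff.2 hdet
  rw [Matrix.sub_mulVec, Matrix.smul_mulVec, Matrix.one_mulVec, sub_eq_zero] at hc
  let L : Matrix (Fin 2) (Fin 2) ℂ →L[ℝ] ℂ := LinearMap.toContinuousLinearMap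
    { toFun := fun M => star c ⬝ᵥ M.mulVec c
      map_add' := fun A B => by rw [Matrix.add_mulVec, dotProduct_add]
      map_smul' := fun r A => by rw [Matrix.smul_mulVec, dotProduct_smul]; rfl }
  have hLap : ∀ M, L M = star c ⬝ᵥ M.mulVec c := fun M => rfl
  have hL : ∀ A B : Matrix (Fin 2) (Fin 2) ℂ, L (A.conjTranspose * B * A)
      = star (A.mulVec c) ⬝ᵥ B.mulVec (A.mulVec c) := by
    intro A B
    rw [hLap, Matrix.star_mulVec, ← Matrix.dotProduct_mulVec, Matrix.mulVec_mulVec,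
      Matrix.mulVec_mulVec, mul_assoc]
  have hpos : ∀ t, L ((q.sol lam t).conjTranspose * q.sol lam t)
      = ((‖(q.sol lam t).mulVec c 0‖ ^ 2 + ‖(q.sol lam t).mulVec c 1‖ ^ 2 : ℝ) : ℂ) := by
    intro t
    have h := hL (q.sol lam t) 1
    rw [mul_one, Matrix.one_mulVec] at h
    rw [h]
    simp only [dotProduct, Fin.sum_univ_two, Pi.star_apply, Complex.star_def, Complex.conj_mul']
    push_cast
    ring
  have h1 := ((q.hasAEDeriv_lagrange lam).clm L).eq_integral x
  -- On the eigenvector `c` the form at `x` is `‖om‖ ^ 2` times its value at 0. Lagrange's identity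
  -- therefore has zero increment, while the integral multiplying `lam - conj lam` is positive.
  have h2 : L ((q.sol lam x).conjTranspose * J * q.sol lam x)
      = L ((q.sol lam 0).conjTranspose * J * q.sol lam 0) := by
    rw [hL, hc, sol_zero, Matrix.conjTranspose_one, one_mul, mul_one, hLap, Matrix.mulVec_smul,
      dotProduct_smul, star_smul, smul_dotProduct, smul_smul, smul_eq_mul, Complex.star_def,
      Complex.mul_conj', hom]
    simp
  rw [h2, left_eq_add] at h1
  have hsm : ∀ t, L ((lam - conj lam) • ((q.sol lam t).conjTranspose * q.sol lam t))
      = (lam - conj lam) *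
        ((‖(q.sol lam t).mulVec c 0‖ ^ 2 + ‖(q.sol lam t).mulVec c 1‖ ^ 2 : ℝ) : ℂ) := by
    intro t
    rw [← hpos, hLap, hLap, Matrix.smul_mulVec, dotProduct_smul, smul_eq_mul]
  simp_rw [hsm] at h1
  rw [intervalIntegral.integral_const_mul, intervalIntegral.integral_ofReal] at h1
  have hent : ∀ i, Continuous fun t => (q.sol lam t).mulVec c i := by
    intro i
    have hij : ∀ j, Continuous fun t => q.sol lam t i j := fun j =>
      (entryCLM i j).continuous.comp (q.continuous_sol lam)
    simp only [Matrix.mulVec, dotProduct, Fin.sum_univ_two]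
    have := hij 0
    have := hij 1
    fun_prop
  have hintpos : 0 < ∫ t in (0 : ℝ)..x,
      (‖(q.sol lam t).mulVec c 0‖ ^ 2 + ‖(q.sol lam t).mulVec c 1‖ ^ 2) := by
    refine intervalIntegral.intervalIntegral_pos_of_pos_on ?_ (fun t _ => ?_) hx
    · exact (((hent 0).norm.pow 2).add ((hent 1).norm.pow 2)).intervalIntegrable 0 x
    · by_contra hcon
      have hcon' : ‖(q.sol lam t).mulVec c 0‖ ^ 2 + ‖(q.sol lam t).mulVec c 1‖ ^ 2 ≤ 0 :=
        not_lt.1 hcon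
      have p0 := sq_nonneg ‖(q.sol lam t).mulVec c 0‖
      have p1 := sq_nonneg ‖(q.sol lam t).mulVec c 1‖
      have e0 : ‖(q.sol lam t).mulVec c 0‖ = 0 :=
        (pow_eq_zero_iff two_ne_zero).1 (le_antisymm (by linarith) p0)
      have e1 : ‖(q.sol lam t).mulVec c 1‖ = 0 :=
        (pow_eq_zero_iff two_ne_zero).1 (le_antisymm (by linarith) p1)
      refine hc0 ?_
      have e2 : (q.sol lam t).mulVec c = 0 := by
        funext i
        fin_cases i
        · exact norm_eq_zero.1 e0
        · exact norm_eq_zero.1 e1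
      have e3 : (q.inv lam t).mulVec ((q.sol lam t).mulVec c) = (q.inv lam t).mulVec 0 := by rw [e2]
      rwa [Matrix.mulVec_mulVec, inv_mul_sol, Matrix.one_mulVec, Matrix.mulVec_zero] at e3
  have h3 : lam - conj lam = 0 := by
    rcases mul_eq_zero.1 h1 with h | h
    · exact h
    · exact absurd (Complex.ofReal_eq_zero.1 h) hintpos.ne'
  exact Complex.conj_eq_iff_im.1 (sub_eq_zero.1 h3).symm

/-- At a real value of the spectral parameter where the trace lies in `[-2, 2]` and is critical, the
fundamental matrix is scalar. -/
theorem sol_scalar_of_critical (q : Potential) {lam : ℂ} (hlam : lam.im = 0) {x : ℝ} (hx : 0 < x)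
    {τ : ℝ} (hτ : τ ^ 2 ≤ 4) (htr : (q.sol lam x).trace = τ)
    (hd : HasDerivAt (fun mu => (q.sol mu x).trace) 0 lam) :
    q.sol lam x 0 1 = 0 ∧ q.sol lam x 1 0 = 0 ∧ q.sol lam x 0 0 = q.sol lam x 1 1 := by
  set y : Fin 2 → Fin 2 → ℝ → ℝ := fun i j t => (q.sol lam t i j).re with hy
  have hyc : ∀ i j, Continuous (y i j) := fun i j =>
    Complex.continuous_re.comp ((entryCLM i j).continuous.comp (q.continuous_sol lam))
  have hsol : ∀ i j t, q.sol lam t i j = (y i j t : ℂ) := fun i j t =>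
    (Complex.conj_eq_iff_re.1 (q.conj_sol hlam t i j)).symm
  set s11 : ℝ := ∫ t in (0 : ℝ)..x, (y 0 0 t ^ 2 + y 1 0 t ^ 2) with hs11
  set s12 : ℝ := ∫ t in (0 : ℝ)..x, (y 0 0 t * y 0 1 t + y 1 0 t * y 1 1 t) with hs12
  set s22 : ℝ := ∫ t in (0 : ℝ)..x, (y 0 1 t ^ 2 + y 1 1 t ^ 2) with hs22
  set T : Matrix (Fin 2) (Fin 2) ℂ := ∫ t in (0 : ℝ)..x, q.inv lam t * J * q.sol lam t with hT
  have hci : Continuous fun t => q.inv lam t * J * q.sol lam t := by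
    have h1 := q.continuous_inv lam
    have h2 := q.continuous_sol lam
    fun_prop
  have hTij : ∀ i j, T i j = ∫ t in (0 : ℝ)..x, (q.inv lam t * J * q.sol lam t) i j := fun i j =>
    ((entryCLM i j).intervalIntegral_comp_comm (hci.intervalIntegrable 0 x)).symm
  -- For real solutions the entries of `adj(Y) J Y` are, up to sign, inner products of the columns
  -- of `Y`; thus `T` is their integrated Gram matrix in disguise.
  have hTe : T = !![(s12 : ℂ), s22; -s11, -s12] := by
    have e : ∀ t, q.inv lam t * J * q.sol lam t
        = !![((y 0 0 t * y 0 1 t + y 1 0 t * y 1 1 t : ℝ) : ℂ), ((y 0 1 t ^ 2 + y 1 1 t ^ 2 : ℝ) : ℂ);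
          ((-(y 0 0 t ^ 2 + y 1 0 t ^ 2) : ℝ) : ℂ),
          ((-(y 0 0 t * y 0 1 t + y 1 0 t * y 1 1 t) : ℝ) : ℂ)] := by
      intro t
      rw [inv, Matrix.adjugate_fin_two]
      ext i j
      fin_cases i <;> fin_cases j <;>
        simp [J, Matrix.mul_apply, Fin.sum_univ_two, hsol] <;> ring
    ext i j
    rw [hTij]
    simp_rw [e]
    fin_cases i <;> fin_cases j <;>
      simp only [Fin.zero_eta, Fin.mk_one, Matrix.of_apply, Matrix.cons_val', Matrix.cons_val_zero,
        Matrix.cons_val_one, Matrix.cons_val_fin_one, intervalIntegral.integral_ofReal,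
        intervalIntegral.integral_neg, Complex.ofReal_neg] <;> rfl
  have hform : ∀ a b : ℝ, (a, b) ≠ 0 → 0 < a ^ 2 * s11 + 2 * (a * b) * s12 + b ^ 2 * s22 := by
    intro a b hab
    have h1 : a ^ 2 * s11 + 2 * (a * b) * s12 + b ^ 2 * s22 = ∫ t in (0 : ℝ)..x,
        ((y 0 0 t * a + y 0 1 t * b) ^ 2 + (y 1 0 t * a + y 1 1 t * b) ^ 2) := by
      have c1 : IntervalIntegrable (fun t => a ^ 2 * (y 0 0 t ^ 2 + y 1 0 t ^ 2)) volume 0 x :=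
        Continuous.intervalIntegrable (by fun_prop) 0 x
      have c2 : IntervalIntegrable (fun t => 2 * (a * b) * (y 0 0 t * y 0 1 t + y 1 0 t * y 1 1 t))
          volume 0 x := Continuous.intervalIntegrable (by fun_prop) 0 x
      have c3 : IntervalIntegrable (fun t => b ^ 2 * (y 0 1 t ^ 2 + y 1 1 t ^ 2)) volume 0 x :=
        Continuous.intervalIntegrable (by fun_prop) 0 x
      rw [hs11, hs12, hs22, ← intervalIntegral.integral_const_mul,
        ← intervalIntegral.integral_const_mul, ← intervalIntegral.integral_const_mul,
        ← intervalIntegral.integral_add c1 c2, ← intervalIntegral.integral_add (c1.add c2) c3]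
      refine intervalIntegral.integral_congr fun t _ => ?_
      ring
    rw [h1]
    refine intervalIntegral.intervalIntegral_pos_of_pos_on
      (Continuous.intervalIntegrable (by fun_prop) 0 x) (fun t _ => ?_) hx
    have hdet : y 0 0 t * y 1 1 t - y 0 1 t * y 1 0 t = 1 := by
      have h2 := q.det_sol lam t
      rw [Matrix.det_fin_two] at h2
      simp only [hsol] at h2
      exact_mod_cast h2
    by_contra hcon
    have e0 : y 0 0 t * a + y 0 1 t * b = 0 := by nlinarith
    have e1 : y 1 0 t * a + y 1 1 t * b = 0 := by nlinarith
    refine hab (Prod.ext ?_ ?_)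
    · change a = 0
      linear_combination y 1 1 t * e0 - y 0 1 t * e1 - a * hdet
    · change b = 0
      linear_combination y 0 0 t * e1 - y 1 0 t * e0 - b * hdet
  set a := y 0 0 x
  set b := y 0 1 x
  set c := y 1 0 x
  set d := y 1 1 x
  have hdet : a * d - b * c = 1 := by
    have h2 := q.det_sol lam x
    rw [Matrix.det_fin_two] at h2
    simp only [hsol] at h2
    exact_mod_cast h2
  have htr' : a + d = τ := by
    rw [Matrix.trace_fin_two, hsol, hsol] at htr
    exact_mod_cast htr
  -- The derivative of the trace is `-tr (Y T)`, which pairs the quadratic form with coefficients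
  -- `-b`, `a - d`, `c` with the Gram matrix.
  have hcrit : -b * s11 + (a - d) * s12 + c * s22 = 0 := by
    have h1 := (q.hasDerivAt_sol_apply lam hx.le 0 0).add (q.hasDerivAt_sol_apply lam hx.le 1 1)
    have h2 : HasDerivAt (fun mu => (q.sol mu x).trace) (-(q.sol lam x * T) 0 0
        + -(q.sol lam x * T) 1 1) lam := by
      refine h1.congr_of_eventuallyEq (Eventually.of_forall fun mu => ?_)
      exact Matrix.trace_fin_two _
    have h3 := hd.unique h2
    rw [hTe] at h3
    simp only [Matrix.mul_apply, Fin.sum_univ_two, hsol, Matrix.of_apply, Matrix.cons_val',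
      Matrix.cons_val_zero, Matrix.cons_val_one, Matrix.cons_val_fin_one] at h3
    have h4 : (0 : ℂ) = ((-(a * s12 + b * -s11) + -(c * s22 + d * -s12) : ℝ) : ℂ) := by
      push_cast
      exact h3
    have h5 : (0 : ℝ) = -(a * s12 + b * -s11) + -(c * s22 + d * -s12) := by exact_mod_cast h4
    linarith
  have hs22pos : 0 < s22 := by
    have := hform 0 1 (by simp)
    simpa using this
  -- This quantity equals `1 - τ² / 4`, so a trace in `[-2, 2]` makes that quadratic form
  -- semidefinite. A semidefinite form whose pairing with a positive definite one is zero must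
  -- vanish.
  have hdisc : 0 ≤ -(b * c) - ((a - d) / 2) ^ 2 := by
    have h1 : -(b * c) - ((a - d) / 2) ^ 2 = 1 - τ ^ 2 / 4 := by
      rw [← htr']
      linear_combination hdet
    rw [h1]
    linarith
  -- The test vector `(b, -(a - d) / 2)` completes the square: adding `b` times `hcrit` to the Gram
  -- form there leaves `(b c + ((a - d) / 2)²) s22 > 0`, against `hdisc`.
  have hb : b = 0 := by
    by_contra hb
    have h1 := hform b (-((a - d) / 2)) (by simp [hb])
    have h2 : b * (-b * s11 + (a - d) * s12 + c * s22) = 0 := by rw [hcrit, mul_zero]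
    have h3 := mul_nonneg hdisc hs22pos.le
    nlinarith
  have had : a = d := by
    rw [hb] at hdisc
    nlinarith [sq_nonneg ((a - d) / 2)]
  have hc : c = 0 := by
    rw [hb, had] at hcrit
    have : c * s22 = 0 := by linarith
    exact (mul_eq_zero.1 this).resolve_right hs22pos.ne'
  refine ⟨?_, ?_, ?_⟩
  · rw [hsol]; exact_mod_cast hb
  · rw [hsol]; exact_mod_cast hc
  · rw [hsol, hsol]; exact_mod_cast had

end Potential
end DiracSystem

/-! ### Entire functions on an expanding sequence of squares. -/

namespace DiracSystem
open Filter Set Asymptotics Bornology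

/-- `z` lies on the boundary of the square `|re z|, |im z| ≤ 2 k`. -/
def OnSquare (k : ℕ) (z : ℂ) : Prop :=
  |z.re| ≤ 2 * k ∧ |z.im| ≤ 2 * k ∧ (|z.re| = 2 * k ∨ |z.im| = 2 * k)

/-- The filter of neighbourhoods of infinity along the boundaries of the squares
`|re z|, |im z| ≤ 2 k`. -/
noncomputable def squares : Filter ℂ := cobounded ℂ ⊓ 𝓟 {z | ∃ k : ℕ, OnSquare k z}

theorem OnSquare.le_norm {k : ℕ} {z : ℂ} (h : OnSquare k z) : 2 * (k : ℝ) ≤ ‖z‖ := by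
  rcases h.2.2 with h | h
  · exact h ▸ Complex.abs_re_le_norm z
  · exact h ▸ Complex.abs_im_le_norm z

theorem norm_le_of_forall_onSquare {F : ℂ → ℂ} (hF : Differentiable ℂ F) {k : ℕ} {ε : ℝ}
    (h : ∀ z, OnSquare k z → ‖F z‖ ≤ ε) {z : ℂ} (hz : ‖z‖ < 2 * k) : ‖F z‖ ≤ ε := by
  set U : Set ℂ := {z | |z.re| < 2 * k ∧ |z.im| < 2 * k} with hU
  set V : Set ℂ := {z | |z.re| ≤ 2 * k ∧ |z.im| ≤ 2 * k} with hV
  have hUo : IsOpen U :=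
    (isOpen_lt Complex.continuous_re.abs continuous_const).inter
      (isOpen_lt Complex.continuous_im.abs continuous_const)
  have hVc : IsClosed V :=
    (isClosed_le Complex.continuous_re.abs continuous_const).inter
      (isClosed_le Complex.continuous_im.abs continuous_const)
  have hUV : U ⊆ V := fun z hz => ⟨hz.1.le, hz.2.le⟩
  have hb : IsBounded U := by
    refine (Metric.isBounded_closedBall (x := (0 : ℂ)) (r := 4 * k)).subset fun z hz => ?_
    rw [mem_closedBall_zero_iff]
    have := Complex.norm_le_abs_re_add_abs_im z
    linarith [hz.1, hz.2]
  refine Complex.norm_le_of_forall_mem_frontier_norm_le hb hF.diffContOnCl (fun w hw => h w ?_)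
    (subset_closure (show z ∈ U from ⟨(Complex.abs_re_le_norm z).trans_lt hz,
      (Complex.abs_im_le_norm z).trans_lt hz⟩))
  rw [hUo.frontier_eq] at hw
  have hwV : w ∈ V := closure_minimal hUV hVc hw.1
  refine ⟨hwV.1, hwV.2, ?_⟩
  by_contra hcon
  push Not at hcon
  exact hw.2 ⟨lt_of_le_of_ne hwV.1 hcon.1, lt_of_le_of_ne hwV.2 hcon.2⟩

/-- An entire function tending to zero along the boundaries of the squares vanishes. -/
theorem eq_zero_of_tendsto_squares {F : ℂ → ℂ} (hF : Differentiable ℂ F)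
    (h : Tendsto F squares (nhds 0)) (z : ℂ) : F z = 0 := by
  rw [← norm_le_zero_iff]
  refine le_of_forall_pos_le_add fun ε hε => ?_
  rw [zero_add]
  have h1 : ∀ᶠ w in squares, ‖F w‖ ≤ ε := by
    filter_upwards [(tendsto_zero_iff_norm_tendsto_zero.1 h).eventually (gt_mem_nhds hε)] with w hw
    exact hw.le
  rw [squares, eventually_inf_principal] at h1
  obtain ⟨R, -, hR⟩ := (hasBasis_cobounded_norm (E := ℂ)).eventually_iff.1 h1
  obtain ⟨k, hk⟩ := exists_nat_gt (max R ‖z‖)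
  have hk1 : R < k := (le_max_left _ _).trans_lt hk
  have hk2 : ‖z‖ < k := (le_max_right _ _).trans_lt hk
  have hk0 : (0 : ℝ) ≤ k := Nat.cast_nonneg k
  refine norm_le_of_forall_onSquare hF (k := k) (fun w hw => hR ?_ ⟨k, hw⟩) (by linarith)
  have := hw.le_norm
  change R ≤ ‖w‖
  linarith

/-- The half-side `2 k` is tuned to `cos (π z / 2)`. On the vertical sides `π re z / 2` is `±k π`,
so the real part has modulus `cosh`. On the horizontal sides one of the two exponentials dominates,
for which `k ≥ 1` is needed. -/
theorem exp_le_norm_cos {k : ℕ} (hk : 1 ≤ k) {z : ℂ} (hz : OnSquare k z) :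
    Real.exp (Real.pi / 2 * |z.im|) ≤ 4 * ‖Complex.cos (((Real.pi / 2 : ℝ) : ℂ) * z)‖ := by
  set y := Real.pi / 2 * z.im with hy
  have hyabs : Real.pi / 2 * |z.im| = |y| := by
    rw [hy, abs_mul, abs_of_pos Real.pi_div_two_pos]
  rw [hyabs]
  rcases hz.2.2 with h | h
  · have hc : Complex.cos (((Real.pi / 2 : ℝ) : ℂ) * z)
        = Complex.cos ((Real.pi / 2 * z.re : ℝ) + (y : ℝ) * Complex.I) := by
      congr 1
      apply Complex.ext <;> simp [hy]
    have hcos : |Real.cos (Real.pi / 2 * z.re)| = 1 := by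
      have e : |Real.pi / 2 * z.re| = k * Real.pi := by
        rw [abs_mul, h, abs_of_pos Real.pi_div_two_pos]
        ring
      rw [← Real.cos_abs, e, Real.abs_cos_eq_sqrt_one_sub_sin_sq, Real.sin_nat_mul_pi]
      simp
    have hre : (Complex.cos (((Real.pi / 2 : ℝ) : ℂ) * z)).re
        = Real.cos (Real.pi / 2 * z.re) * Real.cosh y := by
      rw [hc, Complex.cos_add_mul_I, ← Complex.ofReal_cos, ← Complex.ofReal_cosh,
        ← Complex.ofReal_sin, ← Complex.ofReal_sinh, ← Complex.ofReal_mul, ← Complex.ofReal_mul,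
        Complex.sub_re, Complex.ofReal_re, Complex.re_ofReal_mul, Complex.I_re, mul_zero, sub_zero]
    have h1 := Complex.abs_re_le_norm (Complex.cos (((Real.pi / 2 : ℝ) : ℂ) * z))
    rw [hre, abs_mul, hcos, one_mul, abs_of_pos (Real.cosh_pos y)] at h1
    have h2 : Real.exp |y| ≤ 2 * Real.cosh y := by
      rw [← Real.cosh_abs, Real.cosh_eq]
      linarith [Real.exp_pos (-|y|)]
    linarith [Real.cosh_pos y]
  · have hy1 : 1 ≤ |y| := by
      rw [← hyabs, h]
      have : (1 : ℝ) ≤ k := by exact_mod_cast hk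
      nlinarith [Real.pi_gt_three]
    have him : (((Real.pi / 2 : ℝ) : ℂ) * z).im = y := by simp [hy]
    set u := ((Real.pi / 2 : ℝ) : ℂ) * z with hu
    have h1 : Real.exp |y| - Real.exp (-|y|) ≤ 2 * ‖Complex.cos u‖ := by
      have e : 2 * Complex.cos u = Complex.exp (u * Complex.I) + Complex.exp (-u * Complex.I) := by
        rw [Complex.cos]; ring
      have e2 : 2 * ‖Complex.cos u‖
          = ‖Complex.exp (u * Complex.I) + Complex.exp (-u * Complex.I)‖ := by
        rw [← e, norm_mul, Complex.norm_two]
      have n1 : ‖Complex.exp (u * Complex.I)‖ = Real.exp (-y) := by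
        rw [Complex.norm_exp, ← him]; simp
      have n2 : ‖Complex.exp (-u * Complex.I)‖ = Real.exp y := by
        rw [Complex.norm_exp, ← him]; simp
      rw [e2]
      rcases abs_cases y with ⟨h, -⟩ | ⟨h, -⟩
      · rw [h, ← n1, ← n2, add_comm]
        have := norm_sub_norm_le (Complex.exp (-u * Complex.I)) (-Complex.exp (u * Complex.I))
        rwa [norm_neg, sub_neg_eq_add] at this
      · rw [h, neg_neg, ← n1, ← n2]
        have := norm_sub_norm_le (Complex.exp (u * Complex.I)) (-Complex.exp (-u * Complex.I))
        rwa [norm_neg, sub_neg_eq_add] at this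
    have h2 : Real.exp (-|y|) ≤ 1 / 2 * Real.exp |y| := by
      have e1 : Real.exp (-|y|) ≤ 1 := Real.exp_le_one_iff.2 (by linarith)
      have e2 := Real.add_one_le_exp |y|
      linarith
    linarith

/-- The growth function `exp (c |im z|)`. -/
noncomputable def growth (c : ℝ) (z : ℂ) : ℝ := Real.exp (c * |z.im|)

theorem growth_pos (c : ℝ) (z : ℂ) : 0 < growth c z := Real.exp_pos _

theorem growth_mul (c d : ℝ) (z : ℂ) : growth c z * growth d z = growth (c + d) z := by
  rw [growth, growth, growth, ← Real.exp_add, add_mul]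

theorem growth_isBigO_cos :
    growth (Real.pi / 2) =O[squares] fun z => Complex.cos (((Real.pi / 2 : ℝ) : ℂ) * z) := by
  refine IsBigO.of_bound 4 ?_
  rw [squares, eventually_inf_principal]
  filter_upwards [(hasBasis_cobounded_norm (E := ℂ)).mem_of_mem (i := 1) trivial] with z hz hk
  obtain ⟨k, hk⟩ := hk
  have hz1 : 1 ≤ ‖z‖ := hz
  rw [Real.norm_of_nonneg (growth_pos _ _).le]
  refine exp_le_norm_cos (Nat.one_le_iff_ne_zero.2 ?_) hk
  -- The square with `k = 0` is the origin alone.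
  rintro rfl
  have h1 := Complex.norm_le_abs_re_add_abs_im z
  have h2 := hk.1
  have h3 := hk.2.1
  simp only [Nat.cast_zero, mul_zero] at h2 h3
  linarith

/-- If `F * W` is negligible and `W` has full growth, then `F` tends to zero. -/
theorem tendsto_zero_of_mul_isLittleO {F W : ℂ → ℂ} {c : ℝ} (hW : growth c =O[squares] W)
    (h : (fun z => F z * W z) =o[squares] growth c) : Tendsto F squares (nhds 0) := by
  have h1 := (h.trans_isBigO hW).tendsto_div_nhds_zero
  obtain ⟨C, hC⟩ := hW.bound
  refine h1.congr' ?_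
  filter_upwards [hC] with z hz
  have hWz : W z ≠ 0 := by
    intro h0
    rw [h0, norm_zero, mul_zero, Real.norm_of_nonneg (growth_pos _ _).le] at hz
    exact (growth_pos c z).not_ge hz
  field_simp

/-- Division of the square of an entire function by an entire function with only double zeros. -/
theorem exists_sq_eq_mul {F G : ℂ → ℂ} (hF : Differentiable ℂ F) (hG : Differentiable ℂ G)
    (hord : ∀ z, G z = 0 → analyticOrderAt G z = 2) (hFG : ∀ z, G z = 0 → F z = 0) :
    ∃ H : ℂ → ℂ, Differentiable ℂ H ∧ ∀ z, H z * G z = F z ^ 2 := by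
  classical
  -- At a zero of `G` the value is the limit through punctured neighbourhoods. `F` vanishes there at
  -- least once, so `F ^ 2` absorbs the double zero; `F / G` itself could have a simple pole.
  set H : ℂ → ℂ := fun z =>
    if G z = 0 then limUnder (nhdsWithin z {z}ᶜ) (fun w => F w ^ 2 / G w) else F z ^ 2 / G z with hH
  refine ⟨H, fun z₀ => ?_, fun z => ?_⟩
  · by_cases h0 : G z₀ = 0
    · obtain ⟨g, hg, hg0, hGg⟩ := (hG.analyticAt z₀).analyticOrderAt_eq_natCast.1
        (show analyticOrderAt G z₀ = ((2 : ℕ) : ℕ∞) from hord z₀ h0)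
      set f : ℂ → ℂ := dslope F z₀ with hf
      have hfd : Differentiable ℂ f := by
        rw [← differentiableOn_univ, hf, Complex.differentiableOn_dslope univ_mem,
          differentiableOn_univ]
        exact hF
      have hFf : ∀ z, F z = (z - z₀) * f z := by
        intro z
        have := sub_smul_dslope F z₀ z
        rw [hFG z₀ h0, sub_zero] at this
        exact this.symm
      have hgne : ∀ᶠ z in nhds z₀, g z ≠ 0 := hg.continuousAt.eventually_ne hg0
      have hfg : DifferentiableAt ℂ (fun z => f z ^ 2 / g z) z₀ :=
        ((hfd z₀).pow 2).div hg.differentiableAt hg0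
      have hquot : ∀ᶠ z in nhds z₀, z ≠ z₀ → G z ≠ 0 ∧ F z ^ 2 / G z = f z ^ 2 / g z := by
        filter_upwards [hgne, hGg] with z h1 h2 h3
        have h4 : z - z₀ ≠ 0 := sub_ne_zero.2 h3
        rw [smul_eq_mul] at h2
        refine ⟨by rw [h2]; exact mul_ne_zero (pow_ne_zero 2 h4) h1, ?_⟩
        rw [h2, hFf]
        field_simp
      have hlim : limUnder (nhdsWithin z₀ {z₀}ᶜ) (fun w => F w ^ 2 / G w) = f z₀ ^ 2 / g z₀ := by
        refine Tendsto.limUnder_eq ?_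
        have h1 : Tendsto (fun z => f z ^ 2 / g z) (nhdsWithin z₀ {z₀}ᶜ)
            (nhds (f z₀ ^ 2 / g z₀)) := hfg.continuousAt.continuousWithinAt
        refine h1.congr' ?_
        filter_upwards [eventually_nhdsWithin_of_eventually_nhds hquot, self_mem_nhdsWithin] with z
          h2 h3
        exact (h2 h3).2.symm
      refine hfg.congr_of_eventuallyEq ?_
      filter_upwards [hquot] with z hz
      by_cases hzz : z = z₀
      · rw [hzz, hH]
        simp only [h0, if_true]
        exact hlim
      · rw [hH]
        simp only [(hz hzz).1, if_false]
        exact (hz hzz).2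
    · have h1 : DifferentiableAt ℂ (fun z => F z ^ 2 / G z) z₀ := ((hF z₀).pow 2).div (hG z₀) h0
      refine h1.congr_of_eventuallyEq ?_
      filter_upwards [(hG z₀).continuousAt.eventually_ne h0] with z hz
      rw [hH]
      simp only [hz, if_false]
  · by_cases h0 : G z = 0
    · rw [h0, mul_zero, hFG z h0]
      simp
    · rw [hH]
      simp only [h0, if_false]
      field_simp

end DiracSystem

/-! ### Double zeros of `tr Y(π) + 2` and the half-period of the potential. -/

namespace DiracSystem
open MeasureTheory Set Filter Asymptotics
open scoped Matrix.Norms.Operator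
attribute [local instance] normTopology

/-- A function with full growth absorbs a negligible error: `W` and `C` are asymptotically
equivalent. This carries lower bounds from the free system to a general potential. -/
theorem growth_isBigO_of_sub_isLittleO {C W : ℂ → ℂ} {c : ℝ} (hC : growth c =O[squares] C)
    (h : (fun z => W z - C z) =o[squares] growth c) : growth c =O[squares] W :=
  hC.trans (IsEquivalent.isBigO_symm (h.trans_isBigO hC))

theorem IsLittleO.mul_growth {f g : ℂ → ℂ} {c d e : ℝ} (hf : f =o[squares] growth c)
    (hg : g =O[squares] growth d) (he : c + d = e) : (fun z => f z * g z) =o[squares] growth e := by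
  refine (hf.mul_isBigO hg).congr_right fun z => ?_
  rw [growth_mul, he]

/-- An algebraic identity comparing two factorisations `Z₁ Y₁ = Z₂ Y₂` of a matrix. -/
theorem mul_apply_eq_of_factorizations {Y₁ Y₂ Z₁ Z₂ : Matrix (Fin 2) (Fin 2) ℂ}
    (h : Z₁ * Y₁ = Z₂ * Y₂) (hY₁ : Y₁ * Y₁.adjugate = 1) (hY₂ : Y₂.adjugate * Y₂ = 1) (i : Fin 2) :
    (Y₁ * Y₂.adjugate - 1) i 0 * (Z₂ * Y₂) 0 0 =
        (Y₁ i 0 - Y₂ i 0) * Z₂ 0 0 - (Z₁.adjugate i 1 - Z₂.adjugate i 1) * Y₂ 1 0 ∧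
      (Y₁ * Y₂.adjugate - 1) i 1 * (Z₂ * Y₂) 0 0 =
        (Y₁ i 0 - Y₂ i 0) * Z₂ 0 1 + (Z₁.adjugate i 1 - Z₂.adjugate i 1) * Y₂ 0 0 := by
  set P := Y₁ * Y₂.adjugate with hP
  have e1 : P * Y₂ = Y₁ := by rw [hP, mul_assoc, hY₂, mul_one]
  have e2 : P * Z₂.adjugate = Z₁.adjugate := by
    rw [hP, mul_assoc, ← Matrix.adjugate_mul_distrib, ← h, Matrix.adjugate_mul_distrib,
      ← mul_assoc, hY₁, one_mul]
  -- Row `i` of `P` satisfies two linear equations, from the first column of `Y₂` and the second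
  -- column of `adj Z₂`, with determinant `(Z₂ * Y₂) 0 0`. The claim is Cramer's rule after
  -- subtracting the corresponding equations for the identity matrix.
  have h1 : P i 0 * Y₂ 0 0 + P i 1 * Y₂ 1 0 = Y₁ i 0 := by
    rw [← e1, Matrix.mul_apply, Fin.sum_univ_two]
  have h2 : -(P i 0 * Z₂ 0 1) + P i 1 * Z₂ 0 0 = Z₁.adjugate i 1 := by
    rw [← e2, Matrix.mul_apply, Fin.sum_univ_two]
    simp [Matrix.adjugate_fin_two]
  have hw : (Z₂ * Y₂) 0 0 = Z₂ 0 0 * Y₂ 0 0 + Z₂ 0 1 * Y₂ 1 0 := by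
    rw [Matrix.mul_apply, Fin.sum_univ_two]
  rw [hw, ← h1, ← h2]
  fin_cases i <;> constructor <;>
    simp [Matrix.sub_apply, Matrix.adjugate_fin_two] <;> ring

/-- If `B - A` is diagonal modulo the relations of a square root, then `A = B` or `B = -A⁻¹`. -/
theorem eq_or_trace_mul_eq {A B : Matrix (Fin 2) (Fin 2) ℂ} (hA : A.det = 1) (hB : B.det = 1)
    (h01 : A 0 1 = B 0 1) (h10 : A 1 0 = B 1 0) (hd : A 0 0 + B 1 1 = A 1 1 + B 0 0) :
    A = B ∨ (B * A).trace + 2 = 0 := by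
  rw [Matrix.det_fin_two] at hA hB
  -- Equal off-diagonal entries and determinants give `A₀₀ A₁₁ = B₀₀ B₁₁`; eliminating `A₁₁` through
  -- `hd` makes the difference factor.
  have h : (A 0 0 - B 0 0) * (A 0 0 + B 1 1) = 0 := by
    rw [← h01, ← h10] at hB
    linear_combination hA - hB + A 0 0 * hd
  rcases mul_eq_zero.1 h with h | h
  · left
    have h00 : A 0 0 = B 0 0 := sub_eq_zero.1 h
    ext i j
    fin_cases i <;> fin_cases j
    · exact h00
    · exact h01
    · exact h10
    · change A 1 1 = B 1 1
      rw [h00] at hd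
      linear_combination -hd
  · right
    rw [Matrix.trace_fin_two, Matrix.mul_apply, Matrix.mul_apply, Fin.sum_univ_two,
      Fin.sum_univ_two, ← h01, ← h10]
    have e1 : B 1 1 = -A 0 0 := by linear_combination h
    have e2 : B 0 0 = -A 1 1 := by linear_combination h - hd
    rw [e1, e2]
    linear_combination -2 * hA

theorem rot_apply_isBigO {x : ℝ} (hx : 0 ≤ x) (i j : Fin 2) :
    (fun lam => rot lam x i j) =O[squares] growth x := by
  refine IsBigO.of_bound 2 (Eventually.of_forall fun lam => ?_)
  rw [Real.norm_of_nonneg (growth_pos _ _).le, growth, mul_comm x]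
  exact (norm_entry_le _ i j).trans (norm_rot_le lam hx)

theorem squares_le_cobounded : squares ≤ Bornology.cobounded ℂ := inf_le_left

namespace Potential

theorem sol_apply_sub_rot_isLittleO (q : Potential) {x : ℝ} (hx : 0 ≤ x) (i j : Fin 2) :
    (fun lam => q.sol lam x i j - rot lam x i j) =o[squares] growth x := by
  refine IsLittleO.of_bound fun ε hε => squares_le_cobounded ?_
  obtain ⟨K, hK⟩ := q.sol_asymptotics hx hε
  filter_upwards [(hasBasis_cobounded_norm (E := ℂ)).mem_of_mem (i := K) trivial] with lam hlam
  rw [Real.norm_of_nonneg (growth_pos _ _).le, growth, mul_comm x]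
  exact (norm_entry_le (q.sol lam x - rot lam x) i j).trans (hK lam hlam)

theorem sol_apply_isBigO (q : Potential) {x : ℝ} (hx : 0 ≤ x) (i j : Fin 2) :
    (fun lam => q.sol lam x i j) =O[squares] growth x :=
  ((q.sol_apply_sub_rot_isLittleO hx i j).isBigO.add (rot_apply_isBigO hx i j)).congr_left
    fun _ => sub_add_cancel _ _

theorem sol_apply_sub_sol_apply_isLittleO (q p : Potential) {x : ℝ} (hx : 0 ≤ x) (i j : Fin 2) :
    (fun lam => q.sol lam x i j - p.sol lam x i j) =o[squares] growth x :=
  ((q.sol_apply_sub_rot_isLittleO hx i j).sub (p.sol_apply_sub_rot_isLittleO hx i j)).congr_left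
    fun _ => sub_sub_sub_cancel_right _ _ _

theorem inv_apply_sub_inv_apply_isLittleO (q p : Potential) {x : ℝ} (hx : 0 ≤ x) (i j : Fin 2) :
    (fun lam => q.inv lam x i j - p.inv lam x i j) =o[squares] growth x := by
  have h := q.sol_apply_sub_sol_apply_isLittleO p hx
  fin_cases i <;> fin_cases j
  · exact (h 1 1).congr_left fun lam => by simp [inv, Matrix.adjugate_fin_two]
  · exact (h 0 1).neg_left.congr_left fun lam => by simp [inv, Matrix.adjugate_fin_two]; ring
  · exact (h 1 0).neg_left.congr_left fun lam => by simp [inv, Matrix.adjugate_fin_two]; ring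
  · exact (h 0 0).congr_left fun lam => by simp [inv, Matrix.adjugate_fin_two]

theorem differentiable_inv_apply (q : Potential) {x : ℝ} (hx : 0 ≤ x) (i j : Fin 2) :
    Differentiable ℂ (fun mu => q.inv mu x i j) := by
  have h := q.differentiable_sol_apply hx
  fin_cases i <;> fin_cases j
  · simpa [inv, Matrix.adjugate_fin_two] using h 1 1
  · simpa [inv, Matrix.adjugate_fin_two] using (h 0 1).neg
  · simpa [inv, Matrix.adjugate_fin_two] using (h 1 0).neg
  · simpa [inv, Matrix.adjugate_fin_two] using h 0 0

theorem growth_isBigO_sol_apply (q : Potential) :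
    growth (Real.pi / 2) =O[squares] fun lam => q.sol lam (Real.pi / 2) 0 0 := by
  refine growth_isBigO_of_sub_isLittleO growth_isBigO_cos ?_
  refine (q.sol_apply_sub_rot_isLittleO Real.pi_div_two_pos.le 0 0).congr_left fun lam => ?_
  rw [rot_eq, mul_comm lam]
  rfl

/-- A monodromy matrix determines the fundamental matrix on the whole interval. -/
theorem sol_eq_of_monodromy_eq (q p : Potential)
    (h : ∀ᶠ lam in squares, q.sol lam (Real.pi / 2) = p.sol lam (Real.pi / 2)) {x : ℝ}
    (hx : x ∈ Icc 0 (Real.pi / 2)) (lam : ℂ) : q.sol lam x = p.sol lam x := by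
  have hx' : 0 ≤ Real.pi / 2 - x := sub_nonneg.2 hx.2
  have hsum : x + (Real.pi / 2 - x) = Real.pi / 2 := by ring
  have hY := q.sol_apply_sub_sol_apply_isLittleO p hx.1
  have hZ := (q.shift x).inv_apply_sub_inv_apply_isLittleO (p.shift x) hx'
  have hZ2 := (p.shift x).sol_apply_isBigO hx'
  have hY2 := p.sol_apply_isBigO hx.1
  have hfac : ∀ r : Potential, ∀ mu, (r.shift x).sol mu (Real.pi / 2 - x) * r.sol mu x
      = r.sol mu (Real.pi / 2) := fun r mu => by rw [← sol_add, hsum]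
  have hev : ∀ᶠ mu in squares, ∀ i,
      (q.sol mu x * p.inv mu x - 1) i 0 * p.sol mu (Real.pi / 2) 0 0 =
        (q.sol mu x i 0 - p.sol mu x i 0) * (p.shift x).sol mu (Real.pi / 2 - x) 0 0
        - ((q.shift x).inv mu (Real.pi / 2 - x) i 1 - (p.shift x).inv mu (Real.pi / 2 - x) i 1)
          * p.sol mu x 1 0 ∧
      (q.sol mu x * p.inv mu x - 1) i 1 * p.sol mu (Real.pi / 2) 0 0 =
        (q.sol mu x i 0 - p.sol mu x i 0) * (p.shift x).sol mu (Real.pi / 2 - x) 0 1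
        + ((q.shift x).inv mu (Real.pi / 2 - x) i 1 - (p.shift x).inv mu (Real.pi / 2 - x) i 1)
          * p.sol mu x 0 0 := by
    filter_upwards [h] with mu hmu i
    rw [← hfac p]
    exact mul_apply_eq_of_factorizations (by rw [hfac, hfac, hmu]) (q.sol_mul_inv mu x)
      (p.inv_mul_sol mu x) i
  -- Each product joins a negligible difference on one side of `x` to a solution of full growth on
  -- the other; the lengths `x` and `π / 2 - x` add up to exactly the growth of the transfer matrix
  -- entry.
  have hF : ∀ i j, (fun mu => (q.sol mu x * p.inv mu x - 1) i j * p.sol mu (Real.pi / 2) 0 0)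
      =o[squares] growth (Real.pi / 2) := by
    intro i j
    fin_cases j
    · have h1 := (IsLittleO.mul_growth (hY i 0) (hZ2 0 0) hsum).sub
        (IsLittleO.mul_growth (hZ i 1) (hY2 1 0) (sub_add_cancel _ _))
      refine h1.congr' ?_ EventuallyEq.rfl
      filter_upwards [hev] with mu hmu using (hmu i).1.symm
    · have h1 := (IsLittleO.mul_growth (hY i 0) (hZ2 0 1) hsum).add
        (IsLittleO.mul_growth (hZ i 1) (hY2 0 0) (sub_add_cancel _ _))
      refine h1.congr' ?_ EventuallyEq.rfl
      filter_upwards [hev] with mu hmu using (hmu i).2.symm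
  have hzero : ∀ i j, (q.sol lam x * p.inv lam x - 1) i j = 0 := by
    intro i j
    refine eq_zero_of_tendsto_squares (F := fun mu => (q.sol mu x * p.inv mu x - 1) i j) ?_
      (tendsto_zero_of_mul_isLittleO p.growth_isBigO_sol_apply (hF i j)) lam
    have e : (fun mu => (q.sol mu x * p.inv mu x - 1) i j)
        = fun mu => q.sol mu x i 0 * p.inv mu x 0 j + q.sol mu x i 1 * p.inv mu x 1 j
          - (1 : Matrix (Fin 2) (Fin 2) ℂ) i j := by
      funext mu
      rw [Matrix.sub_apply, Matrix.mul_apply, Fin.sum_univ_two]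
    rw [e]
    exact (((q.differentiable_sol_apply hx.1 i 0).mul (p.differentiable_inv_apply hx.1 0 j)).add
      ((q.differentiable_sol_apply hx.1 i 1).mul (p.differentiable_inv_apply hx.1 1 j))).sub_const _
  have h1 : q.sol lam x * p.inv lam x = 1 := sub_eq_zero.1 (Matrix.ext hzero)
  calc q.sol lam x = q.sol lam x * (p.inv lam x * p.sol lam x) := by rw [inv_mul_sol, mul_one]
    _ = _ := by rw [← mul_assoc, h1, one_mul]

/-- Potentials with the same fundamental matrix on an interval agree there. -/
theorem ae_eq_of_sol_eq (q p : Potential) {lam : ℂ} {c : ℝ}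
    (h : ∀ x ∈ Icc 0 c, q.sol lam x = p.sol lam x) :
    ∀ᵐ t, t ∈ Ioo 0 c → q.v t = p.v t ∧ q.w t = p.w t := by
  filter_upwards [(q.sol_hasAEDeriv lam).hasDerivAt, (p.sol_hasAEDeriv lam).hasDerivAt] with t h1 h2
    ht
  have hev : q.sol lam =ᶠ[nhds t] p.sol lam := by
    filter_upwards [Ioo_mem_nhds ht.1 ht.2] with s hs using h s ⟨hs.1.le, hs.2.le⟩
  have h3 := h1.unique (h2.congr_of_eventuallyEq hev)
  rw [h t ⟨ht.1.le, ht.2.le⟩] at h3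
  have h4 : q.coeff lam t = p.coeff lam t := by
    calc q.coeff lam t = q.coeff lam t * p.sol lam t * p.inv lam t := by
          rw [mul_assoc, sol_mul_inv, mul_one]
      _ = _ := by rw [h3, mul_assoc, sol_mul_inv, mul_one]
  rw [coeff_eq, coeff_eq] at h4
  have e0 := congrFun (congrFun h4 0) 0
  have e1 := congrFun (congrFun h4 0) 1
  simp only [Matrix.of_apply, Matrix.cons_val', Matrix.cons_val_zero, Matrix.cons_val_one,
    Matrix.cons_val_fin_one, sub_left_inj, neg_inj] at e0 e1
  exact ⟨by exact_mod_cast e0, by exact_mod_cast e1⟩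

theorem sol_pi (q : Potential) (lam : ℂ) :
    q.sol lam Real.pi = (q.shift (Real.pi / 2)).sol lam (Real.pi / 2) * q.sol lam (Real.pi / 2) := by
  rw [← sol_add, add_halves]

theorem differentiable_trace (q : Potential) {x : ℝ} (hx : 0 ≤ x) :
    Differentiable ℂ (fun mu => (q.sol mu x).trace) := by
  simp only [Matrix.trace_fin_two]
  exact (q.differentiable_sol_apply hx 0 0).add (q.differentiable_sol_apply hx 1 1)

/-- For the free system the function is `2 cos (π lam) + 2 = 4 cos² (π lam / 2)`, and the lower
bound for the cosine on the squares can be squared. -/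
theorem growth_isBigO_trace_add_two (q : Potential) :
    growth Real.pi =O[squares] fun lam => (q.sol lam Real.pi).trace + 2 := by
  have hc := growth_isBigO_cos.mul growth_isBigO_cos
  simp only [growth_mul, add_halves] at hc
  have hc4 : growth Real.pi =O[squares] fun lam =>
      4 * (Complex.cos (((Real.pi / 2 : ℝ) : ℂ) * lam) * Complex.cos (((Real.pi / 2 : ℝ) : ℂ) * lam)) :=
    hc.trans ((isBigO_refl _ _).const_mul_right (by norm_num))
  refine growth_isBigO_of_sub_isLittleO hc4 ?_
  refine ((q.sol_apply_sub_rot_isLittleO Real.pi_pos.le 0 0).add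
    (q.sol_apply_sub_rot_isLittleO Real.pi_pos.le 1 1)).congr_left fun lam => ?_
  have e : Complex.cos (lam * (Real.pi : ℂ))
      = 2 * Complex.cos (((Real.pi / 2 : ℝ) : ℂ) * lam) ^ 2 - 1 := by
    rw [← Complex.cos_two_mul]
    congr 1
    push_cast
    ring
  rw [rot_eq, Matrix.trace_fin_two]
  simp only [Matrix.of_apply, Matrix.cons_val', Matrix.cons_val_zero, Matrix.cons_val_one,
    Matrix.cons_val_fin_one, e]
  ring

/-- At a double zero of `tr Y(π) + 2` the monodromy matrix is `-1`. -/
theorem sol_pi_eq_neg_one (q : Potential) {lam : ℂ} (h0 : (q.sol lam Real.pi).trace + 2 = 0)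
    (hord : analyticOrderAt (fun mu => (q.sol mu Real.pi).trace + 2) lam = 2) :
    q.sol lam Real.pi = -1 := by
  have htr : (q.sol lam Real.pi).trace = -2 := eq_neg_of_add_eq_zero_left h0
  have him : lam.im = 0 := by
    refine q.im_eq_zero_of_multiplier (om := -1) Real.pi_pos (by simp) ?_
    have h1 := q.det_sol lam Real.pi
    rw [Matrix.det_fin_two] at h1
    rw [Matrix.trace_fin_two] at htr
    rw [Matrix.det_fin_two]
    simp
    linear_combination h1 + htr
  have hdiff := (q.differentiable_trace Real.pi_pos.le).add_const (2 : ℂ)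
  have hder : deriv (fun mu => (q.sol mu Real.pi).trace + 2) lam = 0 := by
    by_contra hne
    have h1 := AnalyticAt.analyticOrderAt_eq_one_of_zero_deriv_ne_zero (hdiff.analyticAt lam) h0 hne
    rw [hord] at h1
    exact absurd h1 (by decide)
  have hd : HasDerivAt (fun mu => (q.sol mu Real.pi).trace) 0 lam := by
    have h1 := (hdiff lam).hasDerivAt
    rw [hder] at h1
    simpa using h1.sub_const 2
  obtain ⟨h01, h10, hdd⟩ := q.sol_scalar_of_critical him Real.pi_pos (τ := -2) (by norm_num)
    (by rw [htr]; norm_num) hd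
  rw [Matrix.trace_fin_two, hdd] at htr
  have h11 : q.sol lam Real.pi 1 1 = -1 := by linear_combination htr / 2
  ext i j
  fin_cases i <;> fin_cases j
  · simpa [hdd] using h11
  · simpa using h01
  · simpa using h10
  · simpa using h11

/-- If `tr Y(π) + 2` has only double zeros, then the potential has period `π / 2` on
`(0, π / 2)`. -/
theorem ae_eq_shift_of_double_zeros (q : Potential)
    (hord : ∀ lam, (q.sol lam Real.pi).trace + 2 = 0 →
      analyticOrderAt (fun mu => (q.sol mu Real.pi).trace + 2) lam = 2) :
    ∀ᵐ t, t ∈ Ioo 0 (Real.pi / 2) →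
      q.v t = q.v (Real.pi / 2 + t) ∧ q.w t = q.w (Real.pi / 2 + t) := by
  set p := q.shift (Real.pi / 2) with hp
  have hl : 0 ≤ Real.pi / 2 := Real.pi_div_two_pos.le
  set G : ℂ → ℂ := fun lam => (q.sol lam Real.pi).trace + 2 with hG
  have hGd : Differentiable ℂ G := (q.differentiable_trace Real.pi_pos.le).add_const (2 : ℂ)
  have hinv : ∀ lam, G lam = 0 → q.sol lam (Real.pi / 2) = -p.inv lam (Real.pi / 2) := by
    intro lam h0
    have h1 := q.sol_pi_eq_neg_one h0 (hord lam h0)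
    rw [sol_pi] at h1
    calc q.sol lam (Real.pi / 2)
        = p.inv lam (Real.pi / 2) * (p.sol lam (Real.pi / 2) * q.sol lam (Real.pi / 2)) := by
          rw [← mul_assoc, inv_mul_sol, one_mul]
      _ = _ := by rw [h1, mul_neg, mul_one]
  -- `N ^ 2 / G` is entire because the zeros of `G` are exactly double, and it tends to zero along
  -- the squares because `G` has the full growth that `N ^ 2` falls short of.
  have hzero : ∀ N : ℂ → ℂ, Differentiable ℂ N → (∀ lam, G lam = 0 → N lam = 0) →
      N =o[squares] growth (Real.pi / 2) → ∀ lam, N lam = 0 := by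
    intro N hN hNG hNo lam
    obtain ⟨H, hH, hHG⟩ := exists_sq_eq_mul hN hGd hord hNG
    have h1 : (fun z => H z * G z) =o[squares] growth Real.pi := by
      have h2 := IsLittleO.mul_growth hNo hNo.isBigO (add_halves Real.pi)
      exact h2.congr_left fun z => by rw [hHG, sq]
    have h2 := eq_zero_of_tendsto_squares hH
      (tendsto_zero_of_mul_isLittleO q.growth_isBigO_trace_add_two h1) lam
    have h3 := hHG lam
    rw [h2, zero_mul] at h3
    exact pow_eq_zero_iff two_ne_zero |>.1 h3.symm
  have hqd := q.differentiable_sol_apply hl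
  have hpd := p.differentiable_sol_apply hl
  have hqp := q.sol_apply_sub_sol_apply_isLittleO p hl
  have hent : ∀ lam, G lam = 0 → ∀ i j, q.sol lam (Real.pi / 2) i j
      = -(p.sol lam (Real.pi / 2)).adjugate i j := fun lam h0 i j => by
    rw [hinv lam h0]; rfl
  -- The adjugate negates off-diagonal entries and swaps the diagonal ones. Hence `A = -adj B`
  -- annihilates these off-diagonal differences and the difference of the two diagonal ones, but not
  -- the difference of the traces.
  have h01 : ∀ lam, q.sol lam (Real.pi / 2) 0 1 = p.sol lam (Real.pi / 2) 0 1 := fun lam =>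
    sub_eq_zero.1 (hzero (fun mu => q.sol mu (Real.pi / 2) 0 1 - p.sol mu (Real.pi / 2) 0 1)
      ((hqd 0 1).sub (hpd 0 1))
      (fun mu h0 => by simp [hent mu h0 0 1, Matrix.adjugate_fin_two]) (hqp 0 1) lam)
  have h10 : ∀ lam, q.sol lam (Real.pi / 2) 1 0 = p.sol lam (Real.pi / 2) 1 0 := fun lam =>
    sub_eq_zero.1 (hzero (fun mu => q.sol mu (Real.pi / 2) 1 0 - p.sol mu (Real.pi / 2) 1 0)
      ((hqd 1 0).sub (hpd 1 0))
      (fun mu h0 => by simp [hent mu h0 1 0, Matrix.adjugate_fin_two]) (hqp 1 0) lam)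
  have hdd : ∀ lam, q.sol lam (Real.pi / 2) 0 0 + p.sol lam (Real.pi / 2) 1 1
      = q.sol lam (Real.pi / 2) 1 1 + p.sol lam (Real.pi / 2) 0 0 := fun lam => by
    have h := hzero (fun mu => (q.sol mu (Real.pi / 2) 0 0 - p.sol mu (Real.pi / 2) 0 0)
      - (q.sol mu (Real.pi / 2) 1 1 - p.sol mu (Real.pi / 2) 1 1))
      (((hqd 0 0).sub (hpd 0 0)).sub ((hqd 1 1).sub (hpd 1 1)))
      (fun mu h0 => by
        simp [hent mu h0 0 0, hent mu h0 1 1, Matrix.adjugate_fin_two]; ring)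
      ((hqp 0 0).sub (hqp 1 1)) lam
    linear_combination h
  -- The alternative to equality is `G lam = 0`, which the lower bound for `G` excludes eventually
  -- along the squares.
  have heq : ∀ᶠ lam in squares, q.sol lam (Real.pi / 2) = p.sol lam (Real.pi / 2) := by
    obtain ⟨C, hC⟩ := q.growth_isBigO_trace_add_two.bound
    filter_upwards [hC] with lam hlam
    refine (eq_or_trace_mul_eq (q.det_sol _ _) (p.det_sol _ _) (h01 lam) (h10 lam)
      (hdd lam)).resolve_right fun h0 => ?_
    rw [hp, ← sol_pi] at h0
    rw [h0, norm_zero, mul_zero, Real.norm_of_nonneg (growth_pos _ _).le] at hlam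
    exact (growth_pos _ lam).not_ge hlam
  exact q.ae_eq_of_sol_eq p (lam := 0) fun x hx => q.sol_eq_of_monodromy_eq p heq hx 0

/-- If the potential has period `π / 2`, then `tr Y(π) + 2` has only double zeros. -/
theorem analyticOrderAt_trace_add_two_of_shift (q : Potential)
    (hv : q.v =ᵐ[volume] (q.shift (Real.pi / 2)).v)
    (hw : q.w =ᵐ[volume] (q.shift (Real.pi / 2)).w) {lam : ℂ}
    (h0 : (q.sol lam Real.pi).trace + 2 = 0) :
    analyticOrderAt (fun mu => (q.sol mu Real.pi).trace + 2) lam = 2 := by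
  have hl : 0 < Real.pi / 2 := Real.pi_div_two_pos
  -- Both half-period factors coincide, and `tr (A²) + 2 det A = (tr A)²` with `det A = 1`.
  have hsq : ∀ mu, (q.sol mu Real.pi).trace + 2 = (q.sol mu (Real.pi / 2)).trace ^ 2 := by
    intro mu
    rw [sol_pi, ← sol_congr hv hw mu]
    have h1 := q.det_sol mu (Real.pi / 2)
    rw [Matrix.det_fin_two] at h1
    rw [Matrix.trace_fin_two, Matrix.trace_fin_two, Matrix.mul_apply, Matrix.mul_apply,
      Fin.sum_univ_two, Fin.sum_univ_two]
    linear_combination -2 * h1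
  have htr : (q.sol lam (Real.pi / 2)).trace = 0 := by
    rw [hsq] at h0
    exact pow_eq_zero_iff two_ne_zero |>.1 h0
  have hdet := q.det_sol lam (Real.pi / 2)
  have him : lam.im = 0 := by
    -- Trace 0 and determinant 1 give the eigenvalues `±i`.
    refine q.im_eq_zero_of_multiplier (om := Complex.I) hl (by simp) ?_
    have h1 := hdet
    have h2 := htr
    rw [Matrix.det_fin_two] at h1
    rw [Matrix.trace_fin_two] at h2
    rw [Matrix.det_fin_two]
    simp
    linear_combination h1 - Complex.I * h2 + Complex.I_sq
  have hdiff := q.differentiable_trace hl.le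
  -- A critical zero would make the matrix scalar with trace 0, hence zero, against determinant 1.
  have hder : deriv (fun mu => (q.sol mu (Real.pi / 2)).trace) lam ≠ 0 := by
    intro hder
    have hd := (hdiff lam).hasDerivAt
    rw [hder] at hd
    obtain ⟨h01, h10, hdd⟩ := q.sol_scalar_of_critical him hl (τ := 0) (by norm_num)
      (by rw [htr]; norm_num) hd
    rw [Matrix.trace_fin_two, hdd] at htr
    rw [Matrix.det_fin_two, h01, hdd] at hdet
    have h11 : q.sol lam (Real.pi / 2) 1 1 = 0 := by linear_combination htr / 2
    rw [h11] at hdet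
    simp at hdet
  have h1 := AnalyticAt.analyticOrderAt_eq_one_of_zero_deriv_ne_zero (hdiff.analyticAt lam) htr hder
  have e : (fun mu => (q.sol mu Real.pi).trace + 2)
      = (fun mu => (q.sol mu (Real.pi / 2)).trace) ^ 2 := funext hsq
  rw [e, analyticOrderAt_pow (hdiff.analyticAt lam), h1]
  rfl

end Potential
end DiracSystem

/-! ### Exponentials in the commutant of `J` and conjugation by rotations. -/

namespace DiracSystem
open MeasureTheory Set Filter

/-- The exponential of `a J - i g`. -/
theorem exp_smul_J_sub (a g : ℂ) :
    NormedSpace.exp (a • J - (Complex.I * g) • (1 : Matrix (Fin 2) (Fin 2) ℂ))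
      = Complex.exp (-(Complex.I * g)) • (Complex.cos a • 1 + Complex.sin a • J) := by
  -- The columns are eigenvectors of `J` for the eigenvalues `i` and `-i`.
  set U : Matrix (Fin 2) (Fin 2) ℂ := !![1, 1; Complex.I, -Complex.I] with hU
  have hdet : IsUnit U.det := by
    rw [hU, Matrix.det_fin_two_of]
    have : (1 : ℂ) * -Complex.I - 1 * Complex.I = -2 * Complex.I := by ring
    rw [this]
    exact (mul_ne_zero (by norm_num) Complex.I_ne_zero).isUnit
  have hUu : IsUnit U := (Matrix.isUnit_iff_isUnit_det U).2 hdet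
  have hconj : ∀ X Y : Matrix (Fin 2) (Fin 2) ℂ, X * U = U * Y → X = U * Y * U⁻¹ := by
    intro X Y h
    rw [← h, mul_assoc, Matrix.mul_nonsing_inv U hdet, mul_one]
  have hX : a • J - (Complex.I * g) • (1 : Matrix (Fin 2) (Fin 2) ℂ) = U * Matrix.diagonal
      ![Complex.I * a - Complex.I * g, -(Complex.I * a) - Complex.I * g] * U⁻¹ := by
    refine hconj _ _ ?_
    ext i j
    fin_cases i <;> fin_cases j <;>
      simp [hU, J, Matrix.mul_apply, Fin.sum_univ_two, Matrix.diagonal] <;>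
      ring_nf <;> simp
  have hR : Complex.exp (-(Complex.I * g)) • (Complex.cos a • 1 + Complex.sin a • J)
      = U * Matrix.diagonal ![Complex.exp (Complex.I * a - Complex.I * g),
        Complex.exp (-(Complex.I * a) - Complex.I * g)] * U⁻¹ := by
    refine hconj _ _ ?_
    have e1 : Complex.exp (Complex.I * a - Complex.I * g)
        = Complex.exp (-(Complex.I * g)) * (Complex.cos a + Complex.sin a * Complex.I) := by
      rw [← Complex.exp_mul_I, ← Complex.exp_add]
      congr 1
      ring
    have e2 : Complex.exp (-(Complex.I * a) - Complex.I * g)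
        = Complex.exp (-(Complex.I * g)) * (Complex.cos a - Complex.sin a * Complex.I) := by
      have := Complex.exp_mul_I (-a)
      rw [Complex.cos_neg, Complex.sin_neg, neg_mul (Complex.sin a), ← sub_eq_add_neg] at this
      rw [← this, ← Complex.exp_add]
      congr 1
      ring
    rw [e1, e2]
    have hI : Complex.I * Complex.I = -1 := Complex.I_mul_I
    ext i j
    fin_cases i <;> fin_cases j <;>
      simp [hU, J, Matrix.mul_apply, Fin.sum_univ_two, Matrix.diagonal]
    · ring
    · ring
    · linear_combination -(Complex.exp (-(Complex.I * g)) * Complex.sin a) * hI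
    · linear_combination -(Complex.exp (-(Complex.I * g)) * Complex.sin a) * hI
  rw [hX, hR, Matrix.exp_conj _ _ hUu, Matrix.exp_diagonal]
  congr 3
  funext i
  rw [Pi.coe_exp, ← Complex.exp_eq_exp_ℂ]
  fin_cases i <;> rfl

/-- Conjugation of `r σ₁ + s σ₃` by the rotation `e (cos a + sin a J)`. -/
theorem rotation_conj {R : Matrix (Fin 2) (Fin 2) ℂ} {e : ℂ} (he : e ≠ 0) (a r s : ℝ)
    (hR : R = e • (Complex.cos a • 1 + Complex.sin a • J)) :
    R⁻¹ * ((r : ℂ) • sigma1 + (s : ℂ) • sigma3) * R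
      = ((r * Real.cos (2 * a) + s * Real.sin (2 * a) : ℝ) : ℂ) • sigma1
        + ((s * Real.cos (2 * a) - r * Real.sin (2 * a) : ℝ) : ℂ) • sigma3 := by
  have hcs : Complex.cos a * Complex.cos a + Complex.sin a * Complex.sin a = 1 := by
    rw [← sq, ← sq, Complex.cos_sq_add_sin_sq]
  have hinv : R⁻¹ = e⁻¹ • (Complex.cos a • 1 - Complex.sin a • J) := by
    refine Matrix.inv_eq_left_inv ?_
    rw [hR, smul_mul_smul_comm, inv_mul_cancel₀ he, one_smul]
    ext i j
    fin_cases i <;> fin_cases j <;> simp [J, Matrix.mul_apply, Fin.sum_univ_two]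
    · linear_combination hcs
    · ring
    · ring
    · linear_combination hcs
  rw [hinv, hR, smul_mul_assoc, smul_mul_smul_comm, inv_mul_cancel₀ he, one_smul, Real.cos_two_mul,
    Real.sin_two_mul]
  push_cast
  ext i j
  fin_cases i <;> fin_cases j <;>
    simp [J, sigma1, sigma3, Matrix.mul_apply, Fin.sum_univ_two]
  · linear_combination -(s : ℂ) * hcs
  · linear_combination -(r : ℂ) * hcs
  · linear_combination -(r : ℂ) * hcs
  · linear_combination (s : ℂ) * hcs

end DiracSystem

/-! ### Reduction of the Hermitian system to a traceless real one. -/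

namespace DiracSystem
open MeasureTheory Set Filter

open scoped Matrix.Norms.Operator

attribute [local instance] normTopology

/-- The pointwise identity behind the gauge transformation. -/
theorem gauge_identity {p pb r s m ca sa c2 s2 : ℂ} (lam : ℂ) (h1 : c2 * ca + s2 * sa = ca)
    (h2 : s2 * ca - c2 * sa = sa) :
    (Complex.I * m) • (ca • (1 : Matrix (Fin 2) (Fin 2) ℂ) - sa • J)
      + (p - pb) • (-sa • (1 : Matrix (Fin 2) (Fin 2) ℂ) - ca • J)
      + (ca • (1 : Matrix (Fin 2) (Fin 2) ℂ) - sa • J)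
        * (J * (!![p + s, r + Complex.I * m; r - Complex.I * m, p - s]
          - lam • (1 : Matrix (Fin 2) (Fin 2) ℂ)))
      = !![r * c2 + s * s2, -(s * c2 - r * s2) - (lam - pb);
          -(s * c2 - r * s2) + (lam - pb), -(r * c2 + s * s2)]
        * (ca • (1 : Matrix (Fin 2) (Fin 2) ℂ) - sa • J) := by
  have e : J * (!![p + s, r + Complex.I * m; r - Complex.I * m, p - s]
      - lam • (1 : Matrix (Fin 2) (Fin 2) ℂ))
      = !![r - Complex.I * m, p - s - lam; lam - p - s, -r - Complex.I * m] := by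
    ext i j
    fin_cases i <;> fin_cases j <;>
      simp [J, Matrix.mul_apply, Fin.sum_univ_two] <;> ring
  rw [e]
  ext i j
  fin_cases i <;> fin_cases j <;> simp [J, Matrix.mul_apply, Fin.sum_univ_two]
  · linear_combination (-r) * h1 + (-s) * h2
  · linear_combination s * h1 - r * h2
  · linear_combination s * h1 - r * h2
  · linear_combination r * h1 + s * h2

section Entries

variable {Q : ℝ → Matrix (Fin 2) (Fin 2) ℂ}

theorem intervalIntegrable_entry (hper : Function.Periodic Q Real.pi)
    (hint : ∀ i j, IntegrableOn (fun z => Q z i j) (Ico 0 Real.pi)) (i j : Fin 2) (x y : ℝ) :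
    IntervalIntegrable (fun z => Q z i j) volume x y := by
  have hp : Function.Periodic (fun z => Q z i j) Real.pi := fun z => by simp only [hper z]
  refine hp.intervalIntegrable₀ Real.pi_ne_zero ?_ x y
  rw [intervalIntegrable_iff_integrableOn_Ico_of_le Real.pi_pos.le]
  exact hint i j

theorem HasAEDeriv.of_entries {F f : ℝ → Matrix (Fin 2) (Fin 2) ℂ}
    (h : ∀ i j, HasAEDeriv (fun x => F x i j) (fun x => f x i j)) : HasAEDeriv F f := by
  let L : Fin 2 → Fin 2 → ℂ →L[ℝ] Matrix (Fin 2) (Fin 2) ℂ := fun i j =>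
    (ContinuousLinearMap.id ℝ ℂ).smulRight (Matrix.single i j (1 : ℂ))
  have e : ∀ M : Matrix (Fin 2) (Fin 2) ℂ, L 0 0 (M 0 0) + L 0 1 (M 0 1)
      + (L 1 0 (M 1 0) + L 1 1 (M 1 1)) = M := by
    intro M
    ext i j
    fin_cases i <;> fin_cases j <;> simp [L]
  have h1 := (((h 0 0).clm (L 0 0)).add ((h 0 1).clm (L 0 1))).add
    (((h 1 0).clm (L 1 0)).add ((h 1 1).clm (L 1 1)))
  simp only [e] at h1
  exact h1

/-- Multiplication by `J` and `J * J = -1` solve the equation for `Y'`. -/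
theorem IsFundamentalMatrix.hasAEDeriv (hQ : ∀ i j x y, IntervalIntegrable (fun z => Q z i j) volume x y)
    {lam : ℂ} {Y : ℝ → Matrix (Fin 2) (Fin 2) ℂ} (hY : IsFundamentalMatrix Q lam Y) :
    HasAEDeriv Y (fun t => J * (Q t - lam • 1) * Y t) := by
  refine HasAEDeriv.of_entries fun i j => ⟨fun x y => ?_, hY.absolutelyContinuous i j, ?_⟩
  · have hc : ∀ k, Continuous fun z => Y z k j := fun k =>
      continuous_of_absolutelyContinuous (hY.absolutelyContinuous k j)
    have h1 : ∀ k l, IntervalIntegrable (fun t => (Q t - lam • 1) k l) volume x y := fun k l =>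
      (hQ k l x y).sub intervalIntegrable_const
    have h2 : ∀ l, IntervalIntegrable (fun t => (J * (Q t - lam • 1)) i l) volume x y := by
      intro l
      simp only [Matrix.mul_apply, Fin.sum_univ_two]
      exact ((h1 0 l).const_mul _).add ((h1 1 l).const_mul _)
    simp only [Matrix.mul_apply (M := J * _), Fin.sum_univ_two]
    exact ((h2 0).mul_continuousOn (hc 0).continuousOn).add
      ((h2 1).mul_continuousOn (hc 1).continuousOn)
  · filter_upwards [hY.equation] with z ⟨Y', h, he⟩
    have h3 : J * (J * Y') = J * (lam • Y z - Q z * Y z) := by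
      rw [← he, add_sub_cancel_right]
    rw [← mul_assoc, J_mul_J, neg_mul, one_mul] at h3
    rw [mul_assoc, sub_mul, smul_mul_assoc, one_mul, ← neg_sub, mul_neg, ← h3, neg_neg]
    exact h i j

/-- Half the trace of `Q`. -/
noncomputable def halfTrace (Q : ℝ → Matrix (Fin 2) (Fin 2) ℂ) (t : ℝ) : ℝ :=
  ((Q t 0 0).re + (Q t 1 1).re) / 2

/-- Half the difference of the diagonal entries of `Q`. -/
noncomputable def halfDiff (Q : ℝ → Matrix (Fin 2) (Fin 2) ℂ) (t : ℝ) : ℝ :=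
  ((Q t 0 0).re - (Q t 1 1).re) / 2

/-- The mean value of a function on `[0, π]`. -/
noncomputable def mean (f : ℝ → ℝ) : ℝ := (1 / Real.pi) * ∫ t in (0 : ℝ)..Real.pi, f t

/-- The angle of the gauge transformation. -/
noncomputable def angle (Q : ℝ → Matrix (Fin 2) (Fin 2) ℂ) (x : ℝ) : ℝ :=
  ∫ t in (0 : ℝ)..x, (halfTrace Q t - mean (halfTrace Q))

theorem intervalIntegrable_re (hQ : ∀ i j x y, IntervalIntegrable (fun z => Q z i j) volume x y)
    (i j : Fin 2) (x y : ℝ) : IntervalIntegrable (fun z => (Q z i j).re) volume x y :=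
  ⟨Complex.reCLM.integrable_comp (hQ i j x y).1, Complex.reCLM.integrable_comp (hQ i j x y).2⟩

theorem intervalIntegrable_im (hQ : ∀ i j x y, IntervalIntegrable (fun z => Q z i j) volume x y)
    (i j : Fin 2) (x y : ℝ) : IntervalIntegrable (fun z => (Q z i j).im) volume x y :=
  ⟨Complex.imCLM.integrable_comp (hQ i j x y).1, Complex.imCLM.integrable_comp (hQ i j x y).2⟩

theorem intervalIntegrable_halfTrace
    (hQ : ∀ i j x y, IntervalIntegrable (fun z => Q z i j) volume x y) (x y : ℝ) :
    IntervalIntegrable (halfTrace Q) volume x y :=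
  ((intervalIntegrable_re hQ 0 0 x y).add (intervalIntegrable_re hQ 1 1 x y)).div_const 2

theorem intervalIntegrable_halfDiff
    (hQ : ∀ i j x y, IntervalIntegrable (fun z => Q z i j) volume x y) (x y : ℝ) :
    IntervalIntegrable (halfDiff Q) volume x y :=
  ((intervalIntegrable_re hQ 0 0 x y).sub (intervalIntegrable_re hQ 1 1 x y)).div_const 2

theorem angle_hasAEDeriv (hQ : ∀ i j x y, IntervalIntegrable (fun z => Q z i j) volume x y) :
    HasAEDeriv (angle Q) (fun t => halfTrace Q t - mean (halfTrace Q)) :=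
  HasAEDeriv.integral fun x y => (intervalIntegrable_halfTrace hQ x y).sub intervalIntegrable_const

@[simp] theorem angle_zero : angle Q 0 = 0 := intervalIntegral.integral_same

theorem integral_sub_mean {f : ℝ → ℝ} (hf : IntervalIntegrable f volume 0 Real.pi) :
    ∫ t in (0 : ℝ)..Real.pi, (f t - mean f) = 0 := by
  rw [intervalIntegral.integral_sub hf intervalIntegrable_const, intervalIntegral.integral_const,
    mean, smul_eq_mul, sub_zero, ← mul_assoc, mul_one_div_cancel Real.pi_ne_zero, one_mul, sub_self]

/-- The traceless real symmetric potential obtained from `Q` by the gauge transformation. -/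
noncomputable def gaugedPotential (Q : ℝ → Matrix (Fin 2) (Fin 2) ℂ)
    (hQ : ∀ i j x y, IntervalIntegrable (fun z => Q z i j) volume x y) : Potential where
  v t := (Q t 0 1).re * Real.cos (2 * angle Q t) + halfDiff Q t * Real.sin (2 * angle Q t)
  w t := halfDiff Q t * Real.cos (2 * angle Q t) - (Q t 0 1).re * Real.sin (2 * angle Q t)
  hv x y := by
    have := (angle_hasAEDeriv hQ).continuous
    exact ((intervalIntegrable_re hQ 0 1 x y).mul_continuousOn (by fun_prop)).add
      ((intervalIntegrable_halfDiff hQ x y).mul_continuousOn (by fun_prop))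
  hw x y := by
    have := (angle_hasAEDeriv hQ).continuous
    exact ((intervalIntegrable_halfDiff hQ x y).mul_continuousOn (by fun_prop)).sub
      ((intervalIntegrable_re hQ 0 1 x y).mul_continuousOn (by fun_prop))

theorem entries_of_isHermitian (hherm : ∀ z, (Q z).IsHermitian) (z : ℝ) :
    Q z = !![(halfTrace Q z : ℂ) + halfDiff Q z, (Q z 0 1).re + Complex.I * (Q z 0 1).im;
      (Q z 0 1).re - Complex.I * (Q z 0 1).im, (halfTrace Q z : ℂ) - halfDiff Q z] := by
  have h00 := (hherm z).coe_re_apply_self 0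
  have h11 := (hherm z).coe_re_apply_self 1
  have h10 := (hherm z).apply 1 0
  simp only [RCLike.re_to_complex, Complex.coe_algebraMap] at h00 h11
  ext i j
  fin_cases i <;> fin_cases j
  · simp only [halfTrace, halfDiff]
    push_cast
    simp
    linear_combination -h00
  · simp [mul_comm Complex.I]
  · refine h10.symm.trans ?_
    apply Complex.ext <;> simp
  · simp only [halfTrace, halfDiff]
    push_cast
    simp
    linear_combination -h11

/-- The gauge transformation reduces the system to one with a traceless real potential. -/
theorem gauge_mul_isFundamentalMatrix (hherm : ∀ z, (Q z).IsHermitian)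
    (hQ : ∀ i j x y, IntervalIntegrable (fun z => Q z i j) volume x y)
    {lam : ℂ} {Y : ℝ → Matrix (Fin 2) (Fin 2) ℂ} (hY : IsFundamentalMatrix Q lam Y) (x : ℝ) :
    Complex.exp (Complex.I * (∫ t in (0 : ℝ)..x, (Q t 0 1).im : ℝ)) •
      ((Complex.cos (angle Q x) • 1 - Complex.sin (angle Q x) • J) * Y x)
      = (gaugedPotential Q hQ).sol (lam - mean (halfTrace Q)) x := by
  set β : ℝ → ℝ := fun x => ∫ t in (0 : ℝ)..x, (Q t 0 1).im with hβ
  have hβd : HasAEDeriv β (fun t => (Q t 0 1).im) :=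
    HasAEDeriv.integral (intervalIntegrable_im hQ 0 1)
  have hαd := angle_hasAEDeriv hQ
  let L : Matrix (Fin 2) (Fin 2) ℂ → ℝ →L[ℝ] Matrix (Fin 2) (Fin 2) ℂ := fun M =>
    (ContinuousLinearMap.id ℝ ℝ).smulRight M
  -- The phase `exp (i β)` and the rotation are built as real-linear images of real sines and
  -- cosines, for which the almost everywhere chain rule is at hand.
  have hC1 := (hβd.real_cos.clm (L 1)).add (hβd.real_sin.clm (L (Complex.I • 1)))
  have hC2 := (hαd.real_cos.clm (L 1)).sub (hαd.real_sin.clm (L J))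
  have hΨ := hC1.mul (hC2.mul (hY.hasAEDeriv hQ))
  have e1 : ∀ t, L 1 (Real.cos (β t)) + L (Complex.I • 1) (Real.sin (β t))
      = Complex.exp (Complex.I * β t) • (1 : Matrix (Fin 2) (Fin 2) ℂ) := by
    intro t
    rw [mul_comm, Complex.exp_mul_I]
    ext i j
    fin_cases i <;> fin_cases j <;> simp [L, mul_comm]
  have e1' : ∀ t, L 1 (-Real.sin (β t) * (Q t 0 1).im)
        + L (Complex.I • 1) (Real.cos (β t) * (Q t 0 1).im)
      = (Complex.exp (Complex.I * β t) * (Complex.I * (Q t 0 1).im))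
        • (1 : Matrix (Fin 2) (Fin 2) ℂ) := by
    intro t
    rw [mul_comm Complex.I (β t : ℂ), Complex.exp_mul_I]
    ext i j
    fin_cases i <;> fin_cases j <;> simp [L] <;>
      linear_combination (-Complex.sin (β t) * (Q t 0 1).im) * Complex.I_mul_I
  have e2 : ∀ t, L 1 (Real.cos (angle Q t)) - L J (Real.sin (angle Q t))
      = Complex.cos (angle Q t) • (1 : Matrix (Fin 2) (Fin 2) ℂ) - Complex.sin (angle Q t) • J := by
    intro t
    ext i j
    fin_cases i <;> fin_cases j <;> simp [L, J]
  have e2' : ∀ t, L 1 (-Real.sin (angle Q t) * (halfTrace Q t - mean (halfTrace Q)))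
        - L J (Real.cos (angle Q t) * (halfTrace Q t - mean (halfTrace Q)))
      = ((halfTrace Q t : ℂ) - mean (halfTrace Q)) • (-Complex.sin (angle Q t) •
        (1 : Matrix (Fin 2) (Fin 2) ℂ) - Complex.cos (angle Q t) • J) := by
    intro t
    ext i j
    fin_cases i <;> fin_cases j <;> simp [L, J, mul_comm]
  simp only [e1, e1', e2, e2'] at hΨ
  have key := (gaugedPotential Q hQ).eq_sol_mul (lam - mean (halfTrace Q))
    (hΨ.congr' fun t => ?_) x
  · simpa [hβ, hY.initial] using key
  · have hc : (Real.cos (2 * angle Q t) : ℂ) * Complex.cos (angle Q t)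
        + Real.sin (2 * angle Q t) * Complex.sin (angle Q t) = Complex.cos (angle Q t) := by
      rw [← Complex.ofReal_cos, ← Complex.ofReal_sin]
      norm_cast
      rw [← Real.cos_sub]
      congr 1
      ring
    have hs : (Real.sin (2 * angle Q t) : ℂ) * Complex.cos (angle Q t)
        - Real.cos (2 * angle Q t) * Complex.sin (angle Q t) = Complex.sin (angle Q t) := by
      rw [← Complex.ofReal_cos, ← Complex.ofReal_sin]
      norm_cast
      rw [← Real.sin_sub]
      congr 1
      ring
    have hid := gauge_identity (p := halfTrace Q t) (pb := mean (halfTrace Q)) (r := (Q t 0 1).re)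
      (s := halfDiff Q t) (m := (Q t 0 1).im) lam hc hs
    rw [← entries_of_isHermitian hherm t] at hid
    have hco : (gaugedPotential Q hQ).coeff (lam - mean (halfTrace Q)) t = _ := 
      Potential.coeff_eq _ _ _
    simp only [gaugedPotential] at hco
    push_cast at hco hid
    rw [← hco] at hid
    have h2 := congrArg (fun M => Complex.exp (Complex.I * β t) • (M * Y t)) hid
    simp only [add_mul, smul_mul_assoc, one_mul, mul_assoc, mul_smul_comm, smul_add, mul_smul] at h2 ⊢
    rw [← add_assoc]
    exact h2

end Entries

end DiracSystem

/-! ### Transfer of periodicity and of zero orders through the gauge. -/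

namespace DiracSystem
open MeasureTheory Set Filter

/-- A function of period `2 h` which agrees with its translate by `h` on `(0, h)` has period `h`. -/
theorem ae_eq_translate_of_periodic {X : Type*} {f : ℝ → X} {h : ℝ} (hh : 0 < h)
    (hf : Function.Periodic f (2 * h)) (H : ∀ᵐ t, t ∈ Ioo 0 h → f t = f (h + t)) :
    ∀ᵐ t, f (t + h) = f t := by
  -- Because `f` has period `2 h`, translating by `h` only swaps the two sides of the equation. The
  -- property therefore needs checking only on one fundamental interval, outside a null set
  -- invariant under the translations.
  have hP : Function.Periodic (fun t => f (t + h) = f t) h := by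
    intro t
    have h1 : f (t + h + h) = f t := by rw [← hf t]; congr 1; ring
    simp only [h1, eq_iff_iff]
    exact eq_comm
  have H0 : ∀ᵐ t, t ∈ Ico 0 h → f (t + h) = f t := by
    filter_upwards [H, compl_mem_ae_iff.2 (Real.volume_singleton (a := 0))] with t ht h0 hI
    rw [ht ⟨lt_of_le_of_ne hI.1 (Ne.symm h0), hI.2⟩, add_comm]
  have H1 : ∀ᵐ t, ∀ n : ℤ, t - n * h ∈ Ico 0 h → f (t - n * h + h) = f (t - n * h) :=
    ae_all_iff.2 fun n =>
      (measurePreserving_sub_right volume ((n : ℝ) * h)).quasiMeasurePreserving.ae H0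
  filter_upwards [H1] with t ht
  have h2 := ht ⌊t / h⌋ ⟨by
      have := Int.floor_le (t / h)
      rw [le_div_iff₀ hh] at this
      linarith, by
      have := Int.lt_floor_add_one (t / h)
      rw [div_lt_iff₀ hh] at this
      linarith⟩
  have h3 := hP.sub_int_mul_eq (x := t) ⌊t / h⌋
  exact h3.mp h2

theorem analyticOrderAt_const_mul_comp_sub {g : ℂ → ℂ} (hg : Differentiable ℂ g) {c : ℂ}
    (hc : c ≠ 0) (a z : ℂ) :
    analyticOrderAt (fun x => c * g (x - a)) z = analyticOrderAt g (z - a) := by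
  have h1 : AnalyticAt ℂ (fun x : ℂ => x - a) z := by fun_prop
  have h2 : AnalyticAt ℂ (g ∘ fun x => x - a) z := (hg.analyticAt _).comp h1
  have h3 : analyticOrderAt (fun _ : ℂ => c) z = 0 := analyticAt_const.analyticOrderAt_eq_zero.2 hc
  have h4 := analyticOrderAt_mul (f := fun _ : ℂ => c) analyticAt_const h2
  rw [h3, zero_add] at h4
  rw [← analyticOrderAt_comp_of_deriv_ne_zero (f := g) (g := fun x => x - a) h1 (by simp), ← h4]
  rfl

theorem matrixIntegral_smul_one_add_smul_sigma2 (f g : ℝ → ℝ) (a b : ℝ) :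
    matrixIntegral (fun t => (f t : ℂ) • (1 : Matrix (Fin 2) (Fin 2) ℂ) + (g t : ℂ) • sigma2) a b
      = ((∫ t in a..b, f t : ℝ) : ℂ) • (1 : Matrix (Fin 2) (Fin 2) ℂ)
        + ((∫ t in a..b, g t : ℝ) : ℂ) • sigma2 := by
  ext i j
  fin_cases i <;> fin_cases j <;> simp [matrixIntegral, sigma2] <;>
      exact intervalIntegral.integral_ofReal

section Gauge

variable {Q : ℝ → Matrix (Fin 2) (Fin 2) ℂ}

theorem Q1_eq (hherm : ∀ z, (Q z).IsHermitian) (z : ℝ) :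
    Q1 Q z = ((Q z 0 1).re : ℂ) • sigma1 + (halfDiff Q z : ℂ) • sigma3 := by
  have h := entries_of_isHermitian hherm z
  have h0 : Q z 0 0 = halfTrace Q z + halfDiff Q z := congrFun (congrFun h 0) 0
  have h1 : Q z 1 1 = halfTrace Q z - halfDiff Q z := congrFun (congrFun h 1) 1
  rw [Q1, h0, h1]
  congr 2
  ring

theorem Q2_eq (hherm : ∀ z, (Q z).IsHermitian) (z : ℝ) :
    Q2 Q z = (halfTrace Q z : ℂ) • (1 : Matrix (Fin 2) (Fin 2) ℂ)
      + ((Q z 0 1).im : ℂ) • sigma2 := by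
  have h := entries_of_isHermitian hherm z
  have h0 : Q z 0 0 = halfTrace Q z + halfDiff Q z := congrFun (congrFun h 0) 0
  have h1 : Q z 1 1 = halfTrace Q z - halfDiff Q z := congrFun (congrFun h 1) 1
  rw [Q2, h0, h1]
  congr 2
  ring

theorem meanQ2_eq (hherm : ∀ z, (Q z).IsHermitian) :
    meanQ2 Q = (mean (halfTrace Q) : ℂ) • (1 : Matrix (Fin 2) (Fin 2) ℂ)
      + (mean (fun t => (Q t 0 1).im) : ℂ) • sigma2 := by
  rw [meanQ2, show Q2 Q = _ from funext (Q2_eq hherm), matrixIntegral_smul_one_add_smul_sigma2,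
    smul_add, smul_smul, smul_smul, mean, mean]
  push_cast
  rfl

/-- The gauge matrix is a scalar multiple of a rotation by the gauge angle. -/
theorem gaugeMatrix_eq (hherm : ∀ z, (Q z).IsHermitian) (z : ℝ) :
    ∃ e : ℂ, e ≠ 0 ∧ gaugeMatrix Q z
      = e • (Complex.cos (angle Q z) • 1 + Complex.sin (angle Q z) • J) := by
  -- As `J σ₂ = -i`, the `Im q` part contributes only the scalar `exp (-i g)`. It cancels under
  -- conjugation, so all that matters later is that it is nonzero.
  set g : ℝ := ∫ t in (0 : ℝ)..z, ((Q t 0 1).im - mean fun t => (Q t 0 1).im) with hg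
  refine ⟨Complex.exp (-(Complex.I * g)), Complex.exp_ne_zero _, ?_⟩
  have h1 : (fun t => Q2 Q t - meanQ2 Q) = fun t =>
      ((halfTrace Q t - mean (halfTrace Q) : ℝ) : ℂ) • (1 : Matrix (Fin 2) (Fin 2) ℂ)
        + (((Q t 0 1).im - mean fun t => (Q t 0 1).im : ℝ) : ℂ) • sigma2 := by
    funext t
    rw [Q2_eq hherm, meanQ2_eq hherm]
    push_cast
    rw [sub_smul, sub_smul]
    abel
  rw [← exp_smul_J_sub, gaugeMatrix, h1, matrixIntegral_smul_one_add_smul_sigma2, ← hg, ← angle]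
  congr 1
  ext i j
  fin_cases i <;> fin_cases j <;> simp [J, sigma2, Matrix.mul_apply, mul_comm]

theorem transformedPotential_eq (hherm : ∀ z, (Q z).IsHermitian)
    (hQ : ∀ i j x y, IntervalIntegrable (fun z => Q z i j) volume x y) (z : ℝ) :
    transformedPotential Q z = ((gaugedPotential Q hQ).v z : ℂ) • sigma1
      + ((gaugedPotential Q hQ).w z : ℂ) • sigma3 + meanQ2 Q := by
  obtain ⟨e, he, hR⟩ := gaugeMatrix_eq hherm z
  rw [transformedPotential, Q1_eq hherm, rotation_conj he _ _ _ hR]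
  rfl

theorem angle_pi (hQ : ∀ i j x y, IntervalIntegrable (fun z => Q z i j) volume x y) :
    angle Q Real.pi = 0 :=
  integral_sub_mean (intervalIntegrable_halfTrace hQ _ _)

/-- The increment of the gauge angle over a period of `Q`. -/
theorem angle_const_add (hQ : ∀ i j x y, IntervalIntegrable (fun z => Q z i j) volume x y) {s : ℝ}
    (hs : ∀ᵐ z, Q (z + s) = Q z) (x : ℝ) : angle Q (s + x) = angle Q x + angle Q s := by
  have h := (((angle_hasAEDeriv hQ).comp_const_add s).sub (angle_hasAEDeriv hQ)).congr
    (g := fun _ => 0) (by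
      filter_upwards [hs] with z hz
      rw [add_comm s z]
      simp only [halfTrace, hz, sub_self])
  have h0 := h.eq_of_zero x 0
  simp only [add_zero, angle_zero, sub_zero] at h0
  linarith

theorem angle_periodic (hper : Function.Periodic Q Real.pi)
    (hQ : ∀ i j x y, IntervalIntegrable (fun z => Q z i j) volume x y) :
    Function.Periodic (angle Q) Real.pi := fun z => by
  rw [add_comm, angle_const_add hQ (Eventually.of_forall hper), angle_pi hQ, add_zero]

/-- At `π` the rotation is trivial because the angle integrates a function of mean zero. The gauge
then contributes only the scalar `exp (i ∫ Im q)`, the inverse of `phase Q`. -/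
theorem discriminant_add_eq (hherm : ∀ z, (Q z).IsHermitian)
    (hper : Function.Periodic Q Real.pi)
    (hint : ∀ i j, IntegrableOn (fun z => Q z i j) (Ico 0 Real.pi)) (lam : ℂ) :
    discriminant Q lam + 2 * phase Q = phase Q *
      (((gaugedPotential Q (intervalIntegrable_entry hper hint)).sol
        (lam - mean (halfTrace Q)) Real.pi).trace + 2) := by
  rw [← gauge_mul_isFundamentalMatrix hherm (intervalIntegrable_entry hper hint)
    (isFundamentalMatrix_fundamentalMatrix Q hper hint lam) Real.pi,
    angle_pi (intervalIntegrable_entry hper hint), Matrix.trace_smul, mul_add]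
  have h : phase Q * Complex.exp (Complex.I * (∫ t in (0 : ℝ)..Real.pi, (Q t 0 1).im : ℝ)) = 1 := by
    rw [phase, ← Complex.exp_add, neg_mul, neg_add_cancel, Complex.exp_zero]
  rw [smul_eq_mul, ← mul_assoc, h]
  simp [discriminant, mul_comm]

theorem onlyDoubleZeros_iff (hherm : ∀ z, (Q z).IsHermitian)
    (hper : Function.Periodic Q Real.pi)
    (hint : ∀ i j, IntegrableOn (fun z => Q z i j) (Ico 0 Real.pi)) :
    OnlyDoubleZeros (fun lam => discriminant Q lam + 2 * phase Q) ↔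
      OnlyDoubleZeros (fun mu => ((gaugedPotential Q (intervalIntegrable_entry hper hint)).sol
        mu Real.pi).trace + 2) := by
  set V := gaugedPotential Q (intervalIntegrable_entry hper hint)
  have hp : phase Q ≠ 0 := Complex.exp_ne_zero _
  have hord : ∀ lam : ℂ, analyticOrderAt (fun lam => discriminant Q lam + 2 * phase Q) lam
      = analyticOrderAt (fun mu => (V.sol mu Real.pi).trace + 2) (lam - mean (halfTrace Q)) := by
    intro lam
    rw [← analyticOrderAt_const_mul_comp_sub
      ((V.differentiable_trace Real.pi_pos.le).add_const 2) hp]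
    congr 1
    funext x
    exact discriminant_add_eq hherm hper hint x
  constructor
  · intro h mu hmu
    have h1 := hord (mu + mean (halfTrace Q))
    rw [add_sub_cancel_right] at h1
    rw [← h1]
    refine h _ ?_
    refine (discriminant_add_eq hherm hper hint _).trans ?_
    rw [add_sub_cancel_right]
    exact mul_eq_zero_of_right _ hmu
  · intro h lam hlam
    rw [hord]
    exact h _ ((mul_eq_zero.1 ((discriminant_add_eq hherm hper hint _).symm.trans hlam)).resolve_left
      hp)

end Gauge

end DiracSystem

open DiracSystem MeasureTheory in
theorem theorem5p1 (Q : ℝ → Matrix (Fin 2) (Fin 2) ℂ)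
    (hherm : ∀ z, (Q z).IsHermitian)
    (hper : Function.Periodic Q Real.pi)
    (hint : ∀ i j, MeasureTheory.IntegrableOn (fun z => Q z i j) (Set.Ico 0 Real.pi)) :
    ((∀ᵐ z : ℝ, Q (z + Real.pi / 2) = Q z) →
      DiracSystem.OnlyDoubleZeros
        (fun lam => DiracSystem.discriminant Q lam + 2 * DiracSystem.phase Q)) ∧
    (DiracSystem.OnlyDoubleZeros
        (fun lam => DiracSystem.discriminant Q lam + 2 * DiracSystem.phase Q) →
      ∀ᵐ z : ℝ, DiracSystem.transformedPotential Q (z + Real.pi / 2)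
        = DiracSystem.transformedPotential Q z) := by
  have hQ := intervalIntegrable_entry hper hint
  rw [onlyDoubleZeros_iff hherm hper hint]
  refine ⟨fun h lam h0 => ?_, fun h => ?_⟩
  -- Two half-period increments of the angle add up to `angle Q π = 0`, so each is zero and the
  -- gauged potential inherits the half-period of `Q`.
  · have hangle : ∀ x, angle Q (Real.pi / 2 + x) = angle Q x := by
      intro x
      have h1 := angle_const_add hQ h (Real.pi / 2)
      rw [add_halves, angle_pi hQ] at h1
      rw [angle_const_add hQ h]
      linarith
    refine (gaugedPotential Q hQ).analyticOrderAt_trace_add_two_of_shift ?_ ?_ h0 <;>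
    · filter_upwards [h] with z hz
      rw [add_comm] at hz
      simp only [gaugedPotential, Potential.shift, hangle, halfDiff, hz]
  · have h1 := (gaugedPotential Q hQ).ae_eq_shift_of_double_zeros h
    have h2 : Function.Periodic (fun z => ((gaugedPotential Q hQ).v z, (gaugedPotential Q hQ).w z))
        (2 * (Real.pi / 2)) := by
      intro z
      rw [mul_div_cancel₀ Real.pi two_ne_zero]
      simp only [gaugedPotential, halfDiff, hper z, angle_periodic hper hQ z]
    have h3 := ae_eq_translate_of_periodic Real.pi_div_two_pos h2 (by
      filter_upwards [h1] with t ht hI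
      exact Prod.ext (ht hI).1 (ht hI).2)
    filter_upwards [h3] with z hz
    rw [Prod.mk.injEq] at hz
    rw [transformedPotential_eq hherm hQ, transformedPotential_eq hherm hQ, hz.1, hz.2]
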